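/- Let $V$ be an $n$-dimensional real inner product space, $E\subset V$ a finite set of unit vectors, $H_e=\{x:(e,x)=0\}$, and let $\mathcal H=\{H_e: e\in E\}$. Assume that there is a chamber (connected component of the complement of $\bigcup_e H_e$) $T_0$ on which $(e,\cdot)>0$ for all $e\in E$; it is the base chamber. More generally, for an arrangement $\mathcal A$ of linear hyperplanes in a subspace $L$ of $V$ with a base chamber, the sign $(-1)^T$ of a chamber $T$ is $-1$ to the number of hyperplanes of $\mathcal A$ separating $T$ from the base chamber, and the pizza quantity of $S\subseteq L$ is $P(\mathcal A,S)=\sum_T(-1)^T\,\mathrm{Vol}_L(S\cap T)$, the sum being over the chambers $T$ of $\mathcal A$. *Even restriction.* For $M\in\mathcal A$, the restricted arrangement on $M$ consists of the $M\cap M'$ with $M'\in\mathcal A$, $M'\neq M$, and the even restricted arrangement consists of those $M\cap M'$ that are contained in an even number of hyperplanes of $\mathcal A$. The empty sequence is an even restriction sequence, with $\mathcal H_\emptyset=\mathcal H$; a sequence $(e_1,\dots,e_r)\in E^r$ is one if $(e_1,\dots,e_{r-1})$ is one and $H_{e_1,\dots,e_r}:=H_{e_1}\cap\dots\cap H_{e_r}$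 is a hyperplane of $\mathcal H_{e_1,\dots,e_{r-1}}$, and then $\mathcal H_{e_1,\dots,e_r}$ is the even restricted arrangement of $\mathcal H_{e_1,\dots,e_{r-1}}$ on $H_{e_1,\dots,e_r}$. Let $P_r$ be the set of even restriction sequences of length $r$, and $P$ the set of maximal ones (those that no $e\in E$ extends). Write $(e_1,\dots,e_r)\sim(f_1,\dots,f_r)$ if $H_{e_1,\dots,e_i}=H_{f_1,\dots,f_i}$ for all $i$. $\mathcal H$ is even if, for every even restriction sequence, the hyperplanes of $\mathcal H_{e_1,\dots,e_r}$ intersect in $\{0\}$ (for $r=n$, where the arrangement is empty, in the space $H_{e_1,\dots,e_n}=\{0\}$). A Lebesgue measurable set $K\subseteq V$ of finite volume is sufficiently symmetric if, for every non-maximal even restriction sequence $(e_1,\dots,e_r)$ and every $a\in H_{e_1,\dots,e_r}^\perp$ such that $(K+a)\cap H_{e_1,\dots,e_r}$ is measurable of finite volume in $H_{e_1,\dots,e_r}$, one has $P(\mathcal H_{e_1,\dots,e_r},(K+a)\cap H_{e_1,\dots,e_r})=0$ (for any base chamber). *Terms.* Let $\pi_{e_1,\dots,e_i}$ be the orthogonal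 projection on $H_{e_1,\dots,e_i}$ (the identity for $i=0$). For an even restriction sequence let $\nu_i=\pi_{e_1,\dots,e_{i-1}}(e_i)/\|\pi_{e_1,\dots,e_{i-1}}(e_i)\|$, the unit normal of $H_{e_1,\dots,e_i}$ in $H_{e_1,\dots,e_{i-1}}$ on the side of $e_i$ (so $\nu_i=e_i$ if $e_i$ is orthogonal to $e_1,\dots,e_{i-1}$). For $s=(e_1,\dots,e_r)\in P$, let $(-1)^{e_r\circ\dots\circ e_1}$ be the sign of any chamber of $\mathcal H$ obtained as follows: put $Z_r=H_{e_1,\dots,e_r}$; for $i=r,\dots,1$ choose a chamber $U\subseteq Z_i$ of the restricted arrangement of $\mathcal H_{e_1,\dots,e_{i-1}}$ on $H_{e_1,\dots,e_i}$, and let $Z_{i-1}$ be the chamber of $\mathcal H_{e_1,\dots,e_{i-1}}$ that contains $x+\varepsilon\nu_i$ for all $x\in U$ and all small enough $\varepsilon>0$; the chamber is $Z_0$. For $a\in V$ put $$c_s(a)=(-1)^{e_r\circ\dots\circ e_1}\prod_{i=1}^r(\pi_{e_1,\dots,e_{i-1}}(a),\nu_i),\qquad d_i=\pi_{e_1,\dots,e_{i-1}}(a)-\pi_{e_1,\dots,e_i}(a).$$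 Then: 1. $c_s(a)$ depends only on $a$ and on the class of $s\in P$ in $P/\!\sim$. 2. If $K\subseteq V$ is Lebesgue measurable of finite volume and sufficiently symmetric, then for every $a\in V$ $$P(\mathcal H,K+a)=\sum_{s=(e_1,\dots,e_r)\in P/\sim}2^r\,c_s(a)\int_0^1\!\int_0^{t_1}\!\!\cdots\int_0^{t_{r-1}}\mathrm{Vol}_{H_{e_1,\dots,e_r}}\bigl(H_{e_1,\dots,e_r}\cap(K+t_1d_1+\dots+t_rd_r)\bigr)\,dt_r\cdots dt_1 .$$ 3. If $\mathcal H$ is even, then $$f_{\mathcal H}(a)=\frac{2^n}{n!}\sum_{s\in P_n/\sim}c_s(a)$$ is a homogeneous polynomial function of degree $n$ on $V$. If moreover $K\subseteq V$ is Lebesgue measurable of finite volume and sufficiently symmetric, and $a\in V$ is such that $-(t_1d_1+\dots+t_nd_n)\in K$ for all $(e_1,\dots,e_n)\in P_n$ and all $0\le t_n\le\dots\le t_1\le1$, then $P(\mathcal H,K+a)=f_{\mathcal H}(a)$. The same equality holds if, instead of this containment condition, $K$ is convex of positive volume and $0\in K+a$. -/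

import Mathlib

open MeasureTheory Set Filter Topology
open scoped RealInnerProductSpace

noncomputable section

namespace Pizza

/-! ### Volumes -/

/-- Lebesgue measure on a Euclidean space: the cube spanned by any orthonormal basis has measure
`1` (in dimension `0` this is the unit mass at `0`). -/
def lebesgue (W : Type*) [NormedAddCommGroup W] [InnerProductSpace ℝ W] [FiniteDimensional ℝ W]
    [MeasurableSpace W] [BorelSpace W] : Measure W := volume

variable {V : Type*} [NormedAddCommGroup V] [InnerProductSpace ℝ V]

/-- The Lebesgue measure of the subspace `L` (with the induced inner product), viewed
as a measure on `V` carried by `L`: `volOn L S` is the volume of `S ∩ L` inside `L`. -/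
def volOn [FiniteDimensional ℝ V] [MeasurableSpace V] [BorelSpace V]
    (L : Submodule ℝ V) : Measure V := (lebesgue L).map (fun x : L => (x : V))

/-- The translate `K + a`. -/
def translateSet (K : Set V) (a : V) : Set V := (fun x => x + a) '' K

/-! ### Arrangements, chambers, pizza quantity

An arrangement in a subspace `L` of `V` is given by its set `A` of hyperplanes: these are
subspaces of `V` that are contained in `L` and have codimension one in `L`. -/

/-- The hyperplane `H_e = {x : ⟪e, x⟫ = 0}`. -/
def hyp (e : V) : Submodule ℝ V := (Submodule.span ℝ {e})ᗮ

/-- The arrangement `{H_e : e ∈ E}` in `V`. -/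
def arr (E : Finset V) : Set (Submodule ℝ V) := hyp '' (E : Set V)

/-- The set of points lying on the positive side of all the `H_e`. -/
def baseChamber (E : Finset V) : Set V := {x | ∀ e ∈ E, 0 < ⟪e, x⟫}

/-- The complement in `L` of the union of the hyperplanes of `A`. -/
def complementIn (L : Submodule ℝ V) (A : Set (Submodule ℝ V)) : Set V :=
  (L : Set V) \ ⋃ M ∈ A, (M : Set V)

/-- The chambers of the arrangement `A` in `L`: the connected components of the complement. -/
def chambers (L : Submodule ℝ V) (A : Set (Submodule ℝ V)) : Set (Set V) :=
  {T | ∃ x ∈ complementIn L A, T = connectedComponentIn (complementIn L A) x}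

/-- The hyperplanes of `A` having `T₁` and `T₂` on different sides. -/
def sepSet (A : Set (Submodule ℝ V)) (T₁ T₂ : Set V) : Set (Submodule ℝ V) :=
  {M ∈ A | ∃ x ∈ T₁, ∃ y ∈ T₂, M.toAffineSubspace.SOppSide x y}

/-- The sign `(-1) ^ |S(T₀, T)|` of the chamber `T` with respect to the base chamber `T₀`. -/
def chamberSign (A : Set (Submodule ℝ V)) (T₀ T : Set V) : ℝ := (-1) ^ (sepSet A T₀ T).ncard

/-- The pizza quantity of `K ∩ L` for the arrangement `A` in `L` with base chamber `T₀`: the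
alternating sum of the volumes (in `L`) of the `K ∩ T`, over the finitely many chambers `T`. -/
def pizza [FiniteDimensional ℝ V] [MeasurableSpace V] [BorelSpace V]
    (L : Submodule ℝ V) (A : Set (Submodule ℝ V)) (T₀ : Set V) (K : Set V) : ℝ :=
  ∑ᶠ T ∈ chambers L A, chamberSign A T₀ T * (volOn L).real (K ∩ T)

/-! ### Restrictions and even restriction sequences -/

/-- The restriction of the arrangement `A` to its hyperplane `M`. -/
def restriction (A : Set (Submodule ℝ V)) (M : Submodule ℝ V) : Set (Submodule ℝ V) :=
  {N | ∃ M' ∈ A, M' ≠ M ∧ N = M ⊓ M'}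

/-- The even restricted arrangement of `A` on its hyperplane `M`: the members of the restriction
that are contained in an even number of hyperplanes of `A`. -/
def evenRestriction (A : Set (Submodule ℝ V)) (M : Submodule ℝ V) : Set (Submodule ℝ V) :=
  {N ∈ restriction A M | Even {M' ∈ A | N ≤ M'}.ncard}

/-- `L ∩ H_{e₁} ∩ ⋯ ∩ H_{eᵣ}`. -/
def flagSpace : Submodule ℝ V → List V → Submodule ℝ V
  | L, [] => L
  | L, e :: s => flagSpace (L ⊓ hyp e) s

/-- The even restriction sequences with entries in `E`, starting from the arrangement `A` in `L`:
at each step, the current subspace is cut by `H_e`, the result has to be a hyperplane of the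
current arrangement, and the even restricted arrangement on it is the next arrangement. -/
def IsEvenSeq (E : Finset V) : Submodule ℝ V → Set (Submodule ℝ V) → List V → Prop
  | _, _, [] => True
  | L, A, e :: s => e ∈ E ∧ L ⊓ hyp e ∈ A ∧
      IsEvenSeq E (L ⊓ hyp e) (evenRestriction A (L ⊓ hyp e)) s

/-- The arrangement in `flagSpace L s` reached from the arrangement `A` in `L` by the iterated
even restrictions along `s`. -/
def flagArr : Submodule ℝ V → Set (Submodule ℝ V) → List V → Set (Submodule ℝ V)
  | _, A, [] => A
  | L, A, e :: s => flagArr (L ⊓ hyp e) (evenRestriction A (L ⊓ hyp e)) s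

/-- The set of all even restriction sequences of the arrangement defined by `E`. -/
def evenSeqs (E : Finset V) : Set (List V) := {s | IsEvenSeq E ⊤ (arr E) s}

/-- `P_r`: the even restriction sequences of length `r`. -/
def evenSeqsOfLength (E : Finset V) (r : ℕ) : Set (List V) := {s ∈ evenSeqs E | s.length = r}

/-- `P`: the maximal even restriction sequences. -/
def maxEvenSeqs (E : Finset V) : Set (List V) :=
  {s ∈ evenSeqs E | ∀ e ∈ E, s ++ [e] ∉ evenSeqs E}

/-- The arrangement is even: all the arrangements reached by even restriction sequences are
essential, i.e. their hyperplanes have intersection `0`. -/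
def IsEvenArr (E : Finset V) : Prop :=
  ∀ s ∈ evenSeqs E, flagSpace ⊤ s ⊓ sInf (flagArr ⊤ (arr E) s) = ⊥

/-- Sufficiently symmetric sets. (A non-maximal even restriction sequence automatically has
length less than `dim V`. The vanishing is required for those slices whose pizza quantity is
defined, and it does not depend on the base chamber `T₀`.) -/
def SuffSymm [FiniteDimensional ℝ V] [MeasurableSpace V] [BorelSpace V]
    (E : Finset V) (K : Set V) : Prop :=
  ∀ s ∈ evenSeqs E, s ∉ maxEvenSeqs E → ∀ a ∈ (flagSpace ⊤ s)ᗮ,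
    NullMeasurableSet (translateSet K a) (volOn (flagSpace ⊤ s)) →
    volOn (flagSpace ⊤ s) (translateSet K a) ≠ ⊤ →
    ∀ T₀ ∈ chambers (flagSpace ⊤ s) (flagArr ⊤ (arr E) s),
      pizza (flagSpace ⊤ s) (flagArr ⊤ (arr E) s) T₀ (translateSet K a) = 0

/-! ### The sum over classes of sequences -/

/-- The equivalence `(e₁,…,eᵣ) ∼ (f₁,…,fᵣ)`: `H_{e₁,…,eᵢ} = H_{f₁,…,fᵢ}` for all `i`. -/
def flagSetoid (V : Type*) [NormedAddCommGroup V] [InnerProductSpace ℝ V] : Setoid (List V) where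
  r s s' := s.length = s'.length ∧ ∀ i, flagSpace ⊤ (s.take i) = flagSpace ⊤ (s'.take i)
  iseqv := ⟨fun _ => ⟨rfl, fun _ => rfl⟩, fun h => ⟨h.1.symm, fun i => (h.2 i).symm⟩,
    fun h h' => ⟨h.1.trans h'.1, fun i => (h.2 i).trans (h'.2 i)⟩⟩

/-- The sum of `F` over `P/∼`, computed with a representative of each class. -/
def sumMod (P : Set (List V)) (F : List V → ℝ) : ℝ :=
  ∑ᶠ c : Quotient ((flagSetoid V).comap (fun s : P => (s : List V))), F (c.out : P)

/-- The orthogonal projection of `x` on `L`. -/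
def proj [FiniteDimensional ℝ V] (L : Submodule ℝ V) (x : V) : V := L.starProjection x

/-- For `L ∩ H_e` a hyperplane of `L`: its unit normal vector in `L` on the same side as `e`, that
is, the normalized projection of `e` on `L`. It is `e` itself if `e` is a unit vector of `L`. -/
def unitNormal [FiniteDimensional ℝ V] (L : Submodule ℝ V) (e : V) : V :=
  ‖proj L e‖⁻¹ • proj L e

/-- `T` is a chamber `Z ∘ eᵣ ∘ ⋯ ∘ e₁` of the arrangement `A` in `L`, where `Z` is the last
subspace `L ∩ H_{e₁} ∩ ⋯ ∩ H_{eᵣ}`. At each step, one passes from a chamber `Z` of the even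
restricted arrangement on `L ∩ H_e` to a chamber `U ⊆ Z` of the restricted arrangement, and then
to the chamber `T = U ∘ e` of `A` containing `x + ε n` for `x ∈ U` and small `ε > 0`,
with `n` the unit normal of `L ∩ H_e` in `L`. -/
def IsFlagChamber [FiniteDimensional ℝ V] :
    Submodule ℝ V → Set (Submodule ℝ V) → List V → Set V → Prop
  | L, _, [], T => T = (L : Set V)
  | L, A, e :: s, T => T ∈ chambers L A ∧ ∃ Z U : Set V,
      IsFlagChamber (L ⊓ hyp e) (evenRestriction A (L ⊓ hyp e)) s Z ∧
      U ∈ chambers (L ⊓ hyp e) (restriction A (L ⊓ hyp e)) ∧ U ⊆ Z ∧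
      ∀ x ∈ U, ∀ᶠ ε : ℝ in 𝓝[>] 0, x + ε • unitNormal L e ∈ T

/-- The sign `(-1) ^ (eᵣ ∘ ⋯ ∘ e₁)` of a maximal even restriction sequence: the sign of any
chamber `Z ∘ eᵣ ∘ ⋯ ∘ e₁`. -/
def seqSign [FiniteDimensional ℝ V] (E : Finset V) (s : List V) : ℝ :=
  chamberSign (arr E) (baseChamber E)
    (Classical.epsilon fun T => IsFlagChamber ⊤ (arr E) s T)

/-- `⟪π_L a, n₁⟫ ⟪π_{L ∩ H_{e₁}} a, n₂⟫ ⋯ ⟪π_{L ∩ H_{e₁,…,eᵣ₋₁}} a, nᵣ⟫`, where `nᵢ` is the unit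
normal of `L ∩ H_{e₁,…,eᵢ}` in `L ∩ H_{e₁,…,eᵢ₋₁}`. -/
def normalProd [FiniteDimensional ℝ V] (a : V) : Submodule ℝ V → List V → ℝ
  | _, [] => 1
  | L, e :: s => ⟪proj L a, unitNormal L e⟫ * normalProd a (L ⊓ hyp e) s

/-- `t₁ (π_L a - π_{L ∩ H_{e₁}} a) + ⋯ + tᵣ (π_{L ∩ H_{e₁,…,eᵣ₋₁}} a - π_{L ∩ H_{e₁,…,eᵣ}} a)`. -/
def shift [FiniteDimensional ℝ V] (a : V) : Submodule ℝ V → List V → List ℝ → V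
  | L, e :: s, t :: ts => t • (proj L a - proj (L ⊓ hyp e) a) + shift a (L ⊓ hyp e) s ts
  | _, _, _ => 0

/-- `∫_0^τ ∫_0^{t₁} ⋯ ∫_0^{tᵣ₋₁} g(t₁,…,tᵣ) dtᵣ ⋯ dt₁`. -/
def iterIntegral : ℕ → ℝ → (List ℝ → ℝ) → ℝ
  | 0, _, g => g []
  | r + 1, τ, g => ∫ t in (0 : ℝ)..τ, iterIntegral r t (fun ts => g (t :: ts))

/-- The summand attached to a maximal sequence `s = (e₁,…,eᵣ)` in the formula for
`P(H, K + a)`. -/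
def summand [FiniteDimensional ℝ V] [MeasurableSpace V] [BorelSpace V]
    (E : Finset V) (K : Set V) (a : V) (s : List V) : ℝ :=
  2 ^ s.length * seqSign E s * normalProd a ⊤ s *
    iterIntegral s.length 1 (fun t =>
      (volOn (flagSpace ⊤ s)).real (flagSpace ⊤ s ∩ translateSet K (shift a ⊤ s t)))

/-- The function `f_H`. -/
def pizzaPoly [FiniteDimensional ℝ V] (E : Finset V) (a : V) : ℝ :=
  2 ^ Module.finrank ℝ V / (Module.finrank ℝ V).factorial *
    sumMod (evenSeqsOfLength E (Module.finrank ℝ V)) (fun s => seqSign E s * normalProd a ⊤ s)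

/-- The points `-(t₁(a - π_{e₁}a) + ⋯ + tₙ(π_{e₁,…,eₙ₋₁}a - π_{e₁,…,eₙ}a))`, for
`0 ≤ tₙ ≤ ⋯ ≤ t₁ ≤ 1` and `(e₁,…,eₙ)` an even restriction sequence of length `n = dim V`,
all lie in `K`. -/
def Contains [FiniteDimensional ℝ V] (E : Finset V) (K : Set V) (a : V) : Prop :=
  ∀ s ∈ evenSeqsOfLength E (Module.finrank ℝ V), ∀ t : List ℝ, t.length = s.length →
    t.Pairwise (· ≥ ·) → (∀ x ∈ t, 0 ≤ x ∧ x ≤ 1) → -shift a ⊤ s t ∈ K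

end Pizza

end

open Pizza

set_option linter.unusedSectionVars false

noncomputable section

namespace Pizza

variable {V : Type*} [NormedAddCommGroup V] [InnerProductSpace ℝ V]

/-! ### Hyperplanes and the arrangements cut out by a finite set of vectors -/

/-! Up to a global sign, the pizza quantity of `K` is the integral over `K` of the function `sgn`,
which is ±1 on the chambers and changes sign across every hyperplane (`pizza_eq_signedVol`). Now
translate `K` by `τ • a`. For almost every `x` the segment from `x` to `x + τ • a` crosses the
hyperplanes one at a time, and `sgn` jumps by ±2 at each crossing. At a crossing point of `M` the
size and sign of the jump are governed by the product of the signs of the other hyperplanes. Those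
that cut `M` in the same `N` contribute equal relative signs, so `N` survives in the product exactly
when their number is odd, that is, when an even number of hyperplanes, `M` included, contains `N`.
The jump is therefore ±2 times the sign function of the even restricted arrangement, and the sign is
absorbed by orienting the unit normal `w` of `M` (`signedNormal`). Fubini along `a` gives
`signedVol_translateSet_sub`: the variation of the signed volume of `K + t a` for `t` from `0` to
`τ` is the sum over `M` of `2 ⟪w, a⟫` times the integral over `[0, τ]` of the signed volume of the
slice of `K + t a` by `M`.

For a sufficiently symmetric `K` the term at `t = 0` vanishes. In `M` the vector `t a` splits into
`t (a - π_M a)`, which only selects another slice of `K`, and `t π_M a`, a translation inside `M` to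
which the same formula applies with upper limit `t`. The recursion lowers the dimension and stops
when the arrangement is empty, where the signed volume is the plain, translation invariant volume.
The outcome is a sum over maximal flags of iterated integrals over `t_r ≤ ⋯ ≤ t_1`
(`signedVol_translateSet_eq_finsum`). Replacing `w` by the normal on the side of `e` costs the same
sign κ in the normal product and in the chamber sign, so the product of the two is unchanged
(`IsFlagChamber.sgn_mul_normalProd`). It thus depends on the flag only, which is the first
assertion.

If the arrangement is even, the maximal flags are those that reach `{0}` in `n` steps. Under the
containment condition every slice is the point `0`, of volume `1`, and the simplex contributes
`1/n!`.

For convex `K`, containment is proved for `-a` in the interior. Slices of `K` parallel to a line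
reached by an even restriction sequence are intervals balanced about `0`, so the closure of `K` is
invariant under the reflections along these lines (`reflect_mem_closure`). By evenness such lines
span every space of a flag (`inner_eq_zero_of_lines`), so `-a` may be projected off these spaces
without leaving `K` (`sub_proj_mem_of_reflect`), and the required points are convex combinations of
the projections. Boundary points follow by continuity in `a`. -/

lemma mem_hyp {e x : V} : x ∈ hyp e ↔ ⟪e, x⟫ = 0 :=
  Submodule.mem_orthogonal_singleton_iff_inner_right

lemma mem_inf_hyp {L : Submodule ℝ V} {e x : V} : x ∈ L ⊓ hyp e ↔ x ∈ L ∧ ⟪e, x⟫ = 0 := by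
  rw [Submodule.mem_inf, mem_hyp]

/-- All members of `A` are hyperplanes of `L` of the form `L ∩ H_e` with `e ∈ E`. -/
def IsGen (E : Finset V) (L : Submodule ℝ V) (A : Set (Submodule ℝ V)) : Prop :=
  ∀ M ∈ A, ∃ e ∈ E, M = L ⊓ hyp e ∧ ¬ L ≤ hyp e

lemma sOppSide_iff {L : Submodule ℝ V} {e x y : V} (hx : x ∈ L) (hy : y ∈ L) :
    (L ⊓ hyp e).toAffineSubspace.SOppSide x y ↔ ⟪e, x⟫ * ⟪e, y⟫ < 0 := by
  have hmem : ∀ z ∈ L, (z ∈ (L ⊓ hyp e).toAffineSubspace ↔ ⟪e, z⟫ = 0) := fun z hz => by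
    rw [Submodule.mem_toAffineSubspace, mem_inf_hyp]; tauto
  constructor
  · intro h
    have hX : ⟪e, x⟫ ≠ 0 := fun h0 => h.left_notMem ((hmem x hx).2 h0)
    have hY : ⟪e, y⟫ ≠ 0 := fun h0 => h.right_notMem ((hmem y hy).2 h0)
    obtain ⟨p, hp, ⟨⟨t, ⟨ht0, ht1⟩, rfl⟩, -, hne⟩⟩ := h.exists_sbtw
    rw [Submodule.mem_toAffineSubspace, mem_inf_hyp] at hp
    have h1 := hp.2
    simp only [AffineMap.lineMap_apply, vsub_eq_sub, vadd_eq_add, inner_add_right,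
      inner_smul_right, inner_sub_right] at h1
    have ht : t ≠ 1 := by
      rintro rfl
      apply hY; linarith
    have ht' : 0 < 1 - t := by
      rcases lt_or_eq_of_le ht1 with h | h
      · linarith
      · exact absurd h ht
    by_contra hcon
    push Not at hcon
    have hX2 : 0 < ⟪e, x⟫ * ⟪e, x⟫ := mul_self_pos.2 hX
    have : (1 - t) * (⟪e, x⟫ * ⟪e, x⟫) + t * (⟪e, x⟫ * ⟪e, y⟫) = 0 := by
      linear_combination ⟪e, x⟫ * h1
    nlinarith [mul_pos ht' hX2, mul_nonneg ht0 hcon]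
  · intro h
    have hX : ⟪e, x⟫ ≠ 0 := by rintro h0; simp [h0] at h
    have hY : ⟪e, y⟫ ≠ 0 := by rintro h0; simp [h0] at h
    have hXY : ⟪e, x⟫ - ⟪e, y⟫ ≠ 0 := by
      intro h0
      have : ⟪e, x⟫ = ⟪e, y⟫ := by linarith
      rw [this] at h; nlinarith [mul_self_nonneg ⟪e, y⟫]
    set t := ⟪e, x⟫ / (⟪e, x⟫ - ⟪e, y⟫) with ht
    have hpz : ⟪e, AffineMap.lineMap x y t⟫ = 0 := by
      simp only [AffineMap.lineMap_apply, vsub_eq_sub, vadd_eq_add, inner_add_right,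
        inner_smul_right, inner_sub_right, ht]
      field_simp
      ring
    have hpL : AffineMap.lineMap x y t ∈ L := by
      simp only [AffineMap.lineMap_apply, vsub_eq_sub, vadd_eq_add]
      exact L.add_mem (L.smul_mem _ (L.sub_mem hy hx)) hx
    have hxy : x ≠ y := by rintro rfl; exact hXY (sub_self _)
    have ht01 : t ∈ Set.Ioo (0 : ℝ) 1 := by
      rcases lt_or_gt_of_ne hX with h1 | h1
      · have h2 : 0 < ⟪e, y⟫ := by
          by_contra hc; push Not at hc; nlinarith [mul_nonneg_of_nonpos_of_nonpos h1.le hc]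
        exact ⟨div_pos_of_neg_of_neg h1 (by linarith), by
          rw [ht, div_lt_one_of_neg (by linarith)]; linarith⟩
      · have h2 : ⟪e, y⟫ < 0 := by
          by_contra hc; push Not at hc; nlinarith [mul_nonneg h1.le hc]
        exact ⟨div_pos h1 (by linarith), by rw [ht, div_lt_one (by linarith)]; linarith⟩
    exact (sbtw_lineMap_iff.2 ⟨hxy, ht01⟩).sOppSide_of_notMem_of_mem
      (fun h0 => hX ((hmem x hx).1 h0)) ((hmem _ hpL).2 hpz)

/-- Both sides have codimension one in `L`. Concretely, a vector `x` of `L` off `H_{e'}` is also off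
`H_e`, and subtracting a multiple of `x` moves any point into `H_e`. -/
lemma inf_hyp_eq_of_le {L : Submodule ℝ V} {e e' : V} (hle : L ⊓ hyp e ≤ L ⊓ hyp e')
    (h : ¬ L ≤ hyp e') : L ⊓ hyp e = L ⊓ hyp e' := by
  refine le_antisymm hle fun y hy => ?_
  obtain ⟨x, hx, hx'⟩ := SetLike.not_le_iff_exists.1 h
  rw [mem_hyp] at hx'
  rw [mem_inf_hyp] at hy ⊢
  refine ⟨hy.1, ?_⟩
  have hex : ⟪e, x⟫ ≠ 0 := fun h0 => hx' (mem_inf_hyp.1 (hle (mem_inf_hyp.2 ⟨hx, h0⟩))).2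
  have h1 : y - (⟪e, y⟫ / ⟪e, x⟫) • x ∈ L ⊓ hyp e := by
    rw [mem_inf_hyp]
    refine ⟨L.sub_mem hy.1 (L.smul_mem _ hx), ?_⟩
    rw [inner_sub_right, inner_smul_right]
    field_simp
    ring
  have h2 := (mem_inf_hyp.1 (hle h1)).2
  rw [inner_sub_right, inner_smul_right, hy.2, zero_sub, neg_eq_zero] at h2
  rcases mul_eq_zero.1 h2 with h3 | h3
  · rcases div_eq_zero_iff.1 h3 with h4 | h4
    · exact h4
    · exact absurd h4 hex
  · exact absurd h3 hx'

lemma IsGen.finite {E : Finset V} {L : Submodule ℝ V} {A : Set (Submodule ℝ V)}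
    (h : IsGen E L A) : A.Finite := by
  refine (E.finite_toSet.image (fun e => L ⊓ hyp e)).subset fun M hM => ?_
  obtain ⟨e, he, rfl, -⟩ := h M hM
  exact ⟨e, he, rfl⟩

lemma IsGen.lt {E : Finset V} {L M : Submodule ℝ V} {A : Set (Submodule ℝ V)}
    (h : IsGen E L A) (hM : M ∈ A) : M < L := by
  obtain ⟨e, -, rfl, he⟩ := h M hM
  exact lt_of_le_of_ne inf_le_left fun h => he (inf_eq_left.1 h)

lemma IsGen.le {E : Finset V} {L M : Submodule ℝ V} {A : Set (Submodule ℝ V)}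
    (h : IsGen E L A) (hM : M ∈ A) : M ≤ L := (h.lt hM).le

lemma IsGen.eq_of_le {E : Finset V} {L M M' : Submodule ℝ V} {A : Set (Submodule ℝ V)}
    (h : IsGen E L A) (hM : M ∈ A) (hM' : M' ∈ A) (hle : M ≤ M') : M = M' := by
  obtain ⟨e, -, rfl, he⟩ := h M hM
  obtain ⟨e', -, rfl, he'⟩ := h M' hM'
  exact inf_hyp_eq_of_le hle he'

lemma IsGen.restriction {E : Finset V} {L M : Submodule ℝ V} {A : Set (Submodule ℝ V)}
    (h : IsGen E L A) (hM : M ∈ A) : IsGen E M (restriction A M) := by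
  rintro N ⟨M', hM', hne, rfl⟩
  obtain ⟨e', he', hM'e, -⟩ := h M' hM'
  refine ⟨e', he', ?_, fun hle => hne ?_⟩
  · rw [hM'e, ← inf_assoc, inf_eq_left.2 (h.le hM)]
  · exact (h.eq_of_le hM hM' (by rw [hM'e]; exact le_inf (h.le hM) hle)).symm

lemma evenRestriction_subset (A : Set (Submodule ℝ V)) (M : Submodule ℝ V) :
    evenRestriction A M ⊆ restriction A M := fun _ h => h.1

lemma IsGen.mono {E : Finset V} {L : Submodule ℝ V} {A B : Set (Submodule ℝ V)}
    (h : IsGen E L A) (hB : B ⊆ A) : IsGen E L B := fun M hM => h M (hB hM)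

lemma IsGen.evenRestriction {E : Finset V} {L M : Submodule ℝ V} {A : Set (Submodule ℝ V)}
    (h : IsGen E L A) (hM : M ∈ A) : IsGen E M (evenRestriction A M) :=
  (h.restriction hM).mono (evenRestriction_subset A M)

lemma isGen_arr {E : Finset V} (hE : ∀ e ∈ E, ‖e‖ = 1) : IsGen E ⊤ (arr E) := by
  rintro M ⟨e, he, rfl⟩
  refine ⟨e, he, by simp, fun h => ?_⟩
  have := mem_hyp.1 (h (Submodule.mem_top : e ∈ ⊤))
  rw [real_inner_self_eq_norm_sq, hE e he] at this
  norm_num at this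

/-- Different vectors of `E` may cut `L` in the same hyperplane. Fixing one normal per member turns
signs into products indexed by the hyperplanes themselves. -/
lemma IsGen.exists_rep {E : Finset V} {L : Submodule ℝ V} {A : Set (Submodule ℝ V)}
    (h : IsGen E L A) :
    ∃ r : Submodule ℝ V → V, ∀ M ∈ A, r M ∈ E ∧ M = L ⊓ hyp (r M) ∧ ¬ L ≤ hyp (r M) := by
  choose! r hr using h
  exact ⟨r, fun M hM => ⟨(hr M hM).1, (hr M hM).2⟩⟩

/-! ### Points of the complement and signs -/

lemma mem_complementIn {L : Submodule ℝ V} {A : Set (Submodule ℝ V)} {x : V} :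
    x ∈ complementIn L A ↔ x ∈ L ∧ ∀ M ∈ A, x ∉ M := by
  simp [complementIn]

lemma complementIn_anti {L : Submodule ℝ V} {A B : Set (Submodule ℝ V)} (h : B ⊆ A) :
    complementIn L A ⊆ complementIn L B := fun x hx => by
  rw [mem_complementIn] at hx ⊢
  exact ⟨hx.1, fun M hM => hx.2 M (h hM)⟩

lemma inner_ne_zero_of_notMem {L : Submodule ℝ V} {e x : V} (hx : x ∈ L) (h : x ∉ L ⊓ hyp e) :
    ⟪e, x⟫ ≠ 0 := fun h0 => h (mem_inf_hyp.2 ⟨hx, h0⟩)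

/-- `-1` if `x` and `y` are strictly on opposite sides of `M`, and `1` otherwise. -/
def opp (M : Submodule ℝ V) (x y : V) : ℝ :=
  open Classical in if M.toAffineSubspace.SOppSide x y then -1 else 1

/-- The parity of the number of members of `A` separating `x` and `y`. -/
def relSign (A : Set (Submodule ℝ V)) (x y : V) : ℝ :=
  (-1) ^ {M ∈ A | M.toAffineSubspace.SOppSide x y}.ncard

lemma relSign_eq_prod {A : Set (Submodule ℝ V)} (hA : A.Finite) (x y : V) :
    relSign A x y = ∏ M ∈ hA.toFinset, opp M x y := by
  classical
  have : {M ∈ A | M.toAffineSubspace.SOppSide x y} =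
      ((hA.toFinset.filter fun M => M.toAffineSubspace.SOppSide x y : Finset _) : Set _) := by
    ext M; simp
  rw [relSign, this, Set.ncard_coe_finset]
  simp only [opp]
  rw [Finset.prod_ite, Finset.prod_const, Finset.prod_const_one, mul_one]

lemma opp_eq {L : Submodule ℝ V} {e x y : V} (hx : x ∈ L) (hy : y ∈ L)
    (hx' : ⟪e, x⟫ ≠ 0) (hy' : ⟪e, y⟫ ≠ 0) :
    opp (L ⊓ hyp e) x y = Real.sign ⟪e, x⟫ * Real.sign ⟪e, y⟫ := by
  rw [opp]
  simp only [sOppSide_iff hx hy]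
  rcases lt_or_gt_of_ne hx' with h1 | h1 <;> rcases lt_or_gt_of_ne hy' with h2 | h2
  · rw [if_neg (not_lt.2 (mul_pos_of_neg_of_neg h1 h2).le), Real.sign_of_neg h1,
      Real.sign_of_neg h2]; norm_num
  · rw [if_pos (mul_neg_of_neg_of_pos h1 h2), Real.sign_of_neg h1, Real.sign_of_pos h2]; norm_num
  · rw [if_pos (mul_neg_of_pos_of_neg h1 h2), Real.sign_of_pos h1, Real.sign_of_neg h2]; norm_num
  · rw [if_neg (not_lt.2 (mul_pos h1 h2).le), Real.sign_of_pos h1, Real.sign_of_pos h2]; norm_num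

lemma relSign_comm (A : Set (Submodule ℝ V)) (x y : V) : relSign A x y = relSign A y x := by
  simp only [relSign, AffineSubspace.sOppSide_comm (x := x)]

lemma relSign_self (A : Set (Submodule ℝ V)) (x : V) : relSign A x x = 1 := by
  simp [relSign, AffineSubspace.not_sOppSide_self]

lemma relSign_empty (x y : V) : relSign (∅ : Set (Submodule ℝ V)) x y = 1 := by
  simp [relSign]

lemma relSign_eq_or (A : Set (Submodule ℝ V)) (x y : V) : relSign A x y = 1 ∨ relSign A x y = -1 :=
  neg_one_pow_eq_or _ _

lemma relSign_mul_self (A : Set (Submodule ℝ V)) (x y : V) :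
    relSign A x y * relSign A x y = 1 := by
  rcases relSign_eq_or A x y with h | h <;> simp [h]

/-- Each separation sign factors into a sign at `x` and a sign at `y`. This splitting makes
`relSign` multiplicative along triples of points and, later, a ratio of values of one function. -/
lemma relSign_eq_sign {E : Finset V} {L : Submodule ℝ V} {A : Set (Submodule ℝ V)}
    (h : IsGen E L A) {r : Submodule ℝ V → V}
    (hr : ∀ M ∈ A, r M ∈ E ∧ M = L ⊓ hyp (r M) ∧ ¬ L ≤ hyp (r M)) {x y : V}
    (hx : x ∈ complementIn L A) (hy : y ∈ complementIn L A) :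
    relSign A x y = (∏ M ∈ h.finite.toFinset, Real.sign ⟪r M, x⟫) *
      ∏ M ∈ h.finite.toFinset, Real.sign ⟪r M, y⟫ := by
  rw [relSign_eq_prod h.finite, ← Finset.prod_mul_distrib]
  refine Finset.prod_congr rfl fun M hM => ?_
  rw [Set.Finite.mem_toFinset] at hM
  rw [mem_complementIn] at hx hy
  have hM2 := (hr M hM).2.1
  have hx' := hx.2 M hM
  have hy' := hy.2 M hM
  rw [hM2] at hx' hy'
  conv_lhs => rw [hM2]
  exact opp_eq hx.1 hy.1 (inner_ne_zero_of_notMem hx.1 hx') (inner_ne_zero_of_notMem hy.1 hy')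

lemma inner_rep_ne_zero {E : Finset V} {L : Submodule ℝ V} {A : Set (Submodule ℝ V)}
    {r : Submodule ℝ V → V}
    (hr : ∀ M ∈ A, r M ∈ E ∧ M = L ⊓ hyp (r M) ∧ ¬ L ≤ hyp (r M)) {x : V}
    (hx : x ∈ complementIn L A) {M : Submodule ℝ V} (hM : M ∈ A) : ⟪r M, x⟫ ≠ 0 := by
  rw [mem_complementIn] at hx
  have hx' := hx.2 M hM
  rw [(hr M hM).2.1] at hx'
  exact inner_ne_zero_of_notMem hx.1 hx'

lemma relSign_mul {E : Finset V} {L : Submodule ℝ V} {A : Set (Submodule ℝ V)}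
    (h : IsGen E L A) {x y z : V}
    (hx : x ∈ complementIn L A) (hy : y ∈ complementIn L A) (hz : z ∈ complementIn L A) :
    relSign A x y * relSign A y z = relSign A x z := by
  obtain ⟨r, hr⟩ := h.exists_rep
  have hyy := relSign_self A y
  rw [relSign_eq_sign h hr hy hy] at hyy
  rw [relSign_eq_sign h hr hx hy, relSign_eq_sign h hr hy hz, relSign_eq_sign h hr hx hz]
  linear_combination (∏ M ∈ h.finite.toFinset, Real.sign ⟪r M, x⟫) *
    (∏ M ∈ h.finite.toFinset, Real.sign ⟪r M, z⟫) * hyy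

lemma opp_pow (M : Submodule ℝ V) (x y : V) (k : ℕ) :
    opp M x y ^ k = if Odd k then opp M x y else 1 := by
  have h : opp M x y = 1 ∨ opp M x y = -1 := by
    rw [opp]; split_ifs <;> simp
  rcases h with h | h
  · simp [h]
  · rw [h]
    split_ifs with hk
    · exact hk.neg_one_pow
    · exact (Nat.not_odd_iff_even.1 hk).neg_one_pow

/-- On a hyperplane `M` of `A`, the product of the signs of the other members of `A` is the sign
for the even restricted arrangement. -/
lemma prod_opp_restriction {E : Finset V} {L M : Submodule ℝ V} {A : Set (Submodule ℝ V)}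
    (h : IsGen E L A) (hM : M ∈ A) (x y : V) :
    ∏ M' ∈ (h.finite.subset (sdiff_subset : A \ {M} ⊆ A)).toFinset, opp (M ⊓ M') x y =
      relSign (evenRestriction A M) x y := by
  classical
  set F := (h.finite.subset (sdiff_subset : A \ {M} ⊆ A)).toFinset with hF
  rw [relSign_eq_prod (h.evenRestriction hM).finite,
    Finset.prod_comp (fun N => opp N x y) (fun M' => M ⊓ M')]
  have himg : ∀ N, N ∈ F.image (fun M' => M ⊓ M') ↔ N ∈ restriction A M := by
    intro N
    simp only [Finset.mem_image, hF, Set.Finite.mem_toFinset, Set.mem_sdiff, mem_singleton_iff,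
      Pizza.restriction, mem_ofPred_eq]
    constructor
    · rintro ⟨M', ⟨h1, h2⟩, rfl⟩; exact ⟨M', h1, h2, rfl⟩
    · rintro ⟨M', h1, h2, rfl⟩; exact ⟨M', ⟨h1, h2⟩, rfl⟩
  -- The hyperplanes through `N` are `M` itself and the fibre of `M' ↦ M ⊓ M'` over `N`. The shift
  -- by one exchanges parities: an odd power of the sign survives exactly for the `N` kept by the
  -- even restriction.
  have hcard : ∀ N ∈ restriction A M,
      {M' ∈ A | N ≤ M'}.ncard = (F.filter fun M' => M ⊓ M' = N).card + 1 := by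
    intro N hN
    have hset : {M' ∈ A | N ≤ M'} = insert M ((F.filter fun M' => M ⊓ M' = N : Finset _) : Set _) := by
      ext M'
      simp only [mem_ofPred_eq, mem_insert_iff, Finset.coe_filter, hF, Set.Finite.mem_toFinset,
        Set.mem_sdiff, mem_singleton_iff]
      constructor
      · rintro ⟨h1, h2⟩
        by_cases hne : M' = M
        · exact Or.inl hne
        · refine Or.inr ⟨⟨h1, hne⟩, ?_⟩
          have hNM : N ≤ M := by obtain ⟨_, _, _, rfl⟩ := hN; exact inf_le_left
          exact ((h.restriction hM).eq_of_le hN ⟨M', h1, hne, rfl⟩ (le_inf hNM h2)).symm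
      · rintro (rfl | ⟨⟨h1, h2⟩, rfl⟩)
        · refine ⟨hM, ?_⟩
          obtain ⟨_, _, _, rfl⟩ := hN; exact inf_le_left
        · exact ⟨h1, inf_le_right⟩
    rw [hset, Set.ncard_insert_of_notMem _ (Finset.finite_toSet _), Set.ncard_coe_finset]
    simp [hF]
  simp only [opp_pow]
  rw [← Finset.prod_filter]
  refine Finset.prod_congr ?_ fun _ _ => rfl
  ext N
  rw [Finset.mem_filter, himg, Set.Finite.mem_toFinset]
  refine ⟨fun hh => ⟨hh.1, ?_⟩, fun hh => ⟨hh.1, ?_⟩⟩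
  · rw [hcard N hh.1]; exact hh.2.add_one
  · have := hh.2
    rw [hcard N hh.1] at this
    by_contra hc
    exact (Nat.not_even_iff_odd.2 ((Nat.not_odd_iff_even.1 hc).add_one)) this

lemma relSign_evenRestriction {E : Finset V} {L M : Submodule ℝ V} {A : Set (Submodule ℝ V)}
    (h : IsGen E L A) (hM : M ∈ A) {r : Submodule ℝ V → V}
    (hr : ∀ M ∈ A, r M ∈ E ∧ M = L ⊓ hyp (r M) ∧ ¬ L ≤ hyp (r M)) {x y : V}
    (hx : x ∈ complementIn M (restriction A M)) (hy : y ∈ complementIn M (restriction A M)) :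
    relSign (evenRestriction A M) x y =
      (∏ M' ∈ (h.finite.subset (sdiff_subset : A \ {M} ⊆ A)).toFinset, Real.sign ⟪r M', x⟫) *
      ∏ M' ∈ (h.finite.subset (sdiff_subset : A \ {M} ⊆ A)).toFinset, Real.sign ⟪r M', y⟫ := by
  rw [← prod_opp_restriction h hM, ← Finset.prod_mul_distrib]
  refine Finset.prod_congr rfl fun M' hM' => ?_
  rw [Set.Finite.mem_toFinset] at hM'
  rw [mem_complementIn] at hx hy
  have hM2 : M ⊓ M' = M ⊓ hyp (r M') := by
    conv_lhs => rw [(hr M' hM'.1).2.1]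
    rw [← inf_assoc, inf_eq_left.2 (h.le hM)]
  have hx' := hx.2 (M ⊓ M') ⟨M', hM'.1, hM'.2, rfl⟩
  have hy' := hy.2 (M ⊓ M') ⟨M', hM'.1, hM'.2, rfl⟩
  rw [hM2] at hx' hy' ⊢
  exact opp_eq hx.1 hy.1 (inner_ne_zero_of_notMem hx.1 hx') (inner_ne_zero_of_notMem hy.1 hy')

lemma inner_rep_ne_zero_of_restriction {E : Finset V} {L M : Submodule ℝ V}
    {A : Set (Submodule ℝ V)} (h : IsGen E L A) (hM : M ∈ A) {r : Submodule ℝ V → V}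
    (hr : ∀ M ∈ A, r M ∈ E ∧ M = L ⊓ hyp (r M) ∧ ¬ L ≤ hyp (r M)) {x : V}
    (hx : x ∈ complementIn M (restriction A M)) {M' : Submodule ℝ V} (hM' : M' ∈ A)
    (hne : M' ≠ M) : ⟪r M', x⟫ ≠ 0 := by
  rw [mem_complementIn] at hx
  intro h0
  refine hx.2 (M ⊓ M') ⟨M', hM', hne, rfl⟩ ⟨hx.1, ?_⟩
  rw [(hr M' hM').2.1]
  exact mem_inf_hyp.2 ⟨h.le hM hx.1, h0⟩

/-- A real vector space is not a finite union of proper subspaces. -/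
lemma complementIn_nonempty {E : Finset V} {L : Submodule ℝ V} {A : Set (Submodule ℝ V)}
    (h : IsGen E L A) : (complementIn L A).Nonempty := by
  classical
  have hne := Subspace.biUnion_ne_univ_of_top_notMem (k := ℝ) (E := L)
    (s := h.finite.toFinset.image (fun M => M.comap L.subtype)) (by
      simp only [Finset.mem_image, Set.Finite.mem_toFinset, not_exists, not_and]
      intro M hM hT
      refine (h.lt hM).not_ge fun x hx => ?_
      have : (⟨x, hx⟩ : L) ∈ M.comap L.subtype := by rw [hT]; trivial
      exact this)
  obtain ⟨x, hx⟩ := (Set.ne_univ_iff_exists_notMem _).1 hne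
  refine ⟨x, mem_complementIn.2 ⟨x.2, fun M hM hxM => hx ?_⟩⟩
  simp only [Finset.mem_image, Set.Finite.mem_toFinset, Set.mem_iUnion, exists_prop]
  exact ⟨_, ⟨M, hM, rfl⟩, hxM⟩

end Pizza

end

noncomputable section

namespace Pizza

variable {V : Type*} [NormedAddCommGroup V] [InnerProductSpace ℝ V]

/-! ### Chambers as sign cells -/

/-- The points of the complement of the arrangement that no member of `A` separates from `x`. -/
def cell (L : Submodule ℝ V) (A : Set (Submodule ℝ V)) (x : V) : Set V :=
  {y | y ∈ complementIn L A ∧ ∀ M ∈ A, ¬ M.toAffineSubspace.SOppSide x y}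

lemma mem_cell_self {L : Submodule ℝ V} {A : Set (Submodule ℝ V)} {x : V}
    (hx : x ∈ complementIn L A) : x ∈ cell L A x :=
  ⟨hx, fun _ _ => AffineSubspace.not_sOppSide_self _ _⟩

lemma mem_cell_iff {E : Finset V} {L : Submodule ℝ V} {A : Set (Submodule ℝ V)}
    {r : Submodule ℝ V → V}
    (hr : ∀ M ∈ A, r M ∈ E ∧ M = L ⊓ hyp (r M) ∧ ¬ L ≤ hyp (r M)) {x y : V}
    (hx : x ∈ complementIn L A) :
    y ∈ cell L A x ↔ y ∈ L ∧ ∀ M ∈ A, 0 < ⟪r M, x⟫ * ⟪r M, y⟫ := by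
  have hxL := (mem_complementIn.1 hx).1
  constructor
  · rintro ⟨hy, h⟩
    have hyL := (mem_complementIn.1 hy).1
    refine ⟨hyL, fun M hM => ?_⟩
    have h1 := h M hM
    rw [(hr M hM).2.1, sOppSide_iff hxL hyL, not_lt] at h1
    exact lt_of_le_of_ne h1
      (mul_ne_zero (inner_rep_ne_zero hr hx hM) (inner_rep_ne_zero hr hy hM)).symm
  · rintro ⟨hyL, h⟩
    refine ⟨mem_complementIn.2 ⟨hyL, fun M hM hyM => ?_⟩, fun M hM => ?_⟩
    · rw [(hr M hM).2.1, mem_inf_hyp] at hyM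
      have := h M hM
      rw [hyM.2, mul_zero] at this
      exact lt_irrefl _ this
    · rw [(hr M hM).2.1, sOppSide_iff hxL hyL, not_lt]
      exact (h M hM).le

lemma convex_cell {E : Finset V} {L : Submodule ℝ V} {A : Set (Submodule ℝ V)}
    (h : IsGen E L A) {x : V} (hx : x ∈ complementIn L A) : Convex ℝ (cell L A x) := by
  obtain ⟨r, hr⟩ := h.exists_rep
  intro y hy z hz a b ha hb hab
  rw [mem_cell_iff hr hx] at hy hz ⊢
  refine ⟨L.add_mem (L.smul_mem _ hy.1) (L.smul_mem _ hz.1), fun M hM => ?_⟩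
  rw [inner_add_right, inner_smul_right, inner_smul_right]
  have h1 := hy.2 M hM
  have h2 := hz.2 M hM
  have h3 := (convex_Ioi (0 : ℝ)) (show _ ∈ Ioi (0 : ℝ) from h1) (show _ ∈ Ioi (0 : ℝ) from h2)
    ha hb hab
  simp only [smul_eq_mul, mem_Ioi] at h3
  linarith

lemma cell_subset_of_isPreconnected {E : Finset V} {L : Submodule ℝ V} {A : Set (Submodule ℝ V)}
    (h : IsGen E L A) {S : Set V} (hS : IsPreconnected S) (hSc : S ⊆ complementIn L A)
    {x : V} (hx : x ∈ S) : S ⊆ cell L A x := by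
  obtain ⟨r, hr⟩ := h.exists_rep
  intro y hy
  rw [mem_cell_iff hr (hSc hx)]
  refine ⟨(mem_complementIn.1 (hSc hy)).1, fun M hM => ?_⟩
  by_contra hc
  push Not at hc
  have hxn := inner_rep_ne_zero hr (hSc hx) hM
  have hcont : ContinuousOn (fun z => ⟪r M, x⟫ * ⟪r M, z⟫) S := by fun_prop
  obtain ⟨z, hz, hz0⟩ := hS.intermediate_value hy hx hcont
    (show (0 : ℝ) ∈ Icc _ _ from ⟨hc, mul_self_nonneg _⟩)
  rcases mul_eq_zero.1 hz0 with h1 | h1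
  · exact hxn h1
  · exact inner_rep_ne_zero hr (hSc hz) hM h1

/-- Sign cells are convex, hence connected, and by the intermediate value theorem a connected subset
of the complement cannot change sign. Chambers can thus be handled through finitely many linear
inequalities. -/
lemma connectedComponentIn_eq_cell {E : Finset V} {L : Submodule ℝ V} {A : Set (Submodule ℝ V)}
    (h : IsGen E L A) {x : V} (hx : x ∈ complementIn L A) :
    connectedComponentIn (complementIn L A) x = cell L A x := by
  refine subset_antisymm ?_ ?_
  · exact cell_subset_of_isPreconnected h isPreconnected_connectedComponentIn
      (connectedComponentIn_subset _ _) (mem_connectedComponentIn hx)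
  · exact (convex_cell h hx).isPreconnected.subset_connectedComponentIn (mem_cell_self hx)
      fun y hy => hy.1

lemma mem_chambers_iff {E : Finset V} {L : Submodule ℝ V} {A : Set (Submodule ℝ V)}
    (h : IsGen E L A) {T : Set V} :
    T ∈ chambers L A ↔ ∃ x ∈ complementIn L A, T = cell L A x := by
  simp only [chambers, mem_ofPred_eq]
  refine exists_congr fun x => and_congr_right fun hx => ?_
  rw [connectedComponentIn_eq_cell h hx]

lemma mul_neg_iff_of_mul_pos {a b c : ℝ} (h : 0 < b * c) : a * b < 0 ↔ a * c < 0 := by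
  rcases pos_and_pos_or_neg_and_neg_of_mul_pos h with ⟨h1, h2⟩ | ⟨h1, h2⟩
  · simp [mul_neg_iff, h1, h2, h1.not_gt, h2.not_gt]
  · simp [mul_neg_iff, h1, h2, h1.not_gt, h2.not_gt]

lemma sOppSide_congr_of_mem_cell {E : Finset V} {L : Submodule ℝ V} {A : Set (Submodule ℝ V)}
    (h : IsGen E L A) {x y : V} (hx : x ∈ complementIn L A) (hy : y ∈ cell L A x)
    {M : Submodule ℝ V} (hM : M ∈ A) {z : V} (hz : z ∈ L) :
    M.toAffineSubspace.SOppSide z x ↔ M.toAffineSubspace.SOppSide z y := by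
  obtain ⟨r, hr⟩ := h.exists_rep
  have hxL := (mem_complementIn.1 hx).1
  rw [mem_cell_iff hr hx] at hy
  rw [(hr M hM).2.1, sOppSide_iff hz hxL, sOppSide_iff hz hy.1]
  exact mul_neg_iff_of_mul_pos (hy.2 M hM)

lemma cell_eq_of_mem {E : Finset V} {L : Submodule ℝ V} {A : Set (Submodule ℝ V)}
    (h : IsGen E L A) {x y : V} (hx : x ∈ complementIn L A) (hy : y ∈ cell L A x) :
    cell L A y = cell L A x := by
  ext z
  refine and_congr_right fun hz => forall₂_congr fun M hM => not_congr ?_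
  rw [AffineSubspace.sOppSide_comm, AffineSubspace.sOppSide_comm (x := x)]
  exact (sOppSide_congr_of_mem_cell h hx hy hM (mem_complementIn.1 hz).1).symm

lemma relSign_congr_of_mem_cell {E : Finset V} {L : Submodule ℝ V} {A : Set (Submodule ℝ V)}
    (h : IsGen E L A) {x y : V} (hx : x ∈ complementIn L A) (hy : y ∈ cell L A x)
    {z : V} (hz : z ∈ L) : relSign A z x = relSign A z y := by
  rw [relSign, relSign]
  congr 2
  ext M
  exact and_congr_right fun hM => sOppSide_congr_of_mem_cell h hx hy hM hz

/-- The separation of two chambers is witnessed by some pair of points, but signs are constant on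
cells, so the chosen base points of the cells decide it. -/
lemma chamberSign_cell {E : Finset V} {L : Submodule ℝ V} {A : Set (Submodule ℝ V)}
    (h : IsGen E L A) {x y : V} (hx : x ∈ complementIn L A) (hy : y ∈ complementIn L A) :
    chamberSign A (cell L A x) (cell L A y) = relSign A x y := by
  rw [chamberSign, relSign, sepSet]
  congr 2
  ext M
  refine and_congr_right fun hM => ⟨?_, fun hh => ⟨x, mem_cell_self hx, y, mem_cell_self hy, hh⟩⟩
  rintro ⟨x', hx', y', hy', hh⟩
  rw [← sOppSide_congr_of_mem_cell h hy hy' hM (mem_complementIn.1 hx'.1).1,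
    AffineSubspace.sOppSide_comm,
    ← sOppSide_congr_of_mem_cell h hx hx' hM (mem_complementIn.1 hy).1] at hh
  exact AffineSubspace.sOppSide_comm.1 hh

lemma chambers_finite {E : Finset V} {L : Submodule ℝ V} {A : Set (Submodule ℝ V)}
    (h : IsGen E L A) : (chambers L A).Finite := by
  obtain ⟨p, hp⟩ := complementIn_nonempty h
  -- A chamber is determined by the set of hyperplanes that separate it from the fixed point `p`,
  -- and there are finitely many such sets.
  refine (h.finite.finite_subsets.image fun B : Set (Submodule ℝ V) =>
    {y | y ∈ complementIn L A ∧ ∀ M ∈ A, (M.toAffineSubspace.SOppSide p y ↔ M ∈ B)}).subset ?_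
  intro T hT
  obtain ⟨x, hx, rfl⟩ := (mem_chambers_iff h).1 hT
  refine ⟨{M ∈ A | M.toAffineSubspace.SOppSide p x}, fun M hM => hM.1, ?_⟩
  obtain ⟨r, hr⟩ := h.exists_rep
  have hpL := (mem_complementIn.1 hp).1
  have hxL := (mem_complementIn.1 hx).1
  ext y
  constructor
  · rintro ⟨hy, h1⟩
    have hyL := (mem_complementIn.1 hy).1
    refine ⟨hy, fun M hM => ?_⟩
    have h2 := h1 M hM
    have hpn := inner_rep_ne_zero hr hp hM
    simp only [mem_ofPred_eq, hM, true_and] at h2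
    rw [(hr M hM).2.1, sOppSide_iff hpL hyL, sOppSide_iff hpL hxL] at h2
    rw [(hr M hM).2.1, sOppSide_iff hxL hyL]
    intro hneg
    have h3 : (⟪r M, p⟫ * ⟪r M, x⟫) * (⟪r M, p⟫ * ⟪r M, y⟫) < 0 := by
      have := mul_neg_of_pos_of_neg (mul_self_pos.2 hpn) hneg
      linarith
    rcases mul_neg_iff.1 h3 with ⟨h4, h5⟩ | ⟨h4, h5⟩
    · exact absurd (h2.1 h5) h4.not_gt
    · exact absurd (h2.2 h4) h5.not_gt
  · intro hy
    refine ⟨hy.1, fun M hM => ?_⟩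
    rw [← sOppSide_congr_of_mem_cell h hx hy hM hpL]
    simp [hM]

/-- A reference point off the hyperplanes. -/
def basePoint (L : Submodule ℝ V) (A : Set (Submodule ℝ V)) : V :=
  Classical.epsilon fun x => x ∈ complementIn L A

lemma basePoint_mem {E : Finset V} {L : Submodule ℝ V} {A : Set (Submodule ℝ V)}
    (h : IsGen E L A) : basePoint L A ∈ complementIn L A :=
  Classical.epsilon_spec (complementIn_nonempty h)

/-- The sign function of the arrangement, normalized at the reference point. -/
def sgn (L : Submodule ℝ V) (A : Set (Submodule ℝ V)) (x : V) : ℝ :=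
  relSign A (basePoint L A) x

lemma sgn_eq_or (L : Submodule ℝ V) (A : Set (Submodule ℝ V)) (x : V) :
    sgn L A x = 1 ∨ sgn L A x = -1 := relSign_eq_or _ _ _

lemma sgn_mul_self (L : Submodule ℝ V) (A : Set (Submodule ℝ V)) (x : V) :
    sgn L A x * sgn L A x = 1 := relSign_mul_self _ _ _

lemma abs_sgn (L : Submodule ℝ V) (A : Set (Submodule ℝ V)) (x : V) : |sgn L A x| = 1 := by
  rcases sgn_eq_or L A x with h | h <;> simp [h]

lemma relSign_eq_sgn_mul {E : Finset V} {L : Submodule ℝ V} {A : Set (Submodule ℝ V)}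
    (h : IsGen E L A) {x y : V} (hx : x ∈ complementIn L A) (hy : y ∈ complementIn L A) :
    relSign A x y = sgn L A x * sgn L A y := by
  rw [sgn, sgn, relSign_comm A _ x, relSign_mul h hx (basePoint_mem h) hy]

lemma sgn_empty (L : Submodule ℝ V) (x : V) : sgn L ∅ x = 1 := relSign_empty _ _

lemma sgn_eq_prod {E : Finset V} {L : Submodule ℝ V} {A : Set (Submodule ℝ V)}
    (h : IsGen E L A) {r : Submodule ℝ V → V}
    (hr : ∀ M ∈ A, r M ∈ E ∧ M = L ⊓ hyp (r M) ∧ ¬ L ≤ hyp (r M)) {x : V}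
    (hx : x ∈ complementIn L A) :
    sgn L A x = (∏ M ∈ h.finite.toFinset, Real.sign ⟪r M, basePoint L A⟫) *
      ∏ M ∈ h.finite.toFinset, Real.sign ⟪r M, x⟫ :=
  relSign_eq_sign h hr (basePoint_mem h) hx

/-! ### Volumes on subspaces and the pizza quantity as an integral -/

variable [FiniteDimensional ℝ V] [MeasurableSpace V] [BorelSpace V]

lemma measurableSet_submodule (L : Submodule ℝ V) : MeasurableSet (L : Set V) :=
  L.closed_of_finiteDimensional.measurableSet

lemma volOn_compl (L : Submodule ℝ V) : volOn L (L : Set V)ᶜ = 0 := by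
  rw [volOn, Measure.map_apply measurable_subtype_coe (measurableSet_submodule L).compl]
  convert! measure_empty (μ := lebesgue L)
  ext x; simp

lemma ae_mem_volOn (L : Submodule ℝ V) : ∀ᵐ x ∂volOn L, x ∈ L := volOn_compl L

lemma volOn_of_lt {L M : Submodule ℝ V} (h : M < L) : volOn L (M : Set V) = 0 := by
  rw [volOn, Measure.map_apply measurable_subtype_coe (measurableSet_submodule M)]
  have : (fun x : L => (x : V)) ⁻¹' (M : Set V) = (M.comap L.subtype : Set L) := rfl
  rw [this, lebesgue]
  refine Measure.addHaar_submodule _ _ fun hT => h.not_ge fun x hx => ?_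
  have : (⟨x, hx⟩ : L) ∈ M.comap L.subtype := by rw [hT]; trivial
  exact this

lemma ae_mem_complementIn {E : Finset V} {L : Submodule ℝ V} {A : Set (Submodule ℝ V)}
    (h : IsGen E L A) : ∀ᵐ x ∂volOn L, x ∈ complementIn L A := by
  have h1 : ∀ᵐ x ∂volOn L, ∀ M ∈ A, x ∉ M := by
    rw [ae_ball_iff h.finite.countable]
    intro M hM
    rw [ae_iff]
    simpa using volOn_of_lt (h.lt hM)
  filter_upwards [h1, ae_mem_volOn L] with x hx1 hx2
  exact mem_complementIn.2 ⟨hx2, hx1⟩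

lemma measurableSet_complementIn {E : Finset V} {L : Submodule ℝ V} {A : Set (Submodule ℝ V)}
    (h : IsGen E L A) : MeasurableSet (complementIn L A) :=
  (measurableSet_submodule L).diff
    (h.finite.measurableSet_biUnion fun M _ => measurableSet_submodule M)

lemma measurableSet_cell {E : Finset V} {L : Submodule ℝ V} {A : Set (Submodule ℝ V)}
    (h : IsGen E L A) {x : V} (hx : x ∈ complementIn L A) : MeasurableSet (cell L A x) := by
  obtain ⟨r, hr⟩ := h.exists_rep
  have : cell L A x = (L : Set V) ∩ ⋂ M ∈ A, {y | 0 < ⟪r M, x⟫ * ⟪r M, y⟫} := by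
    ext y
    rw [mem_cell_iff hr hx]
    simp
  rw [this]
  refine (measurableSet_submodule L).inter (h.finite.measurableSet_biInter fun M _ => ?_)
  exact (isOpen_lt continuous_const (by fun_prop)).measurableSet

lemma measurable_real_sign : Measurable Real.sign := by
  unfold Real.sign
  exact Measurable.ite measurableSet_Iio measurable_const
    (Measurable.ite measurableSet_Ioi measurable_const measurable_const)

lemma aestronglyMeasurable_sgn {E : Finset V} {L : Submodule ℝ V} {A : Set (Submodule ℝ V)}
    (h : IsGen E L A) : AEStronglyMeasurable (sgn L A) (volOn L) := by
  obtain ⟨r, hr⟩ := h.exists_rep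
  refine AEStronglyMeasurable.congr (f := fun x =>
    (∏ M ∈ h.finite.toFinset, Real.sign ⟪r M, basePoint L A⟫) *
      ∏ M ∈ h.finite.toFinset, Real.sign ⟪r M, x⟫) ?_ ?_
  · refine (Measurable.const_mul (Finset.measurable_fun_prod _ fun M _ => ?_) _).aestronglyMeasurable
    exact measurable_real_sign.comp (by fun_prop : Measurable fun x => ⟪r M, x⟫)
  · filter_upwards [ae_mem_complementIn h] with x hx
    exact (sgn_eq_prod h hr hx).symm

/-- The integral of the sign function over `K`. -/
def signedVol (L : Submodule ℝ V) (A : Set (Submodule ℝ V)) (K : Set V) : ℝ :=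
  ∫ x in K, sgn L A x ∂volOn L

lemma integrableOn_sgn {E : Finset V} {L : Submodule ℝ V} {A : Set (Submodule ℝ V)}
    (h : IsGen E L A) {K : Set V} (hK : volOn L K ≠ ⊤) :
    IntegrableOn (sgn L A) K (volOn L) := by
  refine Measure.integrableOn_of_bounded (M := 1) hK (aestronglyMeasurable_sgn h) ?_
  exact Eventually.of_forall fun x => by rw [Real.norm_eq_abs, abs_sgn]

/-- The chambers are disjoint, cover almost all of `L`, and `sgn` is constant on each. Changing the
base chamber only multiplies by a sign, which is why one fixed reference point serves for all of
them. -/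
lemma pizza_eq_signedVol {E : Finset V} {L : Submodule ℝ V} {A : Set (Submodule ℝ V)}
    (h : IsGen E L A) {K : Set V} (hK : volOn L K ≠ ⊤) {p : V} (hp : p ∈ complementIn L A) :
    pizza L A (cell L A p) K = sgn L A p * signedVol L A K := by
  classical
  have hfin := chambers_finite h
  rw [pizza, finsum_mem_eq_finite_toFinset_sum _ hfin, signedVol]
  have hdisj : Set.Pairwise (hfin.toFinset : Set (Set V)) (Function.onFun Disjoint id) := by
    intro T hT T' hT' hne
    rw [Set.Finite.coe_toFinset] at hT hT'
    obtain ⟨x, hx, rfl⟩ := (mem_chambers_iff h).1 hT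
    obtain ⟨x', hx', rfl⟩ := (mem_chambers_iff h).1 hT'
    refine Set.disjoint_left.2 fun y hy hy' => hne ?_
    rw [id] at hy hy'
    rw [← cell_eq_of_mem h hx hy, ← cell_eq_of_mem h hx' hy']
  have hmeas : ∀ T ∈ hfin.toFinset, MeasurableSet (id T) := by
    intro T hT
    rw [Set.Finite.mem_toFinset] at hT
    obtain ⟨x, hx, rfl⟩ := (mem_chambers_iff h).1 hT
    exact measurableSet_cell h hx
  have hunion : ∫ x in K, sgn L A x ∂volOn L =
      ∫ x in ⋃ T ∈ hfin.toFinset, id T, sgn L A x ∂((volOn L).restrict K) := by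
    have hae : ∀ᵐ x ∂((volOn L).restrict K), x ∈ ⋃ T ∈ hfin.toFinset, id T := by
      filter_upwards [ae_restrict_of_ae (ae_mem_complementIn h)] with x hx
      simp only [Set.Finite.mem_toFinset, Set.mem_iUnion, exists_prop, id]
      exact ⟨cell L A x, (mem_chambers_iff h).2 ⟨x, hx, rfl⟩, mem_cell_self hx⟩
    rw [Measure.restrict_eq_self_of_ae_mem hae]
  have hint : ∀ T ∈ hfin.toFinset, IntegrableOn (sgn L A) (id T) ((volOn L).restrict K) :=
    fun T _ => Integrable.integrableOn (integrableOn_sgn h hK)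
  rw [hunion, integral_biUnion_finset _ hmeas hdisj hint, Finset.mul_sum]
  refine Finset.sum_congr rfl fun T hT => ?_
  have hTm := hmeas T hT
  rw [Set.Finite.mem_toFinset] at hT
  obtain ⟨x, hx, rfl⟩ := (mem_chambers_iff h).1 hT
  rw [chamberSign_cell h hp hx, relSign_eq_sgn_mul h hp hx, mul_assoc]
  congr 1
  -- No measurability of `K` is needed: only the chamber has to be measurable in order to evaluate
  -- the measure restricted to `K` on it.
  have hconst : EqOn (sgn L A) (fun _ => sgn L A x) (id (cell L A x)) := fun y hy =>
    (relSign_congr_of_mem_cell h hx hy (mem_complementIn.1 (basePoint_mem h)).1).symm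
  rw [setIntegral_congr_fun hTm hconst, setIntegral_const, smul_eq_mul, mul_comm, Measure.real, Measure.real,
    Measure.restrict_apply hTm, inter_comm]
  rfl

end Pizza

end

noncomputable section

namespace Pizza

variable {V : Type*} [NormedAddCommGroup V] [InnerProductSpace ℝ V]

/-! ### Unit normals and one-sided signs -/

section Projection

variable [FiniteDimensional ℝ V]

lemma proj_mem (L : Submodule ℝ V) (x : V) : proj L x ∈ L := L.starProjection_apply_mem x

lemma inner_proj {L : Submodule ℝ V} (e : V) {x : V} (hx : x ∈ L) : ⟪proj L e, x⟫ = ⟪e, x⟫ := by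
  have h := (Submodule.mem_orthogonal' L _).1 (L.sub_starProjection_mem_orthogonal e) x hx
  rw [inner_sub_left] at h
  rw [proj]; linarith

lemma proj_eq_self {L : Submodule ℝ V} {x : V} (hx : x ∈ L) : proj L x = x :=
  Submodule.starProjection_eq_self_iff.2 hx

lemma proj_ne_zero {L : Submodule ℝ V} {e : V} (h : ¬ L ≤ hyp e) : proj L e ≠ 0 := by
  intro h0
  refine h fun x hx => mem_hyp.2 ?_
  rw [← inner_proj e hx, h0, inner_zero_left]

lemma unitNormal_mem (L : Submodule ℝ V) (e : V) : unitNormal L e ∈ L :=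
  L.smul_mem _ (proj_mem L e)

lemma norm_unitNormal {L : Submodule ℝ V} {e : V} (h : ¬ L ≤ hyp e) : ‖unitNormal L e‖ = 1 := by
  rw [unitNormal, norm_smul, norm_inv, norm_norm]
  exact inv_mul_cancel₀ (norm_ne_zero_iff.2 (proj_ne_zero h))

lemma inner_unitNormal {L : Submodule ℝ V} (e : V) {x : V} (hx : x ∈ L) :
    ⟪unitNormal L e, x⟫ = ‖proj L e‖⁻¹ * ⟪e, x⟫ := by
  rw [unitNormal, real_inner_smul_left, inner_proj e hx]

lemma inner_eq_norm_mul_unitNormal {L : Submodule ℝ V} {e : V} (h : ¬ L ≤ hyp e) {x : V}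
    (hx : x ∈ L) : ⟪e, x⟫ = ‖proj L e‖ * ⟪unitNormal L e, x⟫ := by
  rw [inner_unitNormal e hx, ← mul_assoc, mul_inv_cancel₀ (norm_ne_zero_iff.2 (proj_ne_zero h)),
    one_mul]

lemma inner_unitNormal_of_mem {L : Submodule ℝ V} {e y : V} (hy : y ∈ L ⊓ hyp e) :
    ⟪unitNormal L e, y⟫ = 0 := by
  rw [mem_inf_hyp] at hy
  rw [inner_unitNormal e hy.1, hy.2, mul_zero]

/-- A vector of `L` orthogonal to a hyperplane of `L` is a multiple of the unit normal. -/
lemma eq_smul_unitNormal {L : Submodule ℝ V} {e w : V} (h : ¬ L ≤ hyp e) (hw : w ∈ L)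
    (hwM : ∀ y ∈ L ⊓ hyp e, ⟪w, y⟫ = 0) : w = ⟪unitNormal L e, w⟫ • unitNormal L e := by
  set ν := unitNormal L e with hν
  have hνL := unitNormal_mem L e
  have h1 : w - ⟪ν, w⟫ • ν ∈ L ⊓ hyp e := by
    rw [mem_inf_hyp]
    have hmem := L.sub_mem hw (L.smul_mem ⟪ν, w⟫ hνL)
    refine ⟨hmem, ?_⟩
    rw [inner_eq_norm_mul_unitNormal h hmem, inner_sub_right, inner_smul_right, ← hν,
      real_inner_self_eq_norm_sq, norm_unitNormal h]
    ring
  have h2 : ⟪w - ⟪ν, w⟫ • ν, w - ⟪ν, w⟫ • ν⟫ = 0 := by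
    rw [inner_sub_left, real_inner_smul_left, hwM _ h1, inner_unitNormal_of_mem h1]
    ring
  exact sub_eq_zero.1 (inner_self_eq_zero.1 h2)

end Projection

lemma eventually_inner_add_smul_ne_zero {f y w : V} (h : ⟪f, y⟫ ≠ 0) :
    ∀ᶠ ε : ℝ in 𝓝[>] 0, 0 < ⟪f, y⟫ * ⟪f, y + ε • w⟫ := by
  have hc : Continuous fun ε : ℝ => ⟪f, y⟫ * ⟪f, y + ε • w⟫ := by fun_prop
  have h0 : 0 < ⟪f, y⟫ * ⟪f, y + (0 : ℝ) • w⟫ := by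
    rw [zero_smul, add_zero]; exact mul_self_pos.2 h
  exact (hc.tendsto 0).eventually (lt_mem_nhds h0) |>.filter_mono nhdsWithin_le_nhds

lemma sign_eq_of_mul_pos {a b : ℝ} (h : 0 < a * b) : Real.sign b = Real.sign a := by
  rcases pos_and_pos_or_neg_and_neg_of_mul_pos h with ⟨h1, h2⟩ | ⟨h1, h2⟩
  · rw [Real.sign_of_pos h1, Real.sign_of_pos h2]
  · rw [Real.sign_of_neg h1, Real.sign_of_neg h2]

lemma sign_mul_of_pos {a b : ℝ} (h : 0 < a) : Real.sign (a * b) = Real.sign b := by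
  rcases lt_trichotomy b 0 with h1 | rfl | h1
  · rw [Real.sign_of_neg h1, Real.sign_of_neg (mul_neg_of_pos_of_neg h h1)]
  · simp
  · rw [Real.sign_of_pos h1, Real.sign_of_pos (mul_pos h h1)]

/-- The sign function just beside a generic point of a hyperplane of the arrangement. -/
lemma eventually_sgn_add_smul {E : Finset V} {L M : Submodule ℝ V} {A : Set (Submodule ℝ V)}
    (h : IsGen E L A) (hM : M ∈ A) {r : Submodule ℝ V → V}
    (hr : ∀ M ∈ A, r M ∈ E ∧ M = L ⊓ hyp (r M) ∧ ¬ L ≤ hyp (r M)) {y w : V}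
    (hy : y ∈ complementIn M (restriction A M)) (hw : w ∈ L) (hrw : ⟪r M, w⟫ ≠ 0) :
    ∀ᶠ ε : ℝ in 𝓝[>] 0, y + ε • w ∈ complementIn L A ∧
      sgn L A (y + ε • w) = (∏ M' ∈ h.finite.toFinset, Real.sign ⟪r M', basePoint L A⟫) *
        (Real.sign ⟪r M, w⟫ * ∏ M' ∈ (h.finite.subset (sdiff_subset : A \ {M} ⊆ A)).toFinset,
          Real.sign ⟪r M', y⟫) := by
  classical
  have hyM := (mem_complementIn.1 hy).1
  have hyL := h.le hM hyM
  have hy0 : ⟪r M, y⟫ = 0 := by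
    have := hyM
    rw [(hr M hM).2.1, mem_inf_hyp] at this
    exact this.2
  have h1 : ∀ᶠ ε : ℝ in 𝓝[>] 0, ∀ M' ∈ A \ {M}, 0 < ⟪r M', y⟫ * ⟪r M', y + ε • w⟫ := by
    rw [(h.finite.subset (sdiff_subset : A \ {M} ⊆ A)).eventually_all]
    exact fun M' hM' => eventually_inner_add_smul_ne_zero
      (inner_rep_ne_zero_of_restriction h hM hr hy hM'.1 hM'.2)
  filter_upwards [h1, self_mem_nhdsWithin] with ε hε hε0
  have hε0' : (0 : ℝ) < ε := hε0
  have hM2 : ⟪r M, y + ε • w⟫ = ε * ⟪r M, w⟫ := by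
    rw [inner_add_right, inner_smul_right, hy0, zero_add]
  have hmem : y + ε • w ∈ complementIn L A := by
    refine mem_complementIn.2 ⟨L.add_mem hyL (L.smul_mem _ hw), fun M' hM' hin => ?_⟩
    rw [(hr M' hM').2.1, mem_inf_hyp] at hin
    by_cases hne : M' = M
    · subst hne
      rw [hM2] at hin
      exact mul_ne_zero hε0'.ne' hrw hin.2
    · have := hε M' ⟨hM', hne⟩
      rw [hin.2, mul_zero] at this
      exact lt_irrefl _ this
  refine ⟨hmem, ?_⟩
  rw [sgn_eq_prod h hr hmem]
  congr 1
  have hins : h.finite.toFinset =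
      insert M (h.finite.subset (sdiff_subset : A \ {M} ⊆ A)).toFinset := by
    ext M'
    by_cases hne : M' = M
    · simp [hne, hM]
    · simp [hne]
  rw [hins, Finset.prod_insert (by simp), hM2, sign_mul_of_pos hε0']
  congr 1
  refine Finset.prod_congr rfl fun M' hM' => ?_
  rw [Set.Finite.mem_toFinset] at hM'
  exact sign_eq_of_mul_pos (hε M' hM')

/-- Just off `M` the sign is a constant, times the side of `w`, times the product of the signs of
the other members at `y`. That last product is proportional to the restricted sign function, so a
single `κ` works for all generic `y`; reversing `w` reverses it. -/
lemma exists_sgn_add_smul {E : Finset V} {L M : Submodule ℝ V} {A : Set (Submodule ℝ V)}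
    (h : IsGen E L A) (hM : M ∈ A) {w : V} (hw : w ∈ L) (hwM : w ∉ M) :
    ∃ κ : ℝ, (κ = 1 ∨ κ = -1) ∧ (∀ y ∈ complementIn M (restriction A M),
      ∀ᶠ ε : ℝ in 𝓝[>] 0, y + ε • w ∈ complementIn L A ∧
        sgn L A (y + ε • w) = κ * sgn M (evenRestriction A M) y) ∧
      ∀ y ∈ complementIn M (restriction A M),
      ∀ᶠ ε : ℝ in 𝓝[>] 0, y + ε • -w ∈ complementIn L A ∧
        sgn L A (y + ε • -w) = -κ * sgn M (evenRestriction A M) y := by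
  classical
  obtain ⟨r, hr⟩ := h.exists_rep
  obtain ⟨q, hq⟩ := complementIn_nonempty (h.restriction hM)
  have hrw : ⟪r M, w⟫ ≠ 0 := by
    rw [(hr M hM).2.1] at hwM
    exact inner_ne_zero_of_notMem hw hwM
  have hrw' : ⟪r M, -w⟫ ≠ 0 := by rwa [inner_neg_right, neg_ne_zero]
  have hsub := complementIn_anti (L := M) (evenRestriction_subset A M)
  set B := ∏ M' ∈ h.finite.toFinset, Real.sign ⟪r M', basePoint L A⟫ with hB
  set Q := fun y => ∏ M' ∈ (h.finite.subset (sdiff_subset : A \ {M} ⊆ A)).toFinset,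
          Real.sign ⟪r M', y⟫ with hQ
  have hprod : ∀ {F : Finset (Submodule ℝ V)} {x : V}, (∀ M' ∈ F, ⟪r M', x⟫ ≠ 0) →
      (∏ M' ∈ F, Real.sign ⟪r M', x⟫ = 1 ∨ ∏ M' ∈ F, Real.sign ⟪r M', x⟫ = -1) := by
    intro F x hx
    induction F using Finset.induction_on with
    | empty => simp
    | insert a s ha ih =>
      rw [Finset.prod_insert ha]
      rcases Real.sign_apply_eq_of_ne_zero _ (hx a (Finset.mem_insert_self _ _)) with h1 | h1 <;>
      rcases ih (fun M' hM' => hx M' (Finset.mem_insert_of_mem hM')) with h2 | h2 <;>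
      simp [h1, h2]
  have hBs : B = 1 ∨ B = -1 := hprod fun M' hM' =>
    inner_rep_ne_zero hr (basePoint_mem h) ((Set.Finite.mem_toFinset _).1 hM')
  have hQs : Q q = 1 ∨ Q q = -1 := hprod fun M' hM' => by
    rw [Set.Finite.mem_toFinset] at hM'
    exact inner_rep_ne_zero_of_restriction h hM hr hq hM'.1 hM'.2
  -- Comparison with the fixed generic point `q` of `M` determines the constant of proportionality
  -- between `Q` and the restricted sign function.
  have hQy : ∀ y ∈ complementIn M (restriction A M), Q y =
      Q q * sgn M (evenRestriction A M) q * sgn M (evenRestriction A M) y := by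
    intro y hy
    have h1 := relSign_evenRestriction h hM hr hq hy
    rw [relSign_eq_sgn_mul (h.evenRestriction hM) (hsub hq) (hsub hy)] at h1
    change _ = Q q * Q y at h1
    have h2 : Q q * Q q = 1 := by rcases hQs with h | h <;> simp [h]
    linear_combination (-Q y) * h2 - Q q * h1
  refine ⟨B * (Real.sign ⟪r M, w⟫ * (Q q * sgn M (evenRestriction A M) q)), ?_, ?_, ?_⟩
  · rcases hBs with h1 | h1 <;> rcases hQs with h2 | h2 <;>
      rcases Real.sign_apply_eq_of_ne_zero _ hrw with h3 | h3 <;>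
      rcases sgn_eq_or M (evenRestriction A M) q with h4 | h4 <;> simp [h1, h2, h3, h4]
  · intro y hy
    filter_upwards [eventually_sgn_add_smul h hM hr hy hw hrw] with ε hε
    refine ⟨hε.1, ?_⟩
    rw [hε.2]
    change B * (_ * Q y) = _
    rw [hQy y hy]; ring
  · intro y hy
    filter_upwards [eventually_sgn_add_smul h hM hr hy (L.neg_mem hw) hrw'] with ε hε
    refine ⟨hε.1, ?_⟩
    rw [hε.2]
    change B * (_ * Q y) = _
    rw [hQy y hy, inner_neg_right, Real.sign_neg]; ring

/-- `w` is a unit normal of the hyperplane `M` in `L` pointing to the side where the sign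
function of `A` restricts to the sign function of the even restriction. -/
def IsSignedNormal (L : Submodule ℝ V) (A : Set (Submodule ℝ V)) (M : Submodule ℝ V) (w : V) :
    Prop :=
  w ∈ L ∧ ‖w‖ = 1 ∧ (∀ y ∈ M, ⟪w, y⟫ = 0) ∧ ∀ y ∈ complementIn M (restriction A M),
    ∀ᶠ ε : ℝ in 𝓝[>] 0, sgn L A (y + ε • w) = sgn M (evenRestriction A M) y

/-- The signed unit normal of the hyperplane `M` of the arrangement `A` in `L`. -/
def signedNormal (L : Submodule ℝ V) (A : Set (Submodule ℝ V)) (M : Submodule ℝ V) : V :=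
  Classical.epsilon (IsSignedNormal L A M)

lemma unitNormal_notMem [FiniteDimensional ℝ V] {L : Submodule ℝ V} {e : V} (h : ¬ L ≤ hyp e) :
    unitNormal L e ∉ L ⊓ hyp e := fun hmem => by
  have := inner_unitNormal_of_mem hmem
  rw [real_inner_self_eq_norm_sq, norm_unitNormal h] at this
  norm_num at this

lemma isSignedNormal_signedNormal [FiniteDimensional ℝ V] {E : Finset V} {L M : Submodule ℝ V}
    {A : Set (Submodule ℝ V)} (h : IsGen E L A) (hM : M ∈ A) :
    IsSignedNormal L A M (signedNormal L A M) := by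
  refine Classical.epsilon_spec (p := IsSignedNormal L A M) ?_
  obtain ⟨e, he, hMe, hLe⟩ := h M hM
  have hνL := unitNormal_mem L e
  have hνM : unitNormal L e ∉ M := by rw [hMe]; exact unitNormal_notMem hLe
  have horth : ∀ y ∈ M, ⟪unitNormal L e, y⟫ = 0 := fun y hy => by
    rw [hMe] at hy; exact inner_unitNormal_of_mem hy
  -- Of the two opposite unit normals, the one to take is dictated by `κ`.
  obtain ⟨κ, hκ, h1, h2⟩ := exists_sgn_add_smul h hM hνL hνM
  rcases hκ with rfl | rfl
  · refine ⟨unitNormal L e, hνL, norm_unitNormal hLe, horth, fun y hy => ?_⟩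
    filter_upwards [h1 y hy] with ε hε
    rw [hε.2, one_mul]
  · refine ⟨-unitNormal L e, L.neg_mem hνL, by rw [norm_neg, norm_unitNormal hLe],
      fun y hy => by rw [inner_neg_left, horth y hy, neg_zero], fun y hy => ?_⟩
    filter_upwards [h2 y hy] with ε hε
    rw [hε.2, neg_neg, one_mul]

/-- Comparison of the unit normal on the side of `e` with the signed normal. -/
lemma exists_unitNormal_eq [FiniteDimensional ℝ V] {E : Finset V} {L : Submodule ℝ V}
    {A : Set (Submodule ℝ V)} (h : IsGen E L A) {e : V} (hM : L ⊓ hyp e ∈ A) :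
    ∃ κ : ℝ, κ * κ = 1 ∧ unitNormal L e = κ • signedNormal L A (L ⊓ hyp e) ∧
      ∀ y ∈ complementIn (L ⊓ hyp e) (restriction A (L ⊓ hyp e)),
      ∀ᶠ ε : ℝ in 𝓝[>] 0, y + ε • unitNormal L e ∈ complementIn L A ∧
        sgn L A (y + ε • unitNormal L e) =
          κ * sgn (L ⊓ hyp e) (evenRestriction A (L ⊓ hyp e)) y := by
  have hLe : ¬ L ≤ hyp e := fun hle => (h.lt hM).ne (inf_eq_left.2 hle)
  obtain ⟨hwL, hw1, hwM, hws⟩ := isSignedNormal_signedNormal h hM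
  set w := signedNormal L A (L ⊓ hyp e) with hw
  set ν := unitNormal L e with hν
  have hνL : ν ∈ L := unitNormal_mem L e
  obtain ⟨κ, hκ, h1, h2⟩ := exists_sgn_add_smul h hM hνL (unitNormal_notMem hLe)
  obtain ⟨q, hq⟩ := complementIn_nonempty (h.restriction hM)
  have hwν := eq_smul_unitNormal hLe hwL hwM
  have hq0 := sgn_mul_self (L ⊓ hyp e) (evenRestriction A (L ⊓ hyp e)) q
  refine ⟨κ, by rcases hκ with h | h <;> simp [h], ?_, h1⟩
  have hc : |⟪ν, w⟫| = 1 := by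
    have := congrArg norm hwν
    rwa [norm_smul, norm_unitNormal hLe, mul_one, hw1, Real.norm_eq_abs, eq_comm] at this
  rw [← hν] at hwν
  rcases eq_or_eq_neg_of_abs_eq hc with h3 | h3
  · rw [h3, one_smul] at hwν
    -- Testing both one-sided formulas at one point beside `q` identifies `κ`.
    obtain ⟨ε, h4, h5⟩ := ((h1 q hq).and (hws q hq)).exists
    rw [hwν] at h5
    have h6 := h4.2.symm.trans h5
    have : κ = 1 := by linear_combination (sgn _ _ q) * h6 - (κ - 1) * hq0
    rw [this, one_smul, hwν]
  · rw [h3, neg_one_smul] at hwν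
    obtain ⟨ε, h4, h5⟩ := ((h2 q hq).and (hws q hq)).exists
    rw [hwν] at h5
    have h6 := h4.2.symm.trans h5
    have : κ = -1 := by linear_combination (-(sgn _ _ q)) * h6 - (κ + 1) * hq0
    rw [this, hwν]; simp

/-- The product formula for the restricted sign function at a generic point. -/
lemma sgn_evenRestriction_eq [FiniteDimensional ℝ V] {E : Finset V} {L M : Submodule ℝ V}
    {A : Set (Submodule ℝ V)} (h : IsGen E L A) (hM : M ∈ A) {r : Submodule ℝ V → V}
    (hr : ∀ M ∈ A, r M ∈ E ∧ M = L ⊓ hyp (r M) ∧ ¬ L ≤ hyp (r M)) {y : V}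
    (hy : y ∈ complementIn M (restriction A M)) :
    sgn M (evenRestriction A M) y =
      (∏ M' ∈ h.finite.toFinset, Real.sign ⟪r M', basePoint L A⟫) *
        (Real.sign ⟪r M, signedNormal L A M⟫ *
          ∏ M' ∈ (h.finite.subset (sdiff_subset : A \ {M} ⊆ A)).toFinset,
            Real.sign ⟪r M', y⟫) := by
  obtain ⟨hwL, hw1, hwM, hws⟩ := isSignedNormal_signedNormal h hM
  have hrw : ⟪r M, signedNormal L A M⟫ ≠ 0 := by
    intro h0
    have hmem : signedNormal L A M ∈ M := by
      rw [(hr M hM).2.1, mem_inf_hyp, ← (hr M hM).2.1]; exact ⟨hwL, h0⟩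
    have := hwM _ hmem
    rw [real_inner_self_eq_norm_sq, hw1] at this
    norm_num at this
  obtain ⟨ε, h1, h2⟩ := ((eventually_sgn_add_smul h hM hr hy hwL hrw).and (hws y hy)).exists
  rw [← h2, h1.2]

end Pizza

end

noncomputable section

namespace Pizza

/-! ### Jumps of a product of signs of affine functions along a segment -/

lemma sign_affine {α β t : ℝ} (hβ : β ≠ 0) :
    Real.sign (α + t * β) = Real.sign β * Real.sign (t - -α / β) := by
  have h : α + t * β = β * (t - -α / β) := by field_simp; ring
  rw [h]
  rcases lt_or_gt_of_ne hβ with h1 | h1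
  · rw [Real.sign_of_neg h1, show β * (t - -α / β) = -((-β) * (t - -α / β)) by ring, Real.sign_neg,
      sign_mul_of_pos (by linarith)]
    ring
  · rw [sign_mul_of_pos h1, Real.sign_of_pos h1, one_mul]

/-- Discrete product rule: the variation of a product of signs of affine functions over a segment
is the sum of the jumps at the roots. -/
lemma prod_sign_sub {ι : Type*} [DecidableEq ι] (F : Finset ι) (α β : ι → ℝ)
    (hdist : ∀ i ∈ F, ∀ j ∈ F, i ≠ j → β i ≠ 0 → α j + -α i / β i * β j ≠ 0) :
    ∀ p q : ℝ, p < q → (∀ i ∈ F, α i + p * β i ≠ 0) → (∀ i ∈ F, α i + q * β i ≠ 0) →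
    (∏ i ∈ F, Real.sign (α i + q * β i)) - ∏ i ∈ F, Real.sign (α i + p * β i) =
      ∑ i ∈ F, 2 * Real.sign (β i) * (if p < -α i / β i ∧ -α i / β i < q then
        ∏ j ∈ F.erase i, Real.sign (α j + -α i / β i * β j) else 0) := by
  induction F using Finset.induction_on with
  | empty => simp
  | insert k F hk ih =>
    intro p q hpq hp hq
    have ih' := ih fun i hi j hj => hdist i (Finset.mem_insert_of_mem hi) j
      (Finset.mem_insert_of_mem hj)
    have hpF : ∀ i ∈ F, α i + p * β i ≠ 0 := fun i hi => hp i (Finset.mem_insert_of_mem hi)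
    have hqF : ∀ i ∈ F, α i + q * β i ≠ 0 := fun i hi => hq i (Finset.mem_insert_of_mem hi)
    have hpk := hp k (Finset.mem_insert_self _ _)
    have hqk := hq k (Finset.mem_insert_self _ _)
    have hterm : ∀ i ∈ F, ∏ j ∈ (insert k F).erase i, Real.sign (α j + -α i / β i * β j) =
        Real.sign (α k + -α i / β i * β k) *
          ∏ j ∈ F.erase i, Real.sign (α j + -α i / β i * β j) := by
      intro i hi
      have hki : k ≠ i := fun h => hk (h ▸ hi)
      rw [Finset.erase_insert_of_ne hki, Finset.prod_insert (fun h => hk (Finset.mem_of_mem_erase h))]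
    rw [Finset.prod_insert hk, Finset.prod_insert hk, Finset.sum_insert hk,
      Finset.erase_insert hk]
    -- Either the new factor changes sign at a point `t` strictly inside the segment, and the
    -- induction hypothesis is used on both halves, where this factor is constant; or it keeps its
    -- sign on the whole segment and factors out.
    by_cases hcase : β k ≠ 0 ∧ p < -α k / β k ∧ -α k / β k < q
    · obtain ⟨hβ, h1, h2⟩ := hcase
      set t := -α k / β k with ht
      have htF : ∀ i ∈ F, α i + t * β i ≠ 0 := fun i hi =>
        hdist k (Finset.mem_insert_self _ _) i (Finset.mem_insert_of_mem hi)
          (fun h => hk (h ▸ hi)) hβ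
      have e1 := ih' p t h1 hpF htF
      have e2 := ih' t q h2 htF hqF
      rw [if_pos ⟨h1, h2⟩, sign_affine hβ, sign_affine hβ, ← ht,
        Real.sign_of_pos (show 0 < q - t by linarith),
        Real.sign_of_neg (show p - t < 0 by linarith)]
      have e3 : ∑ i ∈ F, 2 * Real.sign (β i) * (if p < -α i / β i ∧ -α i / β i < q then
          ∏ j ∈ (insert k F).erase i, Real.sign (α j + -α i / β i * β j) else 0) =
          Real.sign (β k) * (∑ i ∈ F, 2 * Real.sign (β i) *
            (if t < -α i / β i ∧ -α i / β i < q then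
              ∏ j ∈ F.erase i, Real.sign (α j + -α i / β i * β j) else 0)) -
          Real.sign (β k) * (∑ i ∈ F, 2 * Real.sign (β i) *
            (if p < -α i / β i ∧ -α i / β i < t then
              ∏ j ∈ F.erase i, Real.sign (α j + -α i / β i * β j) else 0)) := by
        rw [Finset.mul_sum, Finset.mul_sum, ← Finset.sum_sub_distrib]
        refine Finset.sum_congr rfl fun i hi => ?_
        rw [hterm i hi, sign_affine hβ, ← ht]
        -- For slope `0` the division convention makes `0` a spurious root, but the coefficient
        -- `Real.sign (β i)` vanishes with it.
        by_cases hβi : β i = 0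
        · simp [hβi]
        have hne : -α i / β i ≠ t := by
          intro h0
          have := hdist i (Finset.mem_insert_of_mem hi) k (Finset.mem_insert_self _ _)
            (fun h => hk (h ▸ hi)) hβi
          apply this
          rw [h0, ht]; field_simp; ring
        set u := -α i / β i
        rcases lt_or_gt_of_ne hne with h3 | h3
        · rw [Real.sign_of_neg (show u - t < 0 by linarith),
            if_neg (show ¬ (t < u ∧ u < q) from fun h => absurd h.1 h3.not_gt)]
          by_cases h4 : p < u
          · rw [if_pos ⟨h4, h3.trans h2⟩, if_pos ⟨h4, h3⟩]; ring
          · rw [if_neg (fun h => h4 h.1), if_neg (fun h => h4 h.1)]; ring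
        · rw [Real.sign_of_pos (show 0 < u - t by linarith),
            if_neg (show ¬ (p < u ∧ u < t) from fun h => absurd h.2 h3.not_gt)]
          by_cases h4 : u < q
          · rw [if_pos ⟨h1.trans h3, h4⟩, if_pos ⟨h3, h4⟩]; ring
          · rw [if_neg (fun h => h4 h.2), if_neg (fun h => h4 h.2)]; ring
      rw [e3]
      linear_combination (Real.sign (β k)) * e2 - (Real.sign (β k)) * e1
    · have hconst : ∀ u, p ≤ u → u ≤ q →
          Real.sign (α k + u * β k) = Real.sign (α k + p * β k) := by
        intro u hu1 hu2
        by_cases hβ : β k = 0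
        · simp [hβ]
        rw [sign_affine hβ, sign_affine hβ]
        congr 1
        have hp' : p ≠ -α k / β k := fun h => hpk (by rw [h]; field_simp; ring)
        have hq' : q ≠ -α k / β k := fun h => hqk (by rw [h]; field_simp; ring)
        set t := -α k / β k
        rcases lt_or_gt_of_ne hp' with h | h
        · have h3 : q < t := by
            by_contra hc
            push Not at hc
            exact hcase ⟨hβ, h, lt_of_le_of_ne hc hq'.symm⟩
          rw [Real.sign_of_neg (by linarith), Real.sign_of_neg (by linarith)]
        · rw [Real.sign_of_pos (by linarith), Real.sign_of_pos (by linarith)]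
      have hk0 : 2 * Real.sign (β k) * (if p < -α k / β k ∧ -α k / β k < q then
          ∏ j ∈ F, Real.sign (α j + -α k / β k * β j) else 0) = 0 := by
        by_cases hβ : β k = 0
        · simp [hβ]
        · rw [if_neg (fun h => hcase ⟨hβ, h⟩), mul_zero]
      rw [hk0, zero_add, hconst q hpq.le le_rfl, ← mul_sub, ih' p q hpq hpF hqF, Finset.mul_sum]
      refine Finset.sum_congr rfl fun i hi => ?_
      rw [hterm i hi]
      by_cases hi' : p < -α i / β i ∧ -α i / β i < q
      · rw [if_pos hi', if_pos hi', hconst _ hi'.1.le hi'.2.le]; ring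
      · rw [if_neg hi', if_neg hi']; ring

variable {V : Type*} [NormedAddCommGroup V] [InnerProductSpace ℝ V]

/-! ### Translates and slices -/

lemma mem_translateSet {K : Set V} {a x : V} : x ∈ translateSet K a ↔ x - a ∈ K := by
  simp [translateSet, sub_eq_add_neg]

lemma translateSet_zero (K : Set V) : translateSet K 0 = K := by
  ext x; simp [mem_translateSet]

lemma translateSet_translateSet (K : Set V) (a b : V) :
    translateSet (translateSet K a) b = translateSet K (a + b) := by
  ext x
  simp only [mem_translateSet]
  rw [show x - b - a = x - (a + b) by abel]

lemma translateSet_eq_preimage (K : Set V) (a : V) :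
    translateSet K a = (fun x => x + -a) ⁻¹' K := by
  ext x; rw [mem_translateSet, mem_preimage, sub_eq_add_neg]

/-- `w` is a unit normal vector of the hyperplane `M` of `L`. -/
structure IsUnitNormal (L M : Submodule ℝ V) (w : V) : Prop where
  mem : w ∈ L
  norm_eq : ‖w‖ = 1
  le : M ≤ L
  mem_iff : ∀ x ∈ L, x ∈ M ↔ ⟪w, x⟫ = 0

lemma IsUnitNormal.sub_mem {L M : Submodule ℝ V} {w x : V} (h : IsUnitNormal L M w) (hx : x ∈ L) :
    x - ⟪w, x⟫ • w ∈ M := by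
  rw [h.mem_iff _ (L.sub_mem hx (L.smul_mem _ h.mem)), inner_sub_right, inner_smul_right,
    real_inner_self_eq_norm_sq, h.norm_eq]
  ring

variable [FiniteDimensional ℝ V] [MeasurableSpace V] [BorelSpace V]

instance (L : Submodule ℝ V) : (lebesgue L).IsAddHaarMeasure :=
  inferInstanceAs (volume : Measure L).IsAddHaarMeasure

instance (L : Submodule ℝ V) : SFinite (volOn L) := by
  unfold volOn; infer_instance

lemma map_add_volOn {L : Submodule ℝ V} {v : V} (hv : v ∈ L) :
    (volOn L).map (fun x => x + v) = volOn L := by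
  have h : (fun x : V => x + v) ∘ (fun x : L => (x : V)) =
      (fun x : L => (x : V)) ∘ fun x : L => x + ⟨v, hv⟩ := by
    ext x; simp
  rw [volOn, Measure.map_map (by fun_prop) measurable_subtype_coe, h,
    ← Measure.map_map measurable_subtype_coe (by fun_prop), map_add_right_eq_self]

lemma measurePreserving_add_volOn {L : Submodule ℝ V} {v : V} (hv : v ∈ L) :
    MeasurePreserving (fun x => x + v) (volOn L) (volOn L) :=
  ⟨by fun_prop, map_add_volOn hv⟩

lemma volOn_translateSet {L : Submodule ℝ V} {K : Set V}
    (hK : NullMeasurableSet K (volOn L)) {v : V} (hv : v ∈ L) :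
    volOn L (translateSet K v) = volOn L K := by
  rw [translateSet_eq_preimage]
  exact (measurePreserving_add_volOn (L.neg_mem hv)).measure_preimage hK

/-- The orthogonal decomposition of `L` into `M` and the line of `w` is an isometry for the `L²`
norm on the product, hence preserves volume. -/
lemma measurePreserving_add_smul {L M : Submodule ℝ V} {w : V} (h : IsUnitNormal L M w) :
    MeasurePreserving (fun p : ℝ × V => p.2 + p.1 • w) ((volume : Measure ℝ).prod (volOn M))
      (volOn L) := by
  let f : WithLp 2 (M × ℝ) →ₗ[ℝ] L :=
    { toFun := fun p => ⟨p.ofLp.1 + p.ofLp.2 • w,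
        L.add_mem (h.le p.ofLp.1.2) (L.smul_mem _ h.mem)⟩
      map_add' := fun p q => by
        ext
        simp only [WithLp.ofLp_add, Prod.fst_add, Prod.snd_add, Submodule.coe_add, add_smul]
        abel
      map_smul' := fun c p => by
        ext
        simp [smul_smul] }
  have hnorm : ∀ p, ‖f p‖ = ‖p‖ := by
    intro p
    have h0 : ⟪w, (p.ofLp.1 : V)⟫ = 0 := (h.mem_iff _ (h.le p.ofLp.1.2)).1 p.ofLp.1.2
    have h1 : ‖f p‖ ^ 2 = ‖p‖ ^ 2 := by
      rw [WithLp.prod_norm_sq_eq_of_L2]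
      change ‖(p.ofLp.1 : V) + p.ofLp.2 • w‖ ^ 2 = ‖(p.ofLp.1 : V)‖ ^ 2 + ‖p.ofLp.2‖ ^ 2
      rw [norm_add_sq_real, inner_smul_right, real_inner_comm, h0, norm_smul, h.norm_eq]
      ring
    exact (sq_eq_sq₀ (norm_nonneg _) (norm_nonneg _)).1 h1
  have hsurj : Function.Surjective f := by
    intro x
    refine ⟨WithLp.toLp 2 (⟨x - ⟪w, (x : V)⟫ • w, h.sub_mem x.2⟩, ⟪w, (x : V)⟫), ?_⟩
    ext
    change ((x : V) - ⟪w, (x : V)⟫ • w) + ⟪w, (x : V)⟫ • w = x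
    abel
  let F : WithLp 2 (M × ℝ) ≃ₗᵢ[ℝ] L := LinearIsometryEquiv.ofSurjective ⟨f, hnorm⟩ hsurj
  have h1 : MeasurePreserving (fun p : M × ℝ => F (WithLp.toLp 2 p))
      ((volume : Measure M).prod volume) (volume : Measure L) :=
    F.measurePreserving.comp (WithLp.volume_preserving_toLp M ℝ)
  have h2 : MeasurePreserving (fun p : ℝ × M => F (WithLp.toLp 2 p.swap))
      ((volume : Measure ℝ).prod (volume : Measure M)) (volume : Measure L) :=
    h1.comp Measure.measurePreserving_swap
  refine ⟨by fun_prop, ?_⟩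
  have h3 : (volume : Measure ℝ).prod (volOn M) =
      ((volume : Measure ℝ).prod (volume : Measure M)).map
        (Prod.map id (fun x : M => (x : V))) := by
    rw [← Measure.map_prod_map _ _ measurable_id measurable_subtype_coe, Measure.map_id]
    rfl
  rw [h3, Measure.map_map (by fun_prop) (measurable_id.prodMap measurable_subtype_coe), volOn,
    lebesgue, ← h2.map_eq, Measure.map_map measurable_subtype_coe h2.measurable]
  rfl

/-- Decomposition of the volume of `L` along a hyperplane `M` and a transverse vector `a`. -/
lemma map_sub_smul_volOn {L M : Submodule ℝ V} {w a : V} (h : IsUnitNormal L M w) (ha : a ∈ L)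
    (hwa : ⟪w, a⟫ ≠ 0) :
    ((volume : Measure ℝ).prod (volOn M)).map (fun p : ℝ × V => p.2 - p.1 • a) =
      ENNReal.ofReal |⟪w, a⟫|⁻¹ • volOn L := by
  set β := ⟪w, a⟫ with hβ
  -- The map `(t, y) ↦ y - t a` is a composition of this shear, whose direction `β w - a` lies in
  -- `M`, the scaling of `t` by `-β`, and the orthogonal decomposition. Only the scaling changes the
  -- measure.
  have hskew : MeasurePreserving (fun p : ℝ × V => (p.1, p.2 + p.1 • (β • w - a)))
      ((volume : Measure ℝ).prod (volOn M)) ((volume : Measure ℝ).prod (volOn M)) := by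
    refine MeasurePreserving.skew_product (g := fun t y => y + t • (β • w - a))
      (MeasurePreserving.id _) (by fun_prop) (Eventually.of_forall fun t => ?_)
    refine map_add_volOn (M.smul_mem _ ?_)
    rw [← neg_sub]
    exact M.neg_mem (h.sub_mem ha)
  have hscale : ((volume : Measure ℝ).prod (volOn M)).map (Prod.map (fun t => -β * t) id) =
      ENNReal.ofReal |β|⁻¹ • (volume : Measure ℝ).prod (volOn M) := by
    rw [← Measure.map_prod_map _ _ (by fun_prop) measurable_id, Measure.map_id,
      Real.map_volume_mul_left (neg_ne_zero.2 hwa), Measure.prod_smul_left, abs_inv, abs_neg]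
  have hcomp : (fun p : ℝ × V => p.2 - p.1 • a) =
      (fun p : ℝ × V => p.2 + p.1 • w) ∘ Prod.map (fun t => -β * t) id ∘
        fun p : ℝ × V => (p.1, p.2 + p.1 • (β • w - a)) := by
    ext p
    simp only [Function.comp_apply, Prod.map_apply, id]
    module
  have hm := (measurePreserving_add_smul h)
  rw [hcomp, ← Measure.map_map hm.measurable ((by fun_prop : Measurable _).comp hskew.measurable),
    ← Measure.map_map (by fun_prop) hskew.measurable, hskew.map_eq, hscale, Measure.map_smul,
    hm.map_eq]

lemma quasiMeasurePreserving_sub_smul {L M : Submodule ℝ V} {w a : V} (h : IsUnitNormal L M w)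
    (ha : a ∈ L) (hwa : ⟪w, a⟫ ≠ 0) :
    Measure.QuasiMeasurePreserving (fun p : ℝ × V => p.2 - p.1 • a)
      ((volume : Measure ℝ).prod (volOn M)) (volOn L) := by
  refine ⟨by fun_prop, ?_⟩
  rw [map_sub_smul_volOn h ha hwa]
  exact Measure.smul_absolutelyContinuous

lemma ae_slice {L M : Submodule ℝ V} {w a : V} (h : IsUnitNormal L M w)
    (ha : a ∈ L) (hwa : ⟪w, a⟫ ≠ 0) {p : V → Prop} (hp : ∀ᵐ x ∂volOn L, p x) :
    ∀ᵐ t : ℝ, ∀ᵐ y ∂volOn M, p (y - t • a) :=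
  Measure.ae_ae_of_ae_prod ((quasiMeasurePreserving_sub_smul h ha hwa).ae hp)

/-- By Fubini the exceptional null set meets almost every slice in a null set. Individual slices may
be bad, so the recursion is carried out for almost every `t` only. -/
lemma ae_nullMeasurableSet_slice {L M : Submodule ℝ V} {w a : V} (h : IsUnitNormal L M w)
    (ha : a ∈ L) (hwa : ⟪w, a⟫ ≠ 0) {K : Set V} (hK : NullMeasurableSet K (volOn L)) :
    ∀ᵐ t : ℝ, NullMeasurableSet (translateSet K (t • a)) (volOn M) := by
  obtain ⟨K', hK', hKK'⟩ := hK
  filter_upwards [ae_slice h ha hwa (hKK'.mem_iff)] with t ht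
  refine ⟨translateSet K' (t • a), ?_, ?_⟩
  · rw [translateSet_eq_preimage]; exact hK'.preimage (by fun_prop)
  · filter_upwards [ht] with y hy
    exact propext (by rw [← mem_translateSet, ← mem_translateSet] at hy; exact hy)

lemma ae_volOn_slice_ne_top {L M : Submodule ℝ V} {w a : V} (h : IsUnitNormal L M w)
    (ha : a ∈ L) (hwa : ⟪w, a⟫ ≠ 0) {K : Set V} (hK : volOn L K ≠ ⊤) :
    ∀ᵐ t : ℝ, volOn M (translateSet K (t • a)) ≠ ⊤ := by
  -- No measurability of `K` is assumed; a measurable hull has the same finite volume, and Fubini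
  -- applies to it.
  set K' := toMeasurable (volOn L) K
  have hK' : MeasurableSet K' := measurableSet_toMeasurable _ _
  have hfin : volOn L K' ≠ ⊤ := by rwa [measure_toMeasurable]
  have h1 : ((volume : Measure ℝ).prod (volOn M)) ((fun p : ℝ × V => p.2 - p.1 • a) ⁻¹' K') ≠ ⊤ := by
    rw [← Measure.map_apply (by fun_prop) hK', map_sub_smul_volOn h ha hwa, Measure.smul_apply,
      smul_eq_mul]
    exact ENNReal.mul_ne_top ENNReal.ofReal_ne_top hfin
  filter_upwards [Measure.ae_measure_lt_top (hK'.preimage (by fun_prop)) h1] with t ht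
  refine ((measure_mono fun y hy => ?_).trans_lt ht).ne
  exact subset_toMeasurable _ _ (mem_translateSet.1 hy)

lemma integrable_comp_sub_smul {L M : Submodule ℝ V} {w a : V} (h : IsUnitNormal L M w)
    (ha : a ∈ L) (hwa : ⟪w, a⟫ ≠ 0) {f : V → ℝ} (hf : Integrable f (volOn L)) :
    Integrable (fun p : ℝ × V => f (p.2 - p.1 • a)) ((volume : Measure ℝ).prod (volOn M)) := by
  have h1 : Integrable f (((volume : Measure ℝ).prod (volOn M)).map
      (fun p : ℝ × V => p.2 - p.1 • a)) := by
    rw [map_sub_smul_volOn h ha hwa]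
    exact hf.smul_measure ENNReal.ofReal_ne_top
  exact h1.comp_measurable (by fun_prop)

lemma integral_eq_integral_slices {L M : Submodule ℝ V} {w a : V} (h : IsUnitNormal L M w)
    (ha : a ∈ L) (hwa : ⟪w, a⟫ ≠ 0) {f : V → ℝ} (hf : Integrable f (volOn L)) :
    ∫ x, f x ∂volOn L = |⟪w, a⟫| * ∫ t : ℝ, ∫ y, f (y - t • a) ∂volOn M := by
  have h0 : AEStronglyMeasurable f (((volume : Measure ℝ).prod (volOn M)).map
      (fun p : ℝ × V => p.2 - p.1 • a)) := by
    rw [map_sub_smul_volOn h ha hwa]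
    exact (hf.smul_measure ENNReal.ofReal_ne_top).1
  have h1 := integral_map (by fun_prop : AEMeasurable (fun p : ℝ × V => p.2 - p.1 • a)
    ((volume : Measure ℝ).prod (volOn M))) h0
  have hβ : |⟪w, a⟫| ≠ 0 := abs_ne_zero.2 hwa
  rw [map_sub_smul_volOn h ha hwa, integral_smul_measure,
    ENNReal.toReal_ofReal (inv_nonneg.2 (abs_nonneg _)),
    integral_prod _ (integrable_comp_sub_smul h ha hwa hf), smul_eq_mul] at h1
  rw [← h1, ← mul_assoc, mul_inv_cancel₀ hβ, one_mul]

end Pizza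

end

noncomputable section

namespace Pizza

variable {V : Type*} [NormedAddCommGroup V] [InnerProductSpace ℝ V] [FiniteDimensional ℝ V]

/-! ### The variation of the signed volume under a translation -/

lemma IsGen.isUnitNormal {E : Finset V} {L M : Submodule ℝ V} {A : Set (Submodule ℝ V)}
    (h : IsGen E L A) (hM : M ∈ A) : IsUnitNormal L M (signedNormal L A M) := by
  have hs := isSignedNormal_signedNormal h hM
  obtain ⟨e, he, rfl, hLe⟩ := h M hM
  obtain ⟨κ, -, hκ, -⟩ := exists_unitNormal_eq h hM
  refine ⟨hs.1, hs.2.1, inf_le_left, fun x hx => ⟨hs.2.2.1 x, fun h0 => ?_⟩⟩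
  rw [mem_inf_hyp]
  refine ⟨hx, ?_⟩
  rw [inner_eq_norm_mul_unitNormal hLe hx, hκ, real_inner_smul_left, h0]
  ring

lemma inner_rep_eq {L M : Submodule ℝ V} {w f x : V} (h : IsUnitNormal L M w)
    (hf : M ≤ hyp f) (hx : x ∈ L) : ⟪f, x⟫ = ⟪f, w⟫ * ⟪w, x⟫ := by
  have h1 := mem_hyp.1 (hf (h.sub_mem hx))
  rw [inner_sub_right, inner_smul_right] at h1
  linarith

variable [MeasurableSpace V] [BorelSpace V]

/-- The quantity `-⟪w, x⟫ / ⟪w, a⟫` is the time at which `x + t a` meets `M`. -/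
lemma inner_sub_smul_div {L M : Submodule ℝ V} {w a : V} (h : IsUnitNormal L M w)
    (hwa : ⟪w, a⟫ ≠ 0) {y : V} (hy : y ∈ M) (t : ℝ) : -⟪w, y - t • a⟫ / ⟪w, a⟫ = t := by
  rw [inner_sub_right, inner_smul_right, (h.mem_iff y (h.le hy)).1 hy]
  field_simp
  ring

/-- In the coordinates `x = y - t a` the point where the line through `x` meets `M` is `y`, so a
null set of bad `y` yields a null set of bad `x`. -/
lemma ae_projection {L M : Submodule ℝ V} {w a : V} (h : IsUnitNormal L M w)
    (ha : a ∈ L) (hwa : ⟪w, a⟫ ≠ 0) {S : Set V} (hS : MeasurableSet S)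
    (hSM : ∀ᵐ y ∂volOn M, y ∈ S) :
    ∀ᵐ x ∂volOn L, x + (-⟪w, x⟫ / ⟪w, a⟫) • a ∈ S := by
  have hN : MeasurableSet {x : V | x + (-⟪w, x⟫ / ⟪w, a⟫) • a ∈ S} :=
    hS.preimage (by fun_prop)
  have h1 : ∀ᵐ p : ℝ × V ∂((volume : Measure ℝ).prod (volOn M)),
      (p.2 - p.1 • a) + (-⟪w, p.2 - p.1 • a⟫ / ⟪w, a⟫) • a ∈ S := by
    have hP : MeasurableSet ((fun p : ℝ × V => p.2 - p.1 • a) ⁻¹'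
        {x : V | x + (-⟪w, x⟫ / ⟪w, a⟫) • a ∈ S}) := hN.preimage (by fun_prop)
    refine (Measure.ae_prod_iff_ae_ae hP).2 (Eventually.of_forall fun t => ?_)
    filter_upwards [hSM, ae_mem_volOn M] with y hy hyM
    rw [inner_sub_smul_div h hwa hyM, sub_add_cancel]
    exact hy
  have h2 := (ae_map_iff (f := fun p : ℝ × V => p.2 - p.1 • a) (by fun_prop) hN).2 h1
  rw [map_sub_smul_volOn h ha hwa, ae_iff, Measure.smul_apply, smul_eq_mul, mul_eq_zero] at h2
  rcases h2 with h2 | h2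
  · rw [ENNReal.ofReal_eq_zero] at h2
    exact absurd h2 (not_le.2 (inv_pos.2 (abs_pos.2 hwa)))
  · exact h2

lemma integrableOn_slab {L : Submodule ℝ V} {w a : V} {K : Set V} (hKf : volOn L K ≠ ⊤) {τ : ℝ}
    {G : V → ℝ} (hG : Measurable G) (hG1 : ∀ y, |G y| ≤ 1) :
    IntegrableOn (fun x => if 0 < -⟪w, x⟫ / ⟪w, a⟫ ∧ -⟪w, x⟫ / ⟪w, a⟫ < τ then
      G (x + (-⟪w, x⟫ / ⟪w, a⟫) • a) else 0) K (volOn L) := by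
  refine Measure.integrableOn_of_bounded (M := 1) hKf ?_ (Eventually.of_forall fun x => ?_)
  · refine (Measurable.ite ?_ (hG.comp (by fun_prop)) measurable_const).aestronglyMeasurable
    have hq : Measurable fun x => -⟪w, x⟫ / ⟪w, a⟫ := by fun_prop
    exact (measurableSet_lt measurable_const hq).inter (measurableSet_lt hq measurable_const)
  · rw [Real.norm_eq_abs]
    split_ifs
    · exact hG1 _
    · simp

/-- In the coordinates `x = y - t a` the slab condition reads `0 < t < τ`, the argument of `G` is
`y`, and `x ∈ K` means that `y` is in the translate of `K` by `t a`. -/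
lemma setIntegral_slab {L M : Submodule ℝ V} {w a : V} (h : IsUnitNormal L M w)
    (ha : a ∈ L) (hwa : ⟪w, a⟫ ≠ 0) {K : Set V} (hK : NullMeasurableSet K (volOn L))
    (hKf : volOn L K ≠ ⊤) {τ : ℝ} (hτ : 0 ≤ τ) {G : V → ℝ} (hG : Measurable G)
    (hG1 : ∀ y, |G y| ≤ 1) :
    ∫ x in K, (if 0 < -⟪w, x⟫ / ⟪w, a⟫ ∧ -⟪w, x⟫ / ⟪w, a⟫ < τ then
      G (x + (-⟪w, x⟫ / ⟪w, a⟫) • a) else 0) ∂volOn L =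
      |⟪w, a⟫| * ∫ t in (0 : ℝ)..τ, ∫ y in translateSet K (t • a), G y ∂volOn M := by
  have hint := integrableOn_slab (w := w) (a := a) hKf (τ := τ) hG hG1
  replace hint := hint.integrable_indicator₀ hK
  rw [← integral_indicator₀ hK, integral_eq_integral_slices h ha hwa hint,
    intervalIntegral.integral_of_le hτ, integral_Ioc_eq_integral_Ioo,
    ← integral_indicator measurableSet_Ioo]
  congr 1
  refine integral_congr_ae ?_
  filter_upwards [ae_nullMeasurableSet_slice h ha hwa hK] with t ht
  have h1 : ∀ᵐ y ∂volOn M, K.indicator (fun x =>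
      if 0 < -⟪w, x⟫ / ⟪w, a⟫ ∧ -⟪w, x⟫ / ⟪w, a⟫ < τ then
      G (x + (-⟪w, x⟫ / ⟪w, a⟫) • a) else 0) (y - t • a) =
      (if 0 < t ∧ t < τ then 1 else 0) * (translateSet K (t • a)).indicator G y := by
    filter_upwards [ae_mem_volOn M] with y hy
    by_cases hyK : y - t • a ∈ K
    · rw [indicator_of_mem hyK, indicator_of_mem (mem_translateSet.2 hyK),
        inner_sub_smul_div h hwa hy, sub_add_cancel]
      split_ifs <;> simp
    · rw [indicator_of_notMem hyK, indicator_of_notMem (fun hc => hyK (mem_translateSet.1 hc)),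
        mul_zero]
  rw [integral_congr_ae h1, integral_const_mul, integral_indicator₀ ht]
  by_cases ht' : 0 < t ∧ t < τ
  · rw [if_pos ht', indicator_of_mem (show t ∈ Ioo 0 τ from ht'), one_mul]
  · rw [if_neg ht', indicator_of_notMem (show t ∉ Ioo 0 τ from ht'), zero_mul]

lemma mul_abs_sign (x : ℝ) : Real.sign x * |x| = x := by
  rcases lt_trichotomy x 0 with h | rfl | h
  · rw [Real.sign_of_neg h, abs_of_neg h]; ring
  · simp
  · rw [Real.sign_of_pos h, abs_of_pos h]; ring

lemma abs_real_sign_le (x : ℝ) : |Real.sign x| ≤ 1 := by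
  rcases Real.sign_apply_eq x with h | h | h <;> simp [h]

lemma signedVol_translateSet {L : Submodule ℝ V} {A : Set (Submodule ℝ V)} {K : Set V}
    {v : V} (hv : v ∈ L) :
    signedVol L A (translateSet K v) = ∫ x in K, sgn L A (x + v) ∂volOn L := by
  have hemb : MeasurableEmbedding (fun x : V => x + v) := measurableEmbedding_addRight v
  rw [signedVol, ← (measurePreserving_add_volOn hv).setIntegral_image_emb hemb]
  rfl

/-- The fundamental theorem of calculus for the signed volume, with `2 ⟪w, a⟫` times the restricted
signed volume as the contribution of `M` to the derivative. The jumps of `sgn` along a generic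
segment are listed by `prod_sign_sub` and integrated over `K` hyperplane by hyperplane with
`setIntegral_slab`. -/
lemma signedVol_translateSet_sub {E : Finset V} {L : Submodule ℝ V} {A : Set (Submodule ℝ V)}
    (h : IsGen E L A) {K : Set V} (hK : NullMeasurableSet K (volOn L)) (hKf : volOn L K ≠ ⊤)
    {a : V} (ha : a ∈ L) {τ : ℝ} (hτ : 0 ≤ τ) :
    signedVol L A (translateSet K (τ • a)) - signedVol L A K =
      ∑ M ∈ h.finite.toFinset, 2 * ⟪signedNormal L A M, a⟫ *
        ∫ t in (0 : ℝ)..τ, signedVol M (evenRestriction A M) (translateSet K (t • a)) := by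
  classical
  rcases hτ.eq_or_lt with rfl | hτ0
  · simp [translateSet_zero]
  obtain ⟨r, hr⟩ := h.exists_rep
  have hmemA : ∀ {M}, M ∈ h.finite.toFinset → M ∈ A := fun hM => (Set.Finite.mem_toFinset _).1 hM
  set B := ∏ M' ∈ h.finite.toFinset, Real.sign ⟪r M', basePoint L A⟫ with hB
  have hBs : |B| ≤ 1 := by
    rw [hB, Finset.abs_prod]
    exact Finset.prod_le_one (fun _ _ => abs_nonneg _) fun _ _ => abs_real_sign_le _
  set w := signedNormal L A with hw
  -- An everywhere measurable and bounded version of the restricted sign function; the two agree at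
  -- generic points of `M`.
  let G : Submodule ℝ V → V → ℝ := fun M y => B * (Real.sign ⟪r M, w M⟫ *
    ∏ M' ∈ h.finite.toFinset.erase M, Real.sign ⟪r M', y⟫)
  have hGm : ∀ M, Measurable (G M) := fun M => by
    refine Measurable.const_mul (Measurable.const_mul (Finset.measurable_fun_prod _ fun M' _ => ?_) _) _
    exact measurable_real_sign.comp (by fun_prop : Measurable fun x => ⟪r M', x⟫)
  have hG1 : ∀ M y, |G M y| ≤ 1 := fun M y => by
    simp only [G, abs_mul, Finset.abs_prod]
    refine mul_le_one₀ hBs (by positivity) (mul_le_one₀ (abs_real_sign_le _)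
      (Finset.prod_nonneg fun _ _ => abs_nonneg _) ?_)
    exact Finset.prod_le_one (fun _ _ => abs_nonneg _) fun _ _ => abs_real_sign_le _
  have hGs : ∀ M ∈ A, ∀ y ∈ complementIn M (restriction A M),
      G M y = sgn M (evenRestriction A M) y := fun M hM y hy => by
    rw [sgn_evenRestriction_eq h hM hr hy]
    simp only [G]
    congr 3
    ext M'
    simp [and_comm]
  have hun : ∀ M ∈ A, IsUnitNormal L M (w M) := fun M hM => h.isUnitNormal hM
  have hMr : ∀ M ∈ A, M ≤ hyp (r M) := fun M hM => by
    conv_lhs => rw [(hr M hM).2.1]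
    exact inf_le_right
  have hrw : ∀ M ∈ A, ⟪r M, w M⟫ ≠ 0 := fun M hM h0 => by
    refine (hr M hM).2.2 fun x hx => mem_hyp.2 ?_
    rw [inner_rep_eq (hun M hM) (hMr M hM) hx, h0, zero_mul]
  have hquot : ∀ M ∈ A, ∀ x ∈ L, -⟪r M, x⟫ / ⟪r M, a⟫ = -⟪w M, x⟫ / ⟪w M, a⟫ := by
    intro M hM x hx
    rw [inner_rep_eq (hun M hM) (hMr M hM) hx, inner_rep_eq (hun M hM) (hMr M hM) ha,
      ← mul_neg, mul_div_mul_left _ _ (hrw M hM)]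
  -- the generic points
  have hg1 : ∀ᵐ x ∂volOn L, x ∈ complementIn L A := ae_mem_complementIn h
  have hg2 : ∀ᵐ x ∂volOn L, x + τ • a ∈ complementIn L A :=
    (measurePreserving_add_volOn (L.smul_mem τ ha)).quasiMeasurePreserving.ae hg1
  -- Genericity of the crossing points: where the segment meets `M` it meets no other hyperplane, so
  -- that the jumps happen one at a time.
  have hg3 : ∀ᵐ x ∂volOn L, ∀ M ∈ A, ⟪w M, a⟫ ≠ 0 →
      x + (-⟪w M, x⟫ / ⟪w M, a⟫) • a ∈ complementIn M (restriction A M) := by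
    rw [ae_ball_iff h.finite.countable]
    intro M hM
    by_cases hwa : ⟪w M, a⟫ = 0
    · exact Eventually.of_forall fun x hx => absurd hwa hx
    · filter_upwards [ae_projection (hun M hM) ha hwa
        (measurableSet_complementIn (h.restriction hM)) (ae_mem_complementIn (h.restriction hM))]
        with x hx _ using hx
  have hpt : ∀ᵐ x ∂volOn L, sgn L A (x + τ • a) - sgn L A x =
      ∑ M ∈ h.finite.toFinset, 2 * Real.sign ⟪w M, a⟫ *
        (if 0 < -⟪w M, x⟫ / ⟪w M, a⟫ ∧ -⟪w M, x⟫ / ⟪w M, a⟫ < τ then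
          G M (x + (-⟪w M, x⟫ / ⟪w M, a⟫) • a) else 0) := by
    filter_upwards [hg1, hg2, hg3] with x h1 h2 h3
    have hxL := (mem_complementIn.1 h1).1
    have key := prod_sign_sub h.finite.toFinset (fun M => ⟪r M, x⟫) (fun M => ⟪r M, a⟫) ?_ 0 τ hτ0
      ?_ ?_
    · rw [sgn_eq_prod h hr h2, sgn_eq_prod h hr h1, ← mul_sub]
      simp only [zero_mul, add_zero] at key
      simp only [inner_add_right, inner_smul_right]
      rw [key, Finset.mul_sum]
      refine Finset.sum_congr rfl fun M hM => ?_
      have hM' := hmemA hM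
      rw [hquot M hM' x hxL]
      -- The chosen normal `r M` is a multiple of the signed normal; the sign of the factor is the
      -- one built into `G`.
      have hs : Real.sign ⟪r M, a⟫ = Real.sign ⟪r M, w M⟫ * Real.sign ⟪w M, a⟫ := by
        rw [inner_rep_eq (hun M hM') (hMr M hM') ha, mul_comm ⟪r M, w M⟫]
        by_cases hz : ⟪w M, a⟫ = 0
        · simp [hz]
        · have := sign_affine (α := 0) (β := ⟪w M, a⟫) (t := ⟪r M, w M⟫) hz
          rw [zero_add, neg_zero, zero_div, sub_zero] at this
          rw [mul_comm, this, mul_comm]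
      rw [hs]
      split_ifs with hc
      · simp only [G, inner_add_right, inner_smul_right]
        ring
      · ring
    · intro M hM M' hM' hne hβ
      have hMA := hmemA hM
      have hwa : ⟪w M, a⟫ ≠ 0 := fun h0 => hβ (by
        rw [inner_rep_eq (hun M hMA) (hMr M hMA) ha, h0, mul_zero])
      have := inner_rep_ne_zero_of_restriction h hMA hr (h3 M hMA hwa) (hmemA hM') hne.symm
      rw [inner_add_right, inner_smul_right] at this
      rwa [hquot M hMA x hxL]
    · intro M hM
      rw [zero_mul, add_zero]
      exact inner_rep_ne_zero hr h1 (hmemA hM)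
    · intro M hM
      have := inner_rep_ne_zero hr h2 (hmemA hM)
      rwa [inner_add_right, inner_smul_right] at this
  have hi1 : IntegrableOn (fun x => sgn L A (x + τ • a)) K (volOn L) := by
    refine Measure.integrableOn_of_bounded (M := 1) hKf ?_ ?_
    · exact (aestronglyMeasurable_sgn h).comp_quasiMeasurePreserving
        (measurePreserving_add_volOn (L.smul_mem τ ha)).quasiMeasurePreserving
    · exact Eventually.of_forall fun x => by rw [Real.norm_eq_abs, abs_sgn]
  rw [signedVol_translateSet (L.smul_mem τ ha), signedVol,
    ← integral_sub hi1 (integrableOn_sgn h hKf), integral_congr_ae (ae_restrict_of_ae hpt),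
    integral_finsetSum _ fun M _ =>
      (integrableOn_slab (w := w M) (a := a) hKf (hGm M) (hG1 M)).const_mul _]
  refine Finset.sum_congr rfl fun M hM => ?_
  have hMA := hmemA hM
  rw [integral_const_mul]
  by_cases hwa : ⟪w M, a⟫ = 0
  · simp [hwa]
  rw [setIntegral_slab (hun M hMA) ha hwa hK hKf hτ (hGm M) (hG1 M)]
  have hGint : ∀ t : ℝ, ∫ y in translateSet K (t • a), G M y ∂volOn M =
      signedVol M (evenRestriction A M) (translateSet K (t • a)) := fun t => by
    refine integral_congr_ae (ae_restrict_of_ae ?_)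
    filter_upwards [ae_mem_complementIn (h.restriction hMA)] with y hy using hGs M hMA y hy
  simp only [hGint]
  rw [mul_assoc 2, mul_assoc 2, ← mul_assoc (Real.sign _), mul_abs_sign, ← mul_assoc]

end Pizza

end

noncomputable section

namespace Pizza

variable {V : Type*} [NormedAddCommGroup V] [InnerProductSpace ℝ V]

/-! ### Flags of iterated even restrictions -/

/-- The maximal sequences of hyperplanes of iterated even restrictions. -/
def IsMaxFlag : Set (Submodule ℝ V) → List (Submodule ℝ V) → Prop
  | A, [] => A = ∅
  | A, M :: ms => M ∈ A ∧ IsMaxFlag (evenRestriction A M) ms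

/-- The last member of a flag starting at `L`. -/
def flagEnd : Submodule ℝ V → List (Submodule ℝ V) → Submodule ℝ V
  | L, [] => L
  | _, M :: ms => flagEnd M ms

lemma setOf_isMaxFlag_empty :
    {ms | IsMaxFlag (∅ : Set (Submodule ℝ V)) ms} = {[]} := by
  ext ms
  cases ms <;> simp [IsMaxFlag]

lemma setOf_isMaxFlag_eq_biUnion {A : Set (Submodule ℝ V)} (hA : A ≠ ∅) :
    {ms | IsMaxFlag A ms} =
      ⋃ M ∈ A, (fun ms => M :: ms) '' {ms | IsMaxFlag (evenRestriction A M) ms} := by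
  ext ms
  cases ms with
  | nil => simp [IsMaxFlag, hA]
  | cons M ms => simp [IsMaxFlag, and_comm]

lemma finrank_lt_of_mem [FiniteDimensional ℝ V] {E : Finset V} {L M : Submodule ℝ V}
    {A : Set (Submodule ℝ V)} (h : IsGen E L A) (hM : M ∈ A) :
    Module.finrank ℝ M < Module.finrank ℝ L :=
  Submodule.finrank_lt_finrank_of_lt (h.lt hM)

lemma isMaxFlag_finite_aux [FiniteDimensional ℝ V] {E : Finset V} (n : ℕ) :
    ∀ (L : Submodule ℝ V) (A : Set (Submodule ℝ V)), Module.finrank ℝ L ≤ n → IsGen E L A →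
      {ms | IsMaxFlag A ms}.Finite := by
  induction n with
  | zero =>
    intro L A hL h
    have hA : A = ∅ := Set.eq_empty_of_forall_notMem fun M hM => by
      have := finrank_lt_of_mem h hM; omega
    rw [hA, setOf_isMaxFlag_empty]
    exact Set.finite_singleton _
  | succ n ih =>
    intro L A hL h
    by_cases hA : A = ∅
    · rw [hA, setOf_isMaxFlag_empty]
      exact Set.finite_singleton _
    · rw [setOf_isMaxFlag_eq_biUnion hA]
      refine h.finite.biUnion fun M hM => Set.Finite.image _ (ih M _ ?_ (h.evenRestriction hM))
      have := finrank_lt_of_mem h hM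
      omega

lemma isMaxFlag_finite [FiniteDimensional ℝ V] {E : Finset V} {L : Submodule ℝ V}
    {A : Set (Submodule ℝ V)} (h : IsGen E L A) : {ms | IsMaxFlag A ms}.Finite :=
  isMaxFlag_finite_aux _ L A le_rfl h

lemma finsum_isMaxFlag [FiniteDimensional ℝ V] {E : Finset V} {L : Submodule ℝ V}
    {A : Set (Submodule ℝ V)} (h : IsGen E L A) (hA : A ≠ ∅) (F : List (Submodule ℝ V) → ℝ) :
    ∑ᶠ ms ∈ {ms | IsMaxFlag A ms}, F ms = ∑ M ∈ h.finite.toFinset,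
      ∑ᶠ ms ∈ {ms | IsMaxFlag (evenRestriction A M) ms}, F (M :: ms) := by
  have hinj : ∀ M : Submodule ℝ V, Function.Injective fun ms => M :: ms :=
    fun M _ _ h => (List.cons.inj h).2
  rw [setOf_isMaxFlag_eq_biUnion hA, finsum_mem_biUnion ?_ h.finite
    fun M hM => (isMaxFlag_finite (h.evenRestriction hM)).image _,
    finsum_mem_eq_finite_toFinset_sum _ h.finite]
  · exact Finset.sum_congr rfl fun M _ => finsum_mem_image (hinj M).injOn
  · intro M _ M' _ hne
    refine Set.disjoint_left.2 ?_
    rintro _ ⟨ms, -, rfl⟩ ⟨ms', -, h'⟩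
    exact hne (List.cons.inj h').1.symm

variable [FiniteDimensional ℝ V]

/-- The product of the components of `a` along the signed normals of a flag. -/
def flagCoeff (a : V) : Submodule ℝ V → Set (Submodule ℝ V) → List (Submodule ℝ V) → ℝ
  | _, _, [] => 1
  | L, A, M :: ms => ⟪signedNormal L A M, proj L a⟫ * flagCoeff a M (evenRestriction A M) ms

/-- The combination `∑ tᵢ (π_{i-1} a - π_i a)` of the components of `a` along a flag. -/
def flagShift (a : V) : Submodule ℝ V → List (Submodule ℝ V) → List ℝ → V
  | L, M :: ms, t :: ts => t • (proj L a - proj M a) + flagShift a M ms ts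
  | _, _, _ => 0

/-- The points `x` such that `-x` has decreasing coordinates in `(0, τ]` along the components of
`a` with respect to the flag. -/
def flagRegion (a : V) : Submodule ℝ V → List (Submodule ℝ V) → ℝ → Set V
  | _, [], _ => univ
  | L, M :: ms, τ => {x | 0 < -⟪proj L a - proj M a, x⟫ / ‖proj L a - proj M a‖ ^ 2 ∧
      -⟪proj L a - proj M a, x⟫ / ‖proj L a - proj M a‖ ^ 2 ≤ τ ∧
      x ∈ flagRegion a M ms (-⟪proj L a - proj M a, x⟫ / ‖proj L a - proj M a‖ ^ 2)}

/-- A flag of hyperplanes, none of which contains the projection of `a`. -/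
def IsTransverse (a : V) : Submodule ℝ V → List (Submodule ℝ V) → Prop
  | _, [] => True
  | L, M :: ms => (∃ w, IsUnitNormal L M w ∧ ⟪w, proj L a⟫ ≠ 0) ∧ IsTransverse a M ms

lemma proj_sub_proj {L M : Submodule ℝ V} {w : V} (h : IsUnitNormal L M w) (a : V) :
    proj L a - proj M a = ⟪w, proj L a⟫ • w := by
  have h1 : proj M a = proj L a - ⟪w, proj L a⟫ • w := by
    refine (Submodule.eq_starProjection_of_mem_of_inner_eq_zero (h.sub_mem (proj_mem L a))
      fun y hy => ?_)
    rw [inner_sub_left, inner_sub_left, inner_proj a (h.le hy), real_inner_smul_left,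
      (h.mem_iff y (h.le hy)).1 hy]
    ring
  rw [h1]; abel

lemma flagRegion_add {a : V} {L : Submodule ℝ V} {ms : List (Submodule ℝ V)}
    (h : IsTransverse a L ms) {v : V} (hv : ∀ y ∈ L, ⟪y, v⟫ = 0) (τ : ℝ) (x : V) :
    x + v ∈ flagRegion a L ms τ ↔ x ∈ flagRegion a L ms τ := by
  induction ms generalizing L τ with
  | nil => simp [flagRegion]
  | cons M ms ih =>
    obtain ⟨⟨w, hw, -⟩, h2⟩ := h
    have hd : ⟪proj L a - proj M a, x + v⟫ = ⟪proj L a - proj M a, x⟫ := by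
      rw [inner_add_right, hv _ (L.sub_mem (proj_mem L a) (hw.le (proj_mem M a))), add_zero]
    simp only [flagRegion, mem_ofPred_eq, hd]
    rw [ih h2 fun y hy => hv y (hw.le hy)]

/-! ### Iterated integrals along a flag as volumes of regions -/

variable [MeasurableSpace V] [BorelSpace V]

lemma measurableSet_flagRegion_prod (a : V) (ms : List (Submodule ℝ V)) :
    ∀ L : Submodule ℝ V, MeasurableSet {p : V × ℝ | p.1 ∈ flagRegion a L ms p.2} := by
  induction ms with
  | nil => intro L; simp [flagRegion]
  | cons M ms ih =>
    intro L
    have hℓ : Measurable fun p : V × ℝ =>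
        -⟪proj L a - proj M a, p.1⟫ / ‖proj L a - proj M a‖ ^ 2 := by fun_prop
    have h1 : Measurable fun p : V × ℝ =>
        (p.1, -⟪proj L a - proj M a, p.1⟫ / ‖proj L a - proj M a‖ ^ 2) :=
      measurable_fst.prodMk hℓ
    exact (measurableSet_lt measurable_const hℓ).inter
      ((measurableSet_le hℓ measurable_snd).inter ((ih M).preimage h1))

lemma measurableSet_flagRegion (a : V) (ms : List (Submodule ℝ V)) (L : Submodule ℝ V) (τ : ℝ) :
    MeasurableSet (flagRegion a L ms τ) :=
  (measurableSet_flagRegion_prod a ms L).preimage (measurable_id.prodMk measurable_const)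

lemma integrable_volOn_slice {L M : Submodule ℝ V} {w a : V} (h : IsUnitNormal L M w)
    (ha : a ∈ L) (hwa : ⟪w, a⟫ ≠ 0) {D : Set V} (hD : NullMeasurableSet D (volOn L))
    (hDf : volOn L D ≠ ⊤) :
    Integrable (fun t : ℝ => (volOn M).real (translateSet D (t • a))) ∧
      ∫ t : ℝ, (volOn M).real (translateSet D (t • a)) = |⟪w, a⟫|⁻¹ * (volOn L).real D := by
  have hint : Integrable (D.indicator fun _ => (1 : ℝ)) (volOn L) :=
    IntegrableOn.integrable_indicator₀ (integrableOn_const hDf) hD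
  have hae : ∀ᵐ t : ℝ, ∫ y, D.indicator (fun _ => (1 : ℝ)) (y - t • a) ∂volOn M =
      (volOn M).real (translateSet D (t • a)) := by
    filter_upwards [ae_nullMeasurableSet_slice h ha hwa hD] with t ht
    have : (fun y => D.indicator (fun _ => (1 : ℝ)) (y - t • a)) =
        (translateSet D (t • a)).indicator fun _ => (1 : ℝ) := by
      ext y
      by_cases hy : y - t • a ∈ D
      · rw [indicator_of_mem hy, indicator_of_mem (mem_translateSet.2 hy)]
      · rw [indicator_of_notMem hy, indicator_of_notMem fun hc => hy (mem_translateSet.1 hc)]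
    rw [this, integral_indicator₀ ht]
    simp
  refine ⟨((integrable_comp_sub_smul h ha hwa hint).integral_prod_left).congr hae, ?_⟩
  have h1 := integral_eq_integral_slices h ha hwa hint
  rw [integral_indicator₀ hD, integral_congr_ae hae] at h1
  simp only [integral_const, smul_eq_mul, mul_one, measureReal_restrict_apply_univ] at h1
  rw [h1, ← mul_assoc, inv_mul_cancel₀ (abs_ne_zero.2 hwa), one_mul]

/-- On the slice of parameter `t` the first coordinate is constantly `t`, which becomes the bound
for the next coordinate. The remaining conditions do not see the shift, since it is orthogonal to
`M`. -/
lemma volOn_real_slice_flagRegion {a : V} {L M : Submodule ℝ V} {w : V}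
    {ms : List (Submodule ℝ V)} (hw : IsUnitNormal L M w) (hwa : ⟪w, proj L a⟫ ≠ 0)
    (hms : IsTransverse a M ms) (K : Set V) (τ t : ℝ) :
    (volOn M).real (translateSet (K ∩ flagRegion a L (M :: ms) τ) (t • (proj L a - proj M a))) =
      (Ioc 0 τ).indicator (fun t => (volOn M).real
        (translateSet K (t • (proj L a - proj M a)) ∩ flagRegion a M ms t)) t := by
  have hd := proj_sub_proj hw a
  set d := proj L a - proj M a with hdd
  have hdM : ∀ y ∈ M, ⟪d, y⟫ = 0 := fun y hy => by
    rw [hd, real_inner_smul_left, (hw.mem_iff y (hw.le hy)).1 hy, mul_zero]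
  have hd0 : ‖d‖ ^ 2 ≠ 0 := by
    rw [hd, norm_smul, hw.norm_eq, mul_one, Real.norm_eq_abs, sq_abs]
    exact pow_ne_zero 2 hwa
  have hmem : ∀ y ∈ M, (y - t • d ∈ flagRegion a L (M :: ms) τ ↔
      t ∈ Ioc 0 τ ∧ y ∈ flagRegion a M ms t) := by
    intro y hy
    have hℓ : -⟪d, y - t • d⟫ / ‖d‖ ^ 2 = t := by
      rw [inner_sub_right, inner_smul_right, hdM y hy, real_inner_self_eq_norm_sq,
        zero_sub, neg_neg, mul_div_assoc, div_self hd0, mul_one]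
    simp only [flagRegion, mem_ofPred_eq, ← hdd, hℓ, mem_Ioc, and_assoc]
    rw [sub_eq_add_neg, flagRegion_add hms]
    intro z hz
    rw [inner_neg_right, inner_smul_right, real_inner_comm, hdM z hz]
    ring
  by_cases ht : t ∈ Ioc 0 τ
  · rw [indicator_of_mem ht]
    refine measureReal_congr ?_
    filter_upwards [ae_mem_volOn M] with y hy
    refine propext ?_
    change y ∈ translateSet _ _ ↔ y ∈ translateSet _ _ ∩ _
    rw [mem_inter_iff, mem_translateSet, mem_translateSet, mem_inter_iff, hmem y hy]
    tauto
  · rw [indicator_of_notMem ht]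
    have : (volOn M).real (∅ : Set V) = 0 := measureReal_empty
    rw [← this]
    refine measureReal_congr ?_
    filter_upwards [ae_mem_volOn M] with y hy
    refine propext ?_
    change y ∈ translateSet _ _ ↔ y ∈ (∅ : Set V)
    rw [mem_translateSet, mem_inter_iff, hmem y hy]
    simp [ht]

/-- The iterated integral of the volumes of the translates of `K` by the vectors `flagShift`. -/
def flagIntegral (a : V) (L : Submodule ℝ V) (ms : List (Submodule ℝ V)) (τ : ℝ) (K : Set V) : ℝ :=
  iterIntegral ms.length τ fun ts =>
    (volOn (flagEnd L ms)).real (translateSet K (flagShift a L ms ts))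

lemma flagIntegral_cons (a : V) (L M : Submodule ℝ V) (ms : List (Submodule ℝ V)) (τ : ℝ)
    (K : Set V) : flagIntegral a L (M :: ms) τ K =
      ∫ t in (0 : ℝ)..τ, flagIntegral a M ms t (translateSet K (t • (proj L a - proj M a))) := by
  simp only [flagIntegral, List.length_cons, iterIntegral, flagEnd, flagShift,
    translateSet_translateSet]

/-- Fubini, one hyperplane at a time. The use of this formula is that `J` depends neither on `K` nor
on `τ`: the inner iterated integral becomes a constant times a slice volume, whose integrability in
`t` is known. -/
lemma exists_flagIntegral_eq (a : V) (ms : List (Submodule ℝ V)) :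
    ∀ L : Submodule ℝ V, IsTransverse a L ms → ∃ J : ℝ, ∀ K : Set V,
      NullMeasurableSet K (volOn L) → volOn L K ≠ ⊤ → ∀ τ : ℝ, 0 ≤ τ →
      flagIntegral a L ms τ K = J * (volOn L).real (K ∩ flagRegion a L ms τ) := by
  induction ms with
  | nil =>
    intro L _
    refine ⟨1, fun K _ _ τ _ => ?_⟩
    simp [flagIntegral, iterIntegral, flagShift, flagEnd, flagRegion, translateSet_zero]
  | cons M ms ih =>
    rintro L ⟨⟨w, hw, hwa⟩, hms⟩
    obtain ⟨J, hJ⟩ := ih M hms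
    have hd := proj_sub_proj hw a
    have hdL : proj L a - proj M a ∈ L := L.sub_mem (proj_mem L a) (hw.le (proj_mem M a))
    have hwd : ⟪w, proj L a - proj M a⟫ ≠ 0 := by
      rw [hd, inner_smul_right, real_inner_self_eq_norm_sq, hw.norm_eq]
      simpa using hwa
    refine ⟨J * |⟪w, proj L a - proj M a⟫|⁻¹, fun K hK hKf τ hτ => ?_⟩
    have hD : NullMeasurableSet (K ∩ flagRegion a L (M :: ms) τ) (volOn L) :=
      hK.inter (measurableSet_flagRegion a _ L τ).nullMeasurableSet
    have hDf : volOn L (K ∩ flagRegion a L (M :: ms) τ) ≠ ⊤ :=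
      measure_ne_top_of_subset inter_subset_left hKf
    rw [mul_assoc, ← (integrable_volOn_slice hw hdL hwd hD hDf).2]
    simp only [volOn_real_slice_flagRegion hw hwa hms]
    rw [integral_indicator measurableSet_Ioc, ← intervalIntegral.integral_of_le hτ,
      ← intervalIntegral.integral_const_mul, flagIntegral_cons]
    refine intervalIntegral.integral_congr_ae ?_
    filter_upwards [ae_nullMeasurableSet_slice hw hdL hwd hK,
      ae_volOn_slice_ne_top hw hdL hwd hKf] with t h1 h2 ht
    rw [uIoc_of_le hτ] at ht
    exact hJ _ h1 h2 t ht.1.le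

lemma intervalIntegrable_flagIntegral {a : V} {L M : Submodule ℝ V} {w : V}
    {ms : List (Submodule ℝ V)} (hw : IsUnitNormal L M w) (hwa : ⟪w, proj L a⟫ ≠ 0)
    (hms : IsTransverse a M ms) {K : Set V} (hK : NullMeasurableSet K (volOn L))
    (hKf : volOn L K ≠ ⊤) {τ : ℝ} (hτ : 0 ≤ τ) :
    IntervalIntegrable (fun t =>
      flagIntegral a M ms t (translateSet K (t • (proj L a - proj M a)))) volume 0 τ := by
  obtain ⟨J, hJ⟩ := exists_flagIntegral_eq a ms M hms
  have hd := proj_sub_proj hw a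
  have hdL : proj L a - proj M a ∈ L := L.sub_mem (proj_mem L a) (hw.le (proj_mem M a))
  have hwd : ⟪w, proj L a - proj M a⟫ ≠ 0 := by
    rw [hd, inner_smul_right, real_inner_self_eq_norm_sq, hw.norm_eq]
    simpa using hwa
  have hD : NullMeasurableSet (K ∩ flagRegion a L (M :: ms) τ) (volOn L) :=
    hK.inter (measurableSet_flagRegion a _ L τ).nullMeasurableSet
  have hDf : volOn L (K ∩ flagRegion a L (M :: ms) τ) ≠ ⊤ :=
    measure_ne_top_of_subset inter_subset_left hKf
  have h1 := (integrable_volOn_slice hw hdL hwd hD hDf).1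
  simp only [volOn_real_slice_flagRegion hw hwa hms] at h1
  rw [integrable_indicator_iff measurableSet_Ioc] at h1
  rw [intervalIntegrable_iff_integrableOn_Ioc_of_le hτ]
  refine (h1.const_mul J).congr ?_
  rw [Filter.EventuallyEq, ae_restrict_iff' measurableSet_Ioc]
  filter_upwards [ae_nullMeasurableSet_slice hw hdL hwd hK,
    ae_volOn_slice_ne_top hw hdL hwd hKf] with t h1 h2 ht
  exact (hJ _ h1 h2 t ht.1.le).symm

/-- Flags that are not transverse to `a` have coefficient `0`, so integrability along them is never
needed. -/
lemma isTransverse_of_flagCoeff_ne_zero {E : Finset V} {a : V} {ms : List (Submodule ℝ V)} :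
    ∀ {L : Submodule ℝ V} {A : Set (Submodule ℝ V)}, IsGen E L A → IsMaxFlag A ms →
      flagCoeff a L A ms ≠ 0 → IsTransverse a L ms := by
  induction ms with
  | nil => intros; trivial
  | cons M ms ih =>
    intro L A h hms hc
    rw [flagCoeff] at hc
    exact ⟨⟨_, h.isUnitNormal hms.1, left_ne_zero_of_mul hc⟩,
      ih (h.evenRestriction hms.1) hms.2 (right_ne_zero_of_mul hc)⟩

/-! ### The expansion of the signed volume of a translate -/

/-- The slices of `K` along the nonmaximal even restriction sequences of `A` in `L` have
vanishing signed volume. -/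
def RelSymm (E : Finset V) (L : Submodule ℝ V) (A : Set (Submodule ℝ V)) (K : Set V) : Prop :=
  ∀ s, IsEvenSeq E L A s → flagArr L A s ≠ ∅ → ∀ a ∈ L, a ∈ (flagSpace L s)ᗮ →
    NullMeasurableSet (translateSet K a) (volOn (flagSpace L s)) →
    volOn (flagSpace L s) (translateSet K a) ≠ ⊤ →
    signedVol (flagSpace L s) (flagArr L A s) (translateSet K a) = 0

lemma flagSpace_le (L : Submodule ℝ V) (s : List V) : flagSpace L s ≤ L := by
  induction s generalizing L with
  | nil => exact le_rfl
  | cons e s ih => exact (ih _).trans inf_le_left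

/-- A sequence for the restriction to `M = L ∩ H_e` becomes one for `A` by putting `e` in front, and
`d` joins the orthogonal shift. The symmetry condition thereby descends to slices. -/
lemma RelSymm.translateSet {E : Finset V} {L M : Submodule ℝ V} {A : Set (Submodule ℝ V)}
    {K : Set V} (hK : RelSymm E L A K) (h : IsGen E L A) (hM : M ∈ A) {d : V} (hd : d ∈ L)
    (hdM : d ∈ Mᗮ) : RelSymm E M (evenRestriction A M) (translateSet K d) := by
  obtain ⟨e, he, rfl, -⟩ := h M hM
  intro s hs hne a ha hao
  rw [translateSet_translateSet]
  refine hK (e :: s) ⟨he, hM, hs⟩ hne (d + a) (L.add_mem hd (inf_le_left (a := L) ha)) ?_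
  exact Submodule.add_mem _ (Submodule.orthogonal_le (flagSpace_le _ s) hdM) hao

/-- Induction on the dimension through `signedVol_translateSet_sub`. A general upper limit `τ` is
needed because the next level is integrated only up to the current `t`. -/
theorem signedVol_translateSet_eq_finsum {E : Finset V} (a : V) (n : ℕ) :
    ∀ (L : Submodule ℝ V) (A : Set (Submodule ℝ V)), Module.finrank ℝ L ≤ n → IsGen E L A →
    ∀ K : Set V, NullMeasurableSet K (volOn L) → volOn L K ≠ ⊤ → RelSymm E L A K →
    ∀ τ : ℝ, 0 ≤ τ → signedVol L A (translateSet K (τ • proj L a)) =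
      ∑ᶠ ms ∈ {ms | IsMaxFlag A ms},
        2 ^ ms.length * flagCoeff a L A ms * flagIntegral a L ms τ K := by
  have hempty : ∀ (L : Submodule ℝ V) (K : Set V), NullMeasurableSet K (volOn L) →
      ∀ τ : ℝ, signedVol L ∅ (translateSet K (τ • proj L a)) =
      ∑ᶠ ms ∈ {ms | IsMaxFlag (∅ : Set (Submodule ℝ V)) ms},
        2 ^ ms.length * flagCoeff a L ∅ ms * flagIntegral a L ms τ K := by
    intro L K hK τ
    rw [setOf_isMaxFlag_empty, finsum_mem_singleton]
    simp only [signedVol, sgn_empty, flagCoeff, flagIntegral, List.length_nil, iterIntegral,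
      flagShift, flagEnd, translateSet_zero, pow_zero, one_mul, integral_const, smul_eq_mul,
      mul_one, measureReal_restrict_apply_univ]
    rw [Measure.real, Measure.real, volOn_translateSet hK (L.smul_mem _ (proj_mem L a))]
  induction n with
  | zero =>
    intro L A hL h K hK hKf hs τ hτ
    have hA : A = ∅ := Set.eq_empty_of_forall_notMem fun M hM => by
      have := finrank_lt_of_mem h hM; omega
    subst hA
    exact hempty L K hK τ
  | succ n ih =>
    intro L A hL h K hK hKf hs τ hτ
    by_cases hA : A = ∅
    · subst hA
      exact hempty L K hK τ
    -- The empty sequence, with zero shift, is among the symmetry conditions, since the arrangement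
    -- is nonempty.
    have hzero : signedVol L A K = 0 := by
      have := hs [] trivial hA 0 L.zero_mem (Submodule.zero_mem _)
      rw [translateSet_zero] at this
      exact this hK hKf
    have hj := signedVol_translateSet_sub h hK hKf (proj_mem L a) hτ
    rw [hzero, sub_zero] at hj
    rw [hj, finsum_isMaxFlag h hA]
    refine Finset.sum_congr rfl fun M hM => ?_
    rw [Set.Finite.mem_toFinset] at hM
    have hw := h.isUnitNormal hM
    have hgen := h.evenRestriction hM
    simp only [List.length_cons, flagCoeff, pow_succ]
    by_cases hwa : ⟪signedNormal L A M, proj L a⟫ = 0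
    · simp [hwa]
    have hdL : proj L a - proj M a ∈ L := L.sub_mem (proj_mem L a) (hw.le (proj_mem M a))
    have hd := proj_sub_proj hw a
    have hwd : ⟪signedNormal L A M, proj L a - proj M a⟫ ≠ 0 := by
      rw [hd, inner_smul_right, real_inner_self_eq_norm_sq, hw.norm_eq]
      simpa using hwa
    have hdM : proj L a - proj M a ∈ Mᗮ := by
      rw [Submodule.mem_orthogonal']
      intro y hy
      rw [hd, real_inner_smul_left, (hw.mem_iff y (hw.le hy)).1 hy, mul_zero]
    have hfin := isMaxFlag_finite hgen
    -- The shift `t π_L a` is split into its part orthogonal to `M`, which is moved into the set,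
    -- and `t π_M a`, to which the induction hypothesis applies with `t` in place of `τ`.
    have hae : ∀ᵐ t : ℝ, t ∈ uIoc 0 τ →
        signedVol M (evenRestriction A M) (translateSet K (t • proj L a)) =
        ∑ ms ∈ hfin.toFinset, 2 ^ ms.length * flagCoeff a M (evenRestriction A M) ms *
          flagIntegral a M ms t (translateSet K (t • (proj L a - proj M a))) := by
      filter_upwards [ae_nullMeasurableSet_slice hw hdL hwd hK,
        ae_volOn_slice_ne_top hw hdL hwd hKf] with t h1 h2 ht
      rw [uIoc_of_le hτ] at ht
      have hML : Module.finrank ℝ M ≤ n := by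
        have := finrank_lt_of_mem h hM; omega
      have := ih M (evenRestriction A M) hML hgen _ h1 h2
        (hs.translateSet h hM (L.smul_mem t hdL) (Submodule.smul_mem _ t hdM)) t ht.1.le
      rw [translateSet_translateSet, ← smul_add, sub_add_cancel,
        finsum_mem_eq_finite_toFinset_sum _ hfin] at this
      exact this
    rw [intervalIntegral.integral_congr_ae hae, intervalIntegral.integral_finsetSum ?_,
      Finset.mul_sum, finsum_mem_eq_finite_toFinset_sum _ hfin]
    · refine Finset.sum_congr rfl fun ms _ => ?_
      rw [intervalIntegral.integral_const_mul, flagIntegral_cons]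
      ring
    · intro ms hms
      rw [Set.Finite.mem_toFinset] at hms
      by_cases hc : flagCoeff a M (evenRestriction A M) ms = 0
      · simp [hc]
      · exact (intervalIntegrable_flagIntegral hw hwa
          (isTransverse_of_flagCoeff_ne_zero hgen hms hc) hK hKf hτ).const_mul _

end Pizza

end

noncomputable section

namespace Pizza

variable {V : Type*} [NormedAddCommGroup V] [InnerProductSpace ℝ V]

/-! ### Even restriction sequences and their flags -/

/-- The flag `L ∩ H_{e₁}, L ∩ H_{e₁} ∩ H_{e₂}, …`. -/
def flagOf : Submodule ℝ V → List V → List (Submodule ℝ V)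
  | _, [] => []
  | L, e :: s => (L ⊓ hyp e) :: flagOf (L ⊓ hyp e) s

lemma length_flagOf (L : Submodule ℝ V) (s : List V) : (flagOf L s).length = s.length := by
  induction s generalizing L with
  | nil => rfl
  | cons e s ih => simp [flagOf, ih]

lemma flagEnd_flagOf (L : Submodule ℝ V) (s : List V) :
    flagEnd L (flagOf L s) = flagSpace L s := by
  induction s generalizing L with
  | nil => rfl
  | cons e s ih => simp [flagOf, flagEnd, flagSpace, ih]

lemma flagOf_take (L : Submodule ℝ V) (s : List V) (i : ℕ) :
    flagOf L (s.take i) = (flagOf L s).take i := by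
  induction s generalizing L i with
  | nil => simp [flagOf]
  | cons e s ih =>
    cases i with
    | zero => simp [flagOf]
    | succ i => simp [flagOf, ih]

lemma flagOf_eq_iff (L : Submodule ℝ V) (s s' : List V) :
    flagOf L s = flagOf L s' ↔
      s.length = s'.length ∧ ∀ i, flagSpace L (s.take i) = flagSpace L (s'.take i) := by
  constructor
  · intro h
    refine ⟨by rw [← length_flagOf L s, h, length_flagOf], fun i => ?_⟩
    rw [← flagEnd_flagOf, ← flagEnd_flagOf, flagOf_take, flagOf_take, h]
  · rintro ⟨hl, h⟩
    induction s generalizing L s' with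
    | nil =>
      rw [List.length_nil, eq_comm, List.length_eq_zero_iff] at hl
      rw [hl]
    | cons e s ih =>
      cases s' with
      | nil => simp at hl
      | cons e' s' =>
        have h1 : L ⊓ hyp e = L ⊓ hyp e' := by simpa [flagSpace] using h 1
        rw [flagOf, flagOf, ← h1]
        congr 1
        refine ih _ _ (by simpa using hl) fun i => ?_
        have := h (i + 1)
        simpa [flagSpace, ← h1] using this

lemma flagSetoid_iff {s s' : List V} :
    (flagSetoid V).r s s' ↔ flagOf ⊤ s = flagOf ⊤ s' := (flagOf_eq_iff ⊤ s s').symm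

lemma flagShift_flagOf [FiniteDimensional ℝ V] (a : V) (L : Submodule ℝ V) (s : List V)
    (ts : List ℝ) : flagShift a L (flagOf L s) ts = shift a L s ts := by
  induction s generalizing L ts with
  | nil => simp [flagOf, flagShift, shift]
  | cons e s ih =>
    cases ts with
    | nil => simp [flagShift, shift]
    | cons t ts => simp [flagOf, flagShift, shift, ih]

lemma IsEvenSeq.isGen {E : Finset V} {L : Submodule ℝ V} {A : Set (Submodule ℝ V)} {s : List V}
    (hs : IsEvenSeq E L A s) (h : IsGen E L A) : IsGen E (flagSpace L s) (flagArr L A s) := by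
  induction s generalizing L A with
  | nil => exact h
  | cons e s ih => exact ih hs.2.2 (h.evenRestriction hs.2.1)

lemma IsEvenSeq.isMaxFlag {E : Finset V} {L : Submodule ℝ V} {A : Set (Submodule ℝ V)}
    {s : List V} (hs : IsEvenSeq E L A s) (hA : flagArr L A s = ∅) :
    IsMaxFlag A (flagOf L s) := by
  induction s generalizing L A with
  | nil => exact hA
  | cons e s ih => exact ⟨hs.2.1, ih hs.2.2 hA⟩

lemma exists_isEvenSeq_of_isMaxFlag {E : Finset V} {L : Submodule ℝ V}
    {A : Set (Submodule ℝ V)} (h : IsGen E L A) {ms : List (Submodule ℝ V)}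
    (hms : IsMaxFlag A ms) :
    ∃ s, IsEvenSeq E L A s ∧ flagArr L A s = ∅ ∧ flagOf L s = ms := by
  induction ms generalizing L A with
  | nil => exact ⟨[], trivial, hms, rfl⟩
  | cons M ms ih =>
    obtain ⟨s, hs1, hs2, hs3⟩ := ih (h.evenRestriction hms.1) hms.2
    obtain ⟨e, he, rfl, -⟩ := h M hms.1
    exact ⟨e :: s, ⟨he, hms.1, hs1⟩, hs2, by rw [flagOf, hs3]⟩

lemma flagSpace_append (L : Submodule ℝ V) (s t : List V) :
    flagSpace L (s ++ t) = flagSpace (flagSpace L s) t := by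
  induction s generalizing L with
  | nil => rfl
  | cons e s ih => exact ih _

lemma flagArr_append (L : Submodule ℝ V) (A : Set (Submodule ℝ V)) (s t : List V) :
    flagArr L A (s ++ t) = flagArr (flagSpace L s) (flagArr L A s) t := by
  induction s generalizing L A with
  | nil => rfl
  | cons e s ih => exact ih _ _

lemma isEvenSeq_append {E : Finset V} {L : Submodule ℝ V} {A : Set (Submodule ℝ V)}
    {s t : List V} : IsEvenSeq E L A (s ++ t) ↔
      IsEvenSeq E L A s ∧ IsEvenSeq E (flagSpace L s) (flagArr L A s) t := by
  induction s generalizing L A with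
  | nil => simp [IsEvenSeq, flagSpace, flagArr]
  | cons f s ih =>
    simp only [List.cons_append, IsEvenSeq, flagSpace, flagArr, ih]
    tauto

/-- Every member of an arrangement reached is cut out by some `e ∈ E`, so any hyperplane left over
would extend the sequence. -/
lemma mem_maxEvenSeqs_iff {E : Finset V} (hE : ∀ e ∈ E, ‖e‖ = 1) {s : List V} :
    s ∈ maxEvenSeqs E ↔ IsEvenSeq E ⊤ (arr E) s ∧ flagArr ⊤ (arr E) s = ∅ := by
  refine and_congr_right fun hs => ⟨fun h => ?_, fun h e _ hse => ?_⟩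
  · refine Set.eq_empty_of_forall_notMem fun M hM => ?_
    obtain ⟨e, he, rfl, -⟩ := hs.isGen (isGen_arr hE) M hM
    exact h e he (isEvenSeq_append.2 ⟨hs, he, hM, trivial⟩)
  · have := (isEvenSeq_append.1 hse).2.2.1
    rw [h] at this
    exact this

lemma image_flagOf_maxEvenSeqs {E : Finset V} (hE : ∀ e ∈ E, ‖e‖ = 1) :
    flagOf ⊤ '' maxEvenSeqs E = {ms | IsMaxFlag (arr E) ms} := by
  ext ms
  constructor
  · rintro ⟨s, hs, rfl⟩
    rw [mem_maxEvenSeqs_iff hE] at hs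
    exact hs.1.isMaxFlag hs.2
  · intro hms
    obtain ⟨s, h1, h2, rfl⟩ := exists_isEvenSeq_of_isMaxFlag (isGen_arr hE) hms
    exact ⟨s, (mem_maxEvenSeqs_iff hE).2 ⟨h1, h2⟩, rfl⟩

/-- The equivalence of sequences is equality of flags, so the classes embed in the set of flags and
the chosen representatives play no role. -/
lemma sumMod_eq_finsum (P : Set (List V)) (F : List V → ℝ) (G : List (Submodule ℝ V) → ℝ)
    (hFG : ∀ s ∈ P, F s = G (flagOf ⊤ s)) : sumMod P F = ∑ᶠ ms ∈ flagOf ⊤ '' P, G ms := by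
  let S : Setoid P := (flagSetoid V).comap fun s : P => (s : List V)
  let g : Quotient S → List (Submodule ℝ V) := fun c => flagOf ⊤ (c.out : P).1
  have hg : Function.Injective g := by
    intro c c' hcc
    rw [← Quotient.out_eq c, ← Quotient.out_eq c']
    exact Quotient.sound (flagSetoid_iff.2 hcc)
  have hrange : Set.range g = flagOf ⊤ '' P := by
    ext ms
    constructor
    · rintro ⟨c, rfl⟩
      exact ⟨_, (c.out : P).2, rfl⟩
    · rintro ⟨s, hs, rfl⟩
      refine ⟨Quotient.mk S ⟨s, hs⟩, ?_⟩
      have hrel : S (Quotient.mk S ⟨s, hs⟩).out ⟨s, hs⟩ := Quotient.mk_out _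
      exact flagSetoid_iff.1 hrel
  rw [← hrange, finsum_mem_range hg]
  exact finsum_congr fun c => hFG _ (c.out : P).2

/-! ### Signs of maximal even restriction sequences -/

variable [FiniteDimensional ℝ V]

/-- Passing from the signed normal to the normal on the side of `e` multiplies both the chamber sign
and the normal product by `κ`, and `κ² = 1`. The identity holds for every admissible chamber, so the
choice made in `seqSign` is immaterial. -/
lemma IsFlagChamber.sgn_mul_normalProd {E : Finset V} {a : V} {s : List V} :
    ∀ {L : Submodule ℝ V} {A : Set (Submodule ℝ V)} {T : Set V}, IsGen E L A →
      IsEvenSeq E L A s → flagArr L A s = ∅ → IsFlagChamber L A s T → ∀ x ∈ T,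
      sgn L A x * normalProd a L s = flagCoeff a L A (flagOf L s) := by
  induction s with
  | nil =>
    intro L A T _ _ hA _ x _
    change A = ∅ at hA
    subst hA
    simp [sgn_empty, normalProd, flagOf, flagCoeff]
  | cons e s ih =>
    rintro L A T h ⟨he, hM, hs⟩ hA ⟨hT, Z, U, hZ, hU, hUZ, hUT⟩ x hx
    obtain ⟨κ, hκ, hν, hside⟩ := exists_unitNormal_eq h hM
    obtain ⟨y, hy, rfl⟩ := (mem_chambers_iff (h.restriction hM)).1 hU
    have hyU := mem_cell_self hy
    obtain ⟨ε, h1, h2⟩ := ((hUT y hyU).and (hside y hy)).exists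
    have hsx : sgn L A x = κ * sgn (L ⊓ hyp e) (evenRestriction A (L ⊓ hyp e)) y := by
      rw [← h2.2]
      obtain ⟨z, hz, rfl⟩ := (mem_chambers_iff h).1 hT
      have hb := (mem_complementIn.1 (basePoint_mem h)).1
      exact (relSign_congr_of_mem_cell h hz hx hb).symm.trans
        (relSign_congr_of_mem_cell h hz h1 hb)
    have hrec := ih (h.evenRestriction hM) hs hA hZ y (hUZ hyU)
    rw [normalProd, flagOf, flagCoeff, ← hrec, hsx, hν, inner_smul_right,
      real_inner_comm (proj L a)]
    linear_combination (sgn (L ⊓ hyp e) (evenRestriction A (L ⊓ hyp e)) y *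
      ⟪proj L a, signedNormal L A (L ⊓ hyp e)⟫ * normalProd a (L ⊓ hyp e) s) * hκ

lemma IsFlagChamber.mem_chambers {E : Finset V} {L : Submodule ℝ V} {A : Set (Submodule ℝ V)}
    {s : List V} {T : Set V} (h : IsGen E L A) (hA : flagArr L A s = ∅)
    (hT : IsFlagChamber L A s T) : T ∈ chambers L A := by
  cases s with
  | nil =>
    change A = ∅ at hA
    change T = L at hT
    subst hA hT
    refine (mem_chambers_iff h).2 ⟨0, mem_complementIn.2 ⟨L.zero_mem, by simp⟩, ?_⟩
    ext x
    simp [cell, mem_complementIn]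
  | cons e s => exact hT.1

/-- A small push of `z` in a generic direction leaves all hyperplanes without crossing those of `B`.
It provides a chamber `U` of the restriction inside a given chamber of the even restriction. -/
lemma exists_mem_cell_inter_complementIn {E : Finset V} {M : Submodule ℝ V}
    {B C : Set (Submodule ℝ V)} (hC : IsGen E M C) (hBC : B ⊆ C) {z : V}
    (hz : z ∈ complementIn M B) : ∃ y ∈ complementIn M C, y ∈ cell M B z := by
  have hB := hC.mono hBC
  obtain ⟨r, hr⟩ := hC.exists_rep
  have hrB : ∀ N ∈ B, r N ∈ E ∧ N = M ⊓ hyp (r N) ∧ ¬ M ≤ hyp (r N) := fun N hN => hr N (hBC hN)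
  obtain ⟨v, hv⟩ := complementIn_nonempty hC
  have hzM := (mem_complementIn.1 hz).1
  have hvM := (mem_complementIn.1 hv).1
  have h1 : ∀ᶠ ε : ℝ in 𝓝[>] 0, ∀ N ∈ B, 0 < ⟪r N, z⟫ * ⟪r N, z + ε • v⟫ := by
    rw [hB.finite.eventually_all]
    exact fun N hN => eventually_inner_add_smul_ne_zero (inner_rep_ne_zero hrB hz hN)
  have h2 : ∀ᶠ ε : ℝ in 𝓝[>] 0, ∀ N ∈ C, ⟪r N, z + ε • v⟫ ≠ 0 := by
    rw [hC.finite.eventually_all]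
    intro N hN
    by_cases hzN : ⟪r N, z⟫ = 0
    · filter_upwards [self_mem_nhdsWithin] with ε hε
      rw [inner_add_right, hzN, zero_add, inner_smul_right]
      exact mul_ne_zero (ne_of_gt hε) (inner_rep_ne_zero hr hv hN)
    · filter_upwards [eventually_inner_add_smul_ne_zero (w := v) hzN] with ε hε
      exact right_ne_zero_of_mul hε.ne'
  obtain ⟨ε, h3, h4⟩ := (h1.and h2).exists
  have hmem : z + ε • v ∈ M := M.add_mem hzM (M.smul_mem _ hvM)
  refine ⟨z + ε • v, mem_complementIn.2 ⟨hmem, fun N hN hin => h4 N hN ?_⟩,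
    (mem_cell_iff hrB hz).2 ⟨hmem, h3⟩⟩
  rw [(hr N hN).2.1, mem_inf_hyp] at hin
  exact hin.2

lemma mul_pos_of_common_factor {a b c : ℝ} (h1 : 0 < a * b) (h2 : 0 < a * c) : 0 < c * b := by
  rcases pos_and_pos_or_neg_and_neg_of_mul_pos h1 with ⟨ha, hb⟩ | ⟨ha, hb⟩
  · exact mul_pos (pos_of_mul_pos_right h2 ha.le) hb
  · exact mul_pos_of_neg_of_neg (neg_of_mul_pos_right h2 ha.le) hb

lemma exists_isFlagChamber {E : Finset V} {s : List V} :
    ∀ {L : Submodule ℝ V} {A : Set (Submodule ℝ V)}, IsGen E L A →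
      IsEvenSeq E L A s → flagArr L A s = ∅ → ∃ T, IsFlagChamber L A s T := by
  induction s with
  | nil => exact fun {L} {A} _ _ _ => ⟨L, rfl⟩
  | cons e s ih =>
    rintro L A h ⟨he, hM, hs⟩ hA
    have hres := h.restriction hM
    have heven := h.evenRestriction hM
    obtain ⟨Z, hZ⟩ := ih heven hs hA
    obtain ⟨z, hz, rfl⟩ := (mem_chambers_iff heven).1 (hZ.mem_chambers heven hA)
    obtain ⟨y, hy, hyz⟩ := exists_mem_cell_inter_complementIn hres
      (evenRestriction_subset A (L ⊓ hyp e)) hz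
    obtain ⟨r, hr⟩ := h.exists_rep
    have hLe : ¬ L ≤ hyp e := fun hle => (h.lt hM).ne (inf_eq_left.2 hle)
    have hνL := unitNormal_mem L e
    have hrν : ⟪r (L ⊓ hyp e), unitNormal L e⟫ ≠ 0 := by
      refine inner_ne_zero_of_notMem hνL ?_
      rw [← (hr _ hM).2.1]
      exact unitNormal_notMem hLe
    have hsub : cell (L ⊓ hyp e) (restriction A (L ⊓ hyp e)) y ⊆
        cell (L ⊓ hyp e) (evenRestriction A (L ⊓ hyp e)) z := by
      rw [← cell_eq_of_mem heven hz hyz]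
      exact cell_subset_of_isPreconnected heven (convex_cell hres hy).isPreconnected
        (fun x hx => complementIn_anti (evenRestriction_subset A _) hx.1) (mem_cell_self hy)
    have hyside := eventually_sgn_add_smul h hM hr hy hνL hrν
    -- Near `x` on the positive side, the sign with respect to `M` is that of the normal and the
    -- other signs are those of `x`. The latter are constant on `U`, so all points of `U` lead to
    -- the same chamber.
    have hsigns : ∀ x ∈ complementIn (L ⊓ hyp e) (restriction A (L ⊓ hyp e)),
        ∀ᶠ ε : ℝ in 𝓝[>] 0, x + ε • unitNormal L e ∈ L ∧ ∀ M' ∈ A,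
          0 < (if M' = L ⊓ hyp e then ⟪r M', unitNormal L e⟫ else ⟪r M', x⟫) *
            ⟪r M', x + ε • unitNormal L e⟫ := by
      intro x hx
      have hxM := (mem_complementIn.1 hx).1
      have h1 : ∀ᶠ ε : ℝ in 𝓝[>] 0, ∀ M' ∈ A,
          0 < (if M' = L ⊓ hyp e then ⟪r M', unitNormal L e⟫ else ⟪r M', x⟫) *
            ⟪r M', x + ε • unitNormal L e⟫ := by
        rw [h.finite.eventually_all]
        intro M' hM'
        by_cases hne : M' = L ⊓ hyp e
        · subst hne
          filter_upwards [self_mem_nhdsWithin] with ε hε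
          have hx0 : ⟪r (L ⊓ hyp e), x⟫ = 0 := by
            have := hxM
            rw [(hr _ hM).2.1, mem_inf_hyp] at this
            exact this.2
          rw [if_pos rfl, inner_add_right, hx0, zero_add, inner_smul_right, mul_left_comm]
          exact mul_pos hε (mul_self_pos.2 hrν)
        · simp only [if_neg hne]
          exact eventually_inner_add_smul_ne_zero
            (inner_rep_ne_zero_of_restriction h hM hr hx hM' hne)
      filter_upwards [h1] with ε hε
      exact ⟨L.add_mem (h.le hM hxM) (L.smul_mem _ hνL), hε⟩
    obtain ⟨ε₀, h0, h0'⟩ := ((hsigns y hy).and hyside).exists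
    refine ⟨cell L A (y + ε₀ • unitNormal L e), (mem_chambers_iff h).2 ⟨_, h0'.1, rfl⟩, _,
      cell (L ⊓ hyp e) (restriction A (L ⊓ hyp e)) y, hZ,
      (mem_chambers_iff hres).2 ⟨y, hy, rfl⟩, hsub, fun x hx => ?_⟩
    filter_upwards [hsigns x hx.1] with ε hε
    rw [mem_cell_iff hr h0'.1]
    refine ⟨hε.1, fun M' hM' => ?_⟩
    have h1 := hε.2 M' hM'
    have h2 := h0.2 M' hM'
    by_cases hne : M' = L ⊓ hyp e
    · rw [if_pos hne] at h1 h2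
      exact mul_pos_of_common_factor h1 h2
    · rw [if_neg hne] at h1 h2
      have h3 : 0 < ⟪r M', y⟫ * ⟪r M', x⟫ := by
        have hN : (L ⊓ hyp e) ⊓ M' = (L ⊓ hyp e) ⊓ hyp (r M') := by
          conv_lhs => rw [(hr M' hM').2.1]
          rw [← inf_assoc, inf_eq_left.2 (h.le hM)]
        have h4 := hx.2 _ ⟨M', hM', hne, rfl⟩
        rw [hN, sOppSide_iff (mem_complementIn.1 hy).1 (mem_complementIn.1 hx.1).1, not_lt] at h4
        exact lt_of_le_of_ne h4 (mul_ne_zero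
          (inner_rep_ne_zero_of_restriction h hM hr hy hM' hne)
          (inner_rep_ne_zero_of_restriction h hM hr hx.1 hM' hne)).symm
      exact mul_pos_of_common_factor h1 (mul_pos_of_common_factor h2 h3)

lemma mem_complementIn_arr {E : Finset V} {p : V} (hp : p ∈ baseChamber E) :
    p ∈ complementIn ⊤ (arr E) := by
  refine mem_complementIn.2 ⟨trivial, ?_⟩
  rintro _ ⟨e, he, rfl⟩ hin
  exact (hp e he).ne' (mem_hyp.1 hin)

lemma baseChamber_eq_cell {E : Finset V} {p : V} (hp : p ∈ baseChamber E) :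
    baseChamber E = cell ⊤ (arr E) p := by
  have hiff : ∀ e x y, (hyp e : Submodule ℝ V).toAffineSubspace.SOppSide x y ↔
      ⟪e, x⟫ * ⟪e, y⟫ < 0 := fun e x y => by
    have := sOppSide_iff (L := ⊤) (e := e) (x := x) (y := y) trivial trivial
    rwa [top_inf_eq] at this
  ext x
  constructor
  · intro hx
    refine ⟨mem_complementIn_arr hx, ?_⟩
    rintro _ ⟨e, he, rfl⟩
    rw [hiff, not_lt]
    exact (mul_pos (hp e he) (hx e he)).le
  · rintro ⟨hx, h⟩ e he
    have h1 := h _ ⟨e, he, rfl⟩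
    rw [hiff, not_lt] at h1
    refine lt_of_le_of_ne (nonneg_of_mul_nonneg_right h1 (hp e he)) fun h0 => ?_
    exact (mem_complementIn.1 hx).2 _ ⟨e, he, rfl⟩ (mem_hyp.2 h0.symm)

/-- On the right, `s` enters only through its flag: this is the independence of the representative.
-/
lemma seqSign_mul_normalProd {E : Finset V} (hE : ∀ e ∈ E, ‖e‖ = 1) {p : V}
    (hp : p ∈ baseChamber E) {s : List V} (hs : s ∈ maxEvenSeqs E) (a : V) :
    seqSign E s * normalProd a ⊤ s =
      sgn ⊤ (arr E) p * flagCoeff a ⊤ (arr E) (flagOf ⊤ s) := by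
  rw [mem_maxEvenSeqs_iff hE] at hs
  have hgen := isGen_arr hE
  have hT := Classical.epsilon_spec (exists_isFlagChamber hgen hs.1 hs.2)
  have hpc := mem_complementIn_arr hp
  rw [seqSign]
  set T := Classical.epsilon fun T => IsFlagChamber ⊤ (arr E) s T
  obtain ⟨x, hx, hTx⟩ := (mem_chambers_iff hgen).1 (hT.mem_chambers hgen hs.2)
  have hxT : x ∈ T := hTx ▸ mem_cell_self hx
  rw [← hT.sgn_mul_normalProd hgen hs.1 hs.2 x hxT, hTx, baseChamber_eq_cell hp,
    chamberSign_cell hgen hpc hx, relSign_eq_sgn_mul hgen hpc hx, mul_assoc]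

/-! ### The expansion of the pizza quantity -/

variable [MeasurableSpace V] [BorelSpace V]

lemma volOn_top : volOn (⊤ : Submodule ℝ V) = volume :=
  (LinearIsometryEquiv.ofTop V (⊤ : Submodule ℝ V) rfl).measurePreserving.map_eq

lemma proj_top (a : V) : proj ⊤ a = a := proj_eq_self trivial

lemma SuffSymm.relSymm {E : Finset V} (hE : ∀ e ∈ E, ‖e‖ = 1) {K : Set V}
    (hK : SuffSymm E K) : RelSymm E ⊤ (arr E) K := by
  intro s hs hne a _ ha hm hf
  have hgen := hs.isGen (isGen_arr hE)
  have hb := basePoint_mem hgen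
  have h1 := hK s hs (fun hmax => hne ((mem_maxEvenSeqs_iff hE).1 hmax).2) a ha hm hf _
    ((mem_chambers_iff hgen).2 ⟨_, hb, rfl⟩)
  rw [pizza_eq_signedVol hgen hf hb] at h1
  refine (mul_eq_zero.1 h1).resolve_left fun h0 => ?_
  have := sgn_mul_self (flagSpace ⊤ s) (flagArr ⊤ (arr E) s) (basePoint (flagSpace ⊤ s)
    (flagArr ⊤ (arr E) s))
  rw [h0] at this
  norm_num at this

lemma summand_eq {E : Finset V} (hE : ∀ e ∈ E, ‖e‖ = 1) {p : V} (hp : p ∈ baseChamber E)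
    {s : List V} (hs : s ∈ maxEvenSeqs E) (K : Set V) (a : V) :
    summand E K a s = sgn ⊤ (arr E) p * (2 ^ (flagOf ⊤ s).length *
      flagCoeff a ⊤ (arr E) (flagOf ⊤ s) * flagIntegral a ⊤ (flagOf ⊤ s) 1 K) := by
  have hvol : ∀ X : Set V, (volOn (flagSpace ⊤ s)).real (flagSpace ⊤ s ∩ X) =
      (volOn (flagSpace ⊤ s)).real X := fun X => by
    refine measureReal_congr ?_
    filter_upwards [ae_mem_volOn (flagSpace ⊤ s)] with y hy
    exact propext (and_iff_right hy)
  rw [summand, mul_assoc (2 ^ _), seqSign_mul_normalProd hE hp hs, flagIntegral, length_flagOf,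
    flagEnd_flagOf]
  simp only [flagShift_flagOf, hvol]
  ring

theorem pizza_translateSet_eq_sumMod {E : Finset V} (hE : ∀ e ∈ E, ‖e‖ = 1) {p : V}
    (hp : p ∈ baseChamber E) {K : Set V} (hK : NullMeasurableSet K volume) (hKf : volume K ≠ ⊤)
    (hs : SuffSymm E K) (a : V) :
    pizza ⊤ (arr E) (baseChamber E) (translateSet K a) =
      sumMod (maxEvenSeqs E) (summand E K a) := by
  have hgen := isGen_arr hE
  rw [← volOn_top] at hK hKf
  have hKa : volOn ⊤ (translateSet K a) ≠ ⊤ := by rwa [volOn_translateSet hK trivial]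
  have h1 := signedVol_translateSet_eq_finsum a _ ⊤ (arr E) le_rfl hgen K hK hKf
    (hs.relSymm hE) 1 zero_le_one
  rw [proj_top, one_smul] at h1
  rw [baseChamber_eq_cell hp, pizza_eq_signedVol hgen hKa (mem_complementIn_arr hp), h1,
    sumMod_eq_finsum _ _ (fun ms => sgn ⊤ (arr E) p * (2 ^ ms.length *
      flagCoeff a ⊤ (arr E) ms * flagIntegral a ⊤ ms 1 K))
      (fun s hs => summand_eq hE hp hs K a), image_flagOf_maxEvenSeqs hE,
    finsum_mem_eq_finite_toFinset_sum _ (isMaxFlag_finite hgen),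
    finsum_mem_eq_finite_toFinset_sum _ (isMaxFlag_finite hgen), Finset.mul_sum]

end Pizza

end

noncomputable section

namespace Pizza

variable {V : Type*} [NormedAddCommGroup V] [InnerProductSpace ℝ V] [FiniteDimensional ℝ V]

/-! ### Even arrangements -/

lemma finrank_inf_hyp {L : Submodule ℝ V} {e : V} (h : ¬ L ≤ hyp e) :
    Module.finrank ℝ (L ⊓ hyp e : Submodule ℝ V) + 1 = Module.finrank ℝ L := by
  have hle : Submodule.span ℝ {proj L e} ≤ L := by
    rw [Submodule.span_singleton_le_iff_mem]; exact proj_mem L e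
  have h1 := Submodule.finrank_add_inf_finrank_orthogonal hle
  have h2 : (Submodule.span ℝ {proj L e})ᗮ ⊓ L = L ⊓ hyp e := by
    ext x
    rw [mem_inf_hyp, Submodule.mem_inf, Submodule.mem_orthogonal_singleton_iff_inner_right,
      and_comm]
    exact and_congr_right fun hx => by rw [inner_proj e hx]
  rw [h2, finrank_span_singleton (proj_ne_zero h)] at h1
  omega

lemma IsEvenSeq.finrank_add_length {E : Finset V} {L : Submodule ℝ V} {A : Set (Submodule ℝ V)}
    {s : List V} (hs : IsEvenSeq E L A s) (h : IsGen E L A) :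
    Module.finrank ℝ (flagSpace L s) + s.length = Module.finrank ℝ L := by
  induction s generalizing L A with
  | nil => rfl
  | cons e s ih =>
    have h1 := ih hs.2.2 (h.evenRestriction hs.2.1)
    have h2 := finrank_inf_hyp (L := L) (e := e) fun hle =>
      (h.lt hs.2.1).ne (inf_eq_left.2 hle)
    rw [flagSpace, List.length_cons]
    omega

lemma IsEvenArr.flagSpace_eq_bot {E : Finset V} (hev : IsEvenArr E) {s : List V}
    (hs : IsEvenSeq E ⊤ (arr E) s) (hA : flagArr ⊤ (arr E) s = ∅) : flagSpace ⊤ s = ⊥ := by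
  have := hev s hs
  rwa [hA, sInf_empty, inf_top_eq] at this

/-- Each step lowers the dimension by one. An empty arrangement is essential only in the zero space,
so maximal sequences have length `n`; conversely nothing can be cut after `n` steps. -/
lemma maxEvenSeqs_eq {E : Finset V} (hE : ∀ e ∈ E, ‖e‖ = 1) (hev : IsEvenArr E) :
    maxEvenSeqs E = evenSeqsOfLength E (Module.finrank ℝ V) := by
  ext s
  rw [mem_maxEvenSeqs_iff hE]
  refine and_congr_right fun hs => ?_
  have hgen := isGen_arr hE
  have hdim := IsEvenSeq.finrank_add_length hs hgen
  rw [finrank_top] at hdim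
  constructor
  · intro hA
    rw [hev.flagSpace_eq_bot hs hA, finrank_bot] at hdim
    omega
  · intro hl
    refine Set.eq_empty_of_forall_notMem fun M hM => ?_
    have := finrank_lt_of_mem (hs.isGen hgen) hM
    omega

/-! ### Integrals over ordered simplices and homogeneity -/

lemma iterIntegral_one (r : ℕ) (τ : ℝ) :
    iterIntegral r τ (fun _ => 1) = τ ^ r / (r.factorial : ℝ) := by
  induction r generalizing τ with
  | zero => simp [iterIntegral]
  | succ r ih =>
    simp only [iterIntegral, ih]
    rw [intervalIntegral.integral_div, integral_pow, Nat.factorial_succ]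
    push_cast
    rw [zero_pow (Nat.succ_ne_zero r), sub_zero]
    field_simp

lemma iterIntegral_congr (r : ℕ) {τ : ℝ} (hτ : 0 ≤ τ) {g g' : List ℝ → ℝ}
    (h : ∀ ts : List ℝ, ts.length = r → ts.Pairwise (· ≥ ·) → (∀ x ∈ ts, 0 ≤ x ∧ x ≤ τ) →
      g ts = g' ts) : iterIntegral r τ g = iterIntegral r τ g' := by
  induction r generalizing τ g g' with
  | zero => exact h [] rfl List.Pairwise.nil (by simp)
  | succ r ih =>
    simp only [iterIntegral]
    refine intervalIntegral.integral_congr fun t ht => ?_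
    rw [uIcc_of_le hτ] at ht
    refine ih ht.1 fun ts hl hp hts => h (t :: ts) (by simp [hl]) ?_ ?_
    · exact List.pairwise_cons.2 ⟨fun x hx => (hts x hx).2, hp⟩
    · intro x hx
      rcases List.mem_cons.1 hx with rfl | hx
      · exact ht
      · exact ⟨(hts x hx).1, (hts x hx).2.trans ht.2⟩

/-- The functions given by homogeneous polynomials of degree `k` in the coordinates. -/
def IsHomogPoly {n : ℕ} (b : Module.Basis (Fin n) ℝ V) (k : ℕ) (f : V → ℝ) : Prop :=
  ∃ p : MvPolynomial (Fin n) ℝ, p.IsHomogeneous k ∧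
    ∀ a, f a = MvPolynomial.eval (fun i => b.repr a i) p

lemma isHomogPoly_linear {n : ℕ} (b : Module.Basis (Fin n) ℝ V) (f : V →ₗ[ℝ] ℝ) :
    IsHomogPoly b 1 f := by
  refine ⟨∑ i, MvPolynomial.C (f (b i)) * MvPolynomial.X i, ?_, fun a => ?_⟩
  · refine MvPolynomial.IsHomogeneous.sum _ _ _ fun i _ => ?_
    have := (MvPolynomial.isHomogeneous_C (Fin n) (f (b i))).mul
      (MvPolynomial.isHomogeneous_X ℝ i)
    rwa [zero_add] at this
  · conv_lhs => rw [← b.sum_repr a, map_sum]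
    rw [map_sum]
    refine Finset.sum_congr rfl fun i _ => ?_
    rw [map_smul, smul_eq_mul, map_mul, MvPolynomial.eval_C, MvPolynomial.eval_X, mul_comm]

lemma IsHomogPoly.mul {n : ℕ} {b : Module.Basis (Fin n) ℝ V} {k l : ℕ} {f g : V → ℝ}
    (hf : IsHomogPoly b k f) (hg : IsHomogPoly b l g) :
    IsHomogPoly b (k + l) fun a => f a * g a := by
  obtain ⟨p, hp, hfp⟩ := hf
  obtain ⟨q, hq, hgq⟩ := hg
  exact ⟨p * q, hp.mul hq, fun a => by simp only [map_mul, hfp, hgq]⟩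

lemma isHomogPoly_const {n : ℕ} (b : Module.Basis (Fin n) ℝ V) (c : ℝ) :
    IsHomogPoly b 0 fun _ => c :=
  ⟨MvPolynomial.C c, MvPolynomial.isHomogeneous_C _ _, fun a => by simp⟩

lemma isHomogPoly_sum {n : ℕ} {b : Module.Basis (Fin n) ℝ V} {k : ℕ} {ι : Type*} (F : Finset ι)
    (f : ι → V → ℝ) (hf : ∀ i ∈ F, IsHomogPoly b k (f i)) :
    IsHomogPoly b k fun a => ∑ i ∈ F, f i a := by
  choose! p hp hfp using hf
  refine ⟨∑ i ∈ F, p i, MvPolynomial.IsHomogeneous.sum _ _ _ hp, fun a => ?_⟩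
  rw [map_sum]
  exact Finset.sum_congr rfl fun i hi => hfp i hi a

lemma isHomogPoly_flagCoeff {n : ℕ} (b : Module.Basis (Fin n) ℝ V) (ms : List (Submodule ℝ V)) :
    ∀ (L : Submodule ℝ V) (A : Set (Submodule ℝ V)),
      IsHomogPoly b ms.length fun a => flagCoeff a L A ms := by
  induction ms with
  | nil => exact fun L A => isHomogPoly_const b 1
  | cons M ms ih =>
    intro L A
    rw [List.length_cons, add_comm]
    have h1 := isHomogPoly_linear b
      ((innerₛₗ ℝ (signedNormal L A M)).comp L.starProjection.toLinearMap)
    exact h1.mul (ih M (evenRestriction A M))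

lemma continuous_flagCoeff (ms : List (Submodule ℝ V)) :
    ∀ (L : Submodule ℝ V) (A : Set (Submodule ℝ V)), Continuous fun a => flagCoeff a L A ms := by
  induction ms with
  | nil => exact fun L A => continuous_const
  | cons M ms ih =>
    intro L A
    exact (continuous_const.inner L.starProjection.continuous).mul (ih M (evenRestriction A M))

lemma pizzaPoly_eq {E : Finset V} (hE : ∀ e ∈ E, ‖e‖ = 1) (hev : IsEvenArr E) {p : V}
    (hp : p ∈ baseChamber E) (a : V) :
    pizzaPoly E a = 2 ^ Module.finrank ℝ V / (Module.finrank ℝ V).factorial *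
      ∑ ms ∈ (isMaxFlag_finite (isGen_arr hE)).toFinset,
        sgn ⊤ (arr E) p * flagCoeff a ⊤ (arr E) ms := by
  rw [pizzaPoly, ← maxEvenSeqs_eq hE hev, sumMod_eq_finsum _ _
    (fun ms => sgn ⊤ (arr E) p * flagCoeff a ⊤ (arr E) ms)
    (fun s hs => seqSign_mul_normalProd hE hp hs a), image_flagOf_maxEvenSeqs hE,
    finsum_mem_eq_finite_toFinset_sum]

lemma isHomogPoly_pizzaPoly {E : Finset V} (hE : ∀ e ∈ E, ‖e‖ = 1) (hev : IsEvenArr E) {p : V}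
    (hp : p ∈ baseChamber E) {n : ℕ} (b : Module.Basis (Fin n) ℝ V) :
    IsHomogPoly b (Module.finrank ℝ V) (pizzaPoly E) := by
  rw [funext (pizzaPoly_eq hE hev hp)]
  rw [← zero_add (Module.finrank ℝ V)]
  refine (isHomogPoly_const b _).mul (isHomogPoly_sum _ _ fun ms hms => ?_)
  rw [← zero_add (Module.finrank ℝ V)]
  refine (isHomogPoly_const b _).mul ?_
  rw [Set.Finite.mem_toFinset, ← image_flagOf_maxEvenSeqs hE, maxEvenSeqs_eq hE hev] at hms
  obtain ⟨s, hs, rfl⟩ := hms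
  rw [← hs.2, ← length_flagOf ⊤ s]
  exact isHomogPoly_flagCoeff b _ _ _

lemma continuous_pizzaPoly {E : Finset V} (hE : ∀ e ∈ E, ‖e‖ = 1) (hev : IsEvenArr E) {p : V}
    (hp : p ∈ baseChamber E) : Continuous (pizzaPoly E) := by
  rw [funext (pizzaPoly_eq hE hev hp)]
  exact continuous_const.mul (continuous_finsetSum _ fun ms _ =>
    continuous_const.mul (continuous_flagCoeff ms _ _))

/-! ### The polynomial formula under the containment condition -/

variable [MeasurableSpace V] [BorelSpace V]

lemma volOn_bot_real {X : Set V} (hX : (0 : V) ∈ X) :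
    (volOn (⊥ : Submodule ℝ V)).real X = 1 := by
  have h1 : (volume : Measure (⊥ : Submodule ℝ V)) univ = 1 := by
    have h2 := (stdOrthonormalBasis ℝ (⊥ : Submodule ℝ V)).volume_parallelepiped
    have hne : (parallelepiped (stdOrthonormalBasis ℝ (⊥ : Submodule ℝ V))).Nonempty := by
      rw [Set.nonempty_iff_ne_empty]
      intro h0
      rw [h0, measure_empty] at h2
      exact zero_ne_one h2
    rw [← hne.eq_univ, h2]
  have h3 : volOn (⊥ : Submodule ℝ V) {0} = 1 := by
    rw [volOn, Measure.map_apply measurable_subtype_coe (measurableSet_singleton 0), lebesgue, ← h1]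
    congr 1
    ext x
    simp
  have h4 : volOn (⊥ : Submodule ℝ V) X = volOn (⊥ : Submodule ℝ V) {0} := by
    refine measure_congr ?_
    filter_upwards [ae_mem_volOn (⊥ : Submodule ℝ V)] with y hy
    rw [Submodule.mem_bot] at hy
    subst hy
    exact propext ⟨fun _ => rfl, fun _ => hX⟩
  rw [Measure.real, h4, h3, ENNReal.toReal_one]

lemma sumMod_congr {P : Set (List V)} {F G : List V → ℝ} (h : ∀ s ∈ P, F s = G s) :
    sumMod P F = sumMod P G :=
  finsum_congr fun c => h _ (c.out : P).2

theorem pizza_translateSet_eq_pizzaPoly {E : Finset V} (hE : ∀ e ∈ E, ‖e‖ = 1)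
    (hev : IsEvenArr E) {p : V} (hp : p ∈ baseChamber E) {K : Set V}
    (hK : NullMeasurableSet K volume) (hKf : volume K ≠ ⊤) (hs : SuffSymm E K) {a : V}
    (hc : Contains E K a) :
    pizza ⊤ (arr E) (baseChamber E) (translateSet K a) = pizzaPoly E a := by
  rw [pizza_translateSet_eq_sumMod hE hp hK hKf hs, pizzaPoly, ← maxEvenSeqs_eq hE hev]
  have h1 : ∀ s ∈ maxEvenSeqs E, summand E K a s =
      (2 ^ Module.finrank ℝ V / (Module.finrank ℝ V).factorial : ℝ) •
        (seqSign E s * normalProd a ⊤ s) := by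
    intro s hsm
    have hlen : s.length = Module.finrank ℝ V := by
      rw [maxEvenSeqs_eq hE hev] at hsm; exact hsm.2
    have hs2 := (mem_maxEvenSeqs_iff hE).1 hsm
    have h2 : iterIntegral s.length 1 (fun t => (volOn (flagSpace ⊤ s)).real
        (flagSpace ⊤ s ∩ translateSet K (shift a ⊤ s t))) = 1 / (s.length.factorial : ℝ) := by
      rw [iterIntegral_congr s.length zero_le_one (g' := fun _ => 1), iterIntegral_one, one_pow]
      intro ts hl hp hts
      rw [hev.flagSpace_eq_bot hs2.1 hs2.2]
      refine volOn_bot_real ⟨Submodule.zero_mem _, mem_translateSet.2 ?_⟩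
      rw [zero_sub]
      exact hc s (by rwa [← maxEvenSeqs_eq hE hev]) ts hl hp hts
    rw [summand, h2, hlen, smul_eq_mul]
    ring
  rw [sumMod_congr h1, ← smul_eq_mul, sumMod, sumMod, smul_finsum]

end Pizza

end

noncomputable section

namespace Pizza

/-! ### Sign-balanced intervals of the line -/

/-- The two halves of `I` have equal length. The positive one is not null, so the negative one is
nonempty and `I` contains `(0, c]`. If `I` stayed away from `-c`, its negative half would be shorter
than `c`. -/
lemma neg_mem_closure_of_integral_sign_eq_zero {I : Set ℝ} (hI : Convex ℝ I) (hIf : volume I ≠ ⊤)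
    (h0 : ∫ t in I, Real.sign t = 0) {c : ℝ} (hc : 0 < c) (hcI : I ∈ 𝓝 c) : -c ∈ closure I := by
  have hIm : MeasurableSet I := hI.ordConnected.measurableSet
  have hfin : ∀ S : Set ℝ, volume (I ∩ S) ≠ ⊤ := fun S =>
    measure_ne_top_of_subset inter_subset_left hIf
  have heq : volume.real (I ∩ Ioi 0) = volume.real (I ∩ Iio 0) := by
    have hs : ∀ t : ℝ, Real.sign t =
        (Ioi (0 : ℝ)).indicator (fun _ => (1 : ℝ)) t - (Iio (0 : ℝ)).indicator (fun _ => (1 : ℝ)) t := by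
      intro t
      rcases lt_trichotomy t 0 with h | rfl | h
      · rw [Real.sign_of_neg h, indicator_of_notMem (show t ∉ Ioi (0 : ℝ) from fun h' => lt_asymm h h'),
          indicator_of_mem (show t ∈ Iio (0 : ℝ) from h)]; ring
      · simp
      · rw [Real.sign_of_pos h, indicator_of_notMem (show t ∉ Iio (0 : ℝ) from fun h' => lt_asymm h h'),
          indicator_of_mem (show t ∈ Ioi (0 : ℝ) from h)]; ring
    have hi : ∀ S : Set ℝ, MeasurableSet S →
        IntegrableOn (S.indicator fun _ => (1 : ℝ)) I volume := fun S hS =>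
      Integrable.indicator (integrableOn_const hIf) hS
    simp only [hs] at h0
    rw [integral_sub (hi _ measurableSet_Ioi) (hi _ measurableSet_Iio),
      setIntegral_indicator measurableSet_Ioi, setIntegral_indicator measurableSet_Iio] at h0
    simp only [integral_const, smul_eq_mul, mul_one, measureReal_restrict_apply_univ] at h0
    linarith
  by_contra hcl
  have hpos : 0 < volume.real (I ∩ Ioi 0) :=
    ENNReal.toReal_pos (Measure.measure_pos_of_mem_nhds volume (inter_mem hcI (Ioi_mem_nhds hc))).ne'
      (hfin _)
  have hne : (I ∩ Iio 0).Nonempty := by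
    rw [Set.nonempty_iff_ne_empty]
    intro h
    rw [heq, h, measureReal_empty] at hpos
    exact lt_irrefl _ hpos
  obtain ⟨τ, hτI, hτ0⟩ := hne
  have hτ0' : τ < 0 := hτ0
  have hcmem : c ∈ I := mem_of_mem_nhds hcI
  have hge : c ≤ volume.real (I ∩ Ioi 0) := by
    have : volume.real (Ioc 0 c) ≤ volume.real (I ∩ Ioi 0) := by
      refine measureReal_mono (fun t ht => ⟨hI.ordConnected.out hτI hcmem ?_, ht.1⟩) (hfin _)
      exact ⟨(hτ0'.trans ht.1).le, ht.2⟩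
    rwa [Real.volume_real_Ioc_of_le hc.le, sub_zero] at this
  obtain ⟨δ, hδ, hball⟩ := Metric.mem_nhds_iff.1 (isClosed_closure.isOpen_compl.mem_nhds hcl)
  -- A point of `I` left of `-c` would force `-c ∈ I` by order connectedness. The minimum with `0`
  -- covers the case `δ > c`.
  have hsub : I ∩ Iio 0 ⊆ Ico (min (-c + δ) 0) 0 := by
    rintro t ⟨htI, ht0⟩
    refine ⟨?_, ht0⟩
    by_contra hlt
    rw [not_le, lt_min_iff] at hlt
    by_cases htc : -c ≤ t
    · refine hball (a := t) ?_ (subset_closure htI)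
      rw [Metric.mem_ball, Real.dist_eq, abs_lt]
      constructor <;> linarith [hlt.1]
    · push Not at htc
      exact hcl (subset_closure (hI.ordConnected.out htI hcmem ⟨htc.le, by linarith⟩))
  have hle : volume.real (I ∩ Iio 0) ≤ 0 - min (-c + δ) 0 := by
    rw [← Real.volume_real_Ico_of_le (min_le_right (-c + δ) 0)]
    exact measureReal_mono hsub (by simp)
  rw [heq] at hge
  rcases min_choice (-c + δ) 0 with h | h <;> rw [h] at hle <;> linarith

variable {V : Type*} [NormedAddCommGroup V] [InnerProductSpace ℝ V] [FiniteDimensional ℝ V]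

/-! ### Convex sets invariant under reflections -/

/-- The reflection in the hyperplane orthogonal to the unit vector `u`. -/
def reflect (u x : V) : V := x - (2 * ⟪u, x⟫) • u

lemma reflect_reflect {u : V} (hu : ‖u‖ = 1) (x : V) : reflect u (reflect u x) = x := by
  simp only [reflect, inner_sub_right, inner_smul_right, real_inner_self_eq_norm_sq, hu]
  module

lemma norm_reflect_sub {u : V} (hu : ‖u‖ = 1) (x y : V) :
    ‖reflect u x - reflect u y‖ = ‖x - y‖ := by
  have h1 : reflect u x - reflect u y = (x - y) - (2 * ⟪u, x - y⟫) • u := by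
    simp only [reflect, inner_sub_right]
    module
  have h2 : ‖reflect u x - reflect u y‖ ^ 2 = ‖x - y‖ ^ 2 := by
    rw [h1, norm_sub_sq_real, inner_smul_right, norm_smul, hu, real_inner_comm u, mul_one,
      Real.norm_eq_abs, sq_abs]
    ring
  exact (sq_eq_sq₀ (norm_nonneg _) (norm_nonneg _)).1 h2

lemma continuous_reflect (u : V) : Continuous (reflect u) := by
  unfold reflect; fun_prop

/-- A closed convex set invariant under reflections whose normals have the same orthogonal
complement as `W` is stable under projection to the orthogonal complement of `W`. -/
lemma sub_proj_mem_of_reflect {C : Set V} (hC : IsClosed C) (hCc : Convex ℝ C)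
    {W : Submodule ℝ V} {U : Set V} (hUW : ∀ u ∈ U, u ∈ W)
    (hU : ∀ x, (∀ u ∈ U, ⟪u, x⟫ = 0) → ∀ y ∈ W, ⟪y, x⟫ = 0)
    (hrefl : ∀ u ∈ U, ∀ x ∈ C, reflect u x ∈ C) {x : V} (hx : x ∈ C) :
    x - proj W x ∈ C := by
  set C' : Set V := C ∩ {z | z - x ∈ W} with hC'
  have hWc : IsClosed {z : V | z - x ∈ W} :=
    W.closed_of_finiteDimensional.preimage (by fun_prop : Continuous fun z : V => z - x)
  have hconv : Convex ℝ C' := by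
    refine hCc.inter fun z hz z' hz' a b _ _ hab => ?_
    have : a • z + b • z' - x = a • (z - x) + b • (z' - x) := by
      have h1 : x = (a + b) • x := by rw [hab, one_smul]
      conv_lhs => rw [h1]
      module
    rw [mem_ofPred_eq, this]
    exact W.add_mem (W.smul_mem _ hz) (W.smul_mem _ hz')
  have hxC' : x ∈ C' := ⟨hx, by simp⟩
  set p := x - proj W x with hp
  have hpW : ∀ y ∈ W, ⟪p, y⟫ = 0 := fun y hy => by
    rw [hp, inner_sub_left, inner_proj x hy, sub_self]
  -- Let `v` be the point of `C'` nearest to `p`. Testing minimality against the reflection of `v`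
  -- along `u` gives `2 ⟪u, v⟫² ≤ 0`, so `v` is orthogonal to `W`; as `v - p` lies in `W`, it
  -- follows that `v = p`.
  obtain ⟨v, hv, hmin⟩ := exists_norm_eq_iInf_of_complete_convex ⟨x, hxC'⟩
    (hC.inter hWc).isComplete hconv p
  rw [norm_eq_iInf_iff_real_inner_le_zero hconv hv] at hmin
  have hvU : ∀ u ∈ U, ⟪u, v⟫ = 0 := by
    intro u hu
    have huW := hUW u hu
    have hmem : reflect u v ∈ C' := by
      refine ⟨hrefl u hu v hv.1, ?_⟩
      rw [mem_ofPred_eq, reflect, sub_right_comm]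
      exact W.sub_mem hv.2 (W.smul_mem _ huW)
    have h1 := hmin _ hmem
    rw [reflect, sub_sub_cancel_left, inner_neg_right, inner_smul_right, inner_sub_left,
      hpW u huW, real_inner_comm] at h1
    have h2 : ⟪v, u⟫ * ⟪v, u⟫ ≤ 0 := by linarith
    rw [real_inner_comm]
    exact mul_self_eq_zero.1 (le_antisymm h2 (mul_self_nonneg _))
  have hvW := hU v hvU
  have hvp : v - p ∈ W := by
    have : v - p = (v - x) + proj W x := by rw [hp]; abel
    rw [this]
    exact W.add_mem hv.2 (proj_mem W x)
  have h0 : ⟪v - p, v - p⟫ = 0 := by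
    rw [inner_sub_right, hvW _ hvp, real_inner_comm, hpW _ hvp, sub_zero]
  have : v = p := sub_eq_zero.1 (inner_self_eq_zero.1 h0)
  exact this ▸ hv.1

/-- In an even arrangement, the lines reached by even restriction sequences span the space. -/
lemma inner_eq_zero_of_lines {E : Finset V} (n : ℕ) :
    ∀ (L : Submodule ℝ V) (A : Set (Submodule ℝ V)), Module.finrank ℝ L ≤ n → IsGen E L A →
      (∀ s, IsEvenSeq E L A s → flagSpace L s ⊓ sInf (flagArr L A s) = ⊥) → ∀ x : V,
      (∀ s, IsEvenSeq E L A s → Module.finrank ℝ (flagSpace L s) = 1 →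
        ∀ u ∈ flagSpace L s, ⟪u, x⟫ = 0) → ∀ y ∈ L, ⟪y, x⟫ = 0 := by
  induction n with
  | zero =>
    intro L A hL _ _ x _ y hy
    have : L = ⊥ := Submodule.finrank_eq_zero.1 (Nat.le_zero.1 hL)
    rw [this, Submodule.mem_bot] at hy
    rw [hy, inner_zero_left]
  | succ n ih =>
    intro L A hL h hev x hx y hy
    by_cases h1 : Module.finrank ℝ L = 1
    · exact hx [] trivial h1 y hy
    by_cases hbot : L = ⊥
    · rw [hbot, Submodule.mem_bot] at hy
      rw [hy, inner_zero_left]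
    have hess : L ⊓ sInf A = ⊥ := hev [] trivial
    have hstep : ∀ M ∈ A, ∀ z ∈ M, ⟪z, x⟫ = 0 := by
      intro M hM
      obtain ⟨e, he, hMe, -⟩ := h M hM
      subst hMe
      have hlt := finrank_lt_of_mem h hM
      exact ih _ _ (by omega) (h.evenRestriction hM) (fun s hs => hev (e :: s) ⟨he, hM, hs⟩) x
        fun s hs => hx (e :: s) ⟨he, hM, hs⟩
    have hA : A.Nonempty := by
      rw [Set.nonempty_iff_ne_empty]
      rintro rfl
      rw [sInf_empty, inf_top_eq] at hess
      exact hbot hess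
    obtain ⟨M₁, hM₁⟩ := hA
    have hfr : ∀ M ∈ A, Module.finrank ℝ M + 1 = Module.finrank ℝ L := by
      intro M hM
      obtain ⟨e, _, rfl, hLe⟩ := h M hM
      exact finrank_inf_hyp hLe
    have hM₁bot : M₁ ≠ ⊥ := by
      rintro rfl
      have := hfr _ hM₁
      rw [finrank_bot] at this
      omega
    -- In dimension at least two a single hyperplane is not essential, so there are two distinct
    -- ones, and together they span `L`.
    have hex : ∃ M₂ ∈ A, M₂ ≠ M₁ := by
      by_contra hcon
      push Not at hcon
      have : A = {M₁} := Set.eq_singleton_iff_unique_mem.2 ⟨hM₁, hcon⟩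
      rw [this, sInf_singleton, inf_eq_right.2 (h.le hM₁)] at hess
      exact hM₁bot hess
    obtain ⟨M₂, hM₂, hne⟩ := hex
    have hsup : M₁ ⊔ M₂ = L := by
      refine Submodule.eq_of_le_of_finrank_le (sup_le (h.le hM₁) (h.le hM₂)) ?_
      have hlt : M₁ < M₁ ⊔ M₂ :=
        lt_of_le_of_ne le_sup_left fun heq => hne (h.eq_of_le hM₂ hM₁ (sup_eq_left.1 heq.symm))
      have := Submodule.finrank_lt_finrank_of_lt hlt
      have := hfr _ hM₁
      omega
    rw [← hsup] at hy
    obtain ⟨y₁, hy₁, y₂, hy₂, rfl⟩ := Submodule.mem_sup.1 hy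
    rw [inner_add_left, hstep _ hM₁ _ hy₁, hstep _ hM₂ _ hy₂, add_zero]

/-- The simplices spanned by the partial projections of `a` lie in every convex set containing
their vertices. -/
lemma exists_neg_shift_eq_smul (a : V) (s : List V) :
    ∀ (L : Submodule ℝ V) (S : Set V), Convex ℝ S →
      (∀ i, -(proj L a - proj (flagSpace L (s.take i)) a) ∈ S) →
      ∀ (τ : ℝ) (ts : List ℝ), 0 ≤ τ → ts.Pairwise (· ≥ ·) → (∀ x ∈ ts, 0 ≤ x ∧ x ≤ τ) →
      ∃ y ∈ S, -shift a L s ts = τ • y := by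
  have hbase : ∀ (L : Submodule ℝ V) (s : List V) (S : Set V),
      (∀ i, -(proj L a - proj (flagSpace L (s.take i)) a) ∈ S) → (0 : V) ∈ S := by
    intro L s S h
    simpa [flagSpace] using h 0
  induction s with
  | nil =>
    intro L S _ h τ ts _ _ _
    exact ⟨0, hbase L [] S h, by simp [shift]⟩
  | cons e s ih =>
    intro L S hS h τ ts hτ hp hts
    have h0 := hbase L (e :: s) S h
    cases ts with
    | nil => exact ⟨0, h0, by simp [shift]⟩
    | cons t ts =>
      obtain ⟨ht0, htτ⟩ := hts t (by simp)
      rw [List.pairwise_cons] at hp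
      set d := proj L a - proj (L ⊓ hyp e) a with hd
      obtain ⟨y, hy, hyt⟩ := ih (L ⊓ hyp e) ((fun z => -d + z) ⁻¹' S)
        (hS.translate_preimage_right _) (fun i => by
          have h1 := h (i + 1)
          rw [mem_preimage]
          convert h1 using 1
          rw [hd, List.take_succ_cons, flagSpace]
          abel) t ts ht0 hp.2 fun x hx => ⟨(hts x (by simp [hx])).1, hp.1 x hx⟩
      have hS0 : ∀ c : ℝ, 0 ≤ c → c ≤ 1 → c • (-d + y) ∈ S := fun c hc0 hc1 => by
        have := hS (show -d + y ∈ S from hy) h0 hc0 (sub_nonneg.2 hc1) (by ring)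
        simpa using this
      -- Scaling out `t` leaves a point of the simplex for the remaining flag, seen from the vertex
      -- `-d`. Convexity and `0 ∈ S` then allow the contraction by `t / τ ≤ 1`.
      have hsh : -shift a L (e :: s) (t :: ts) = t • (-d + y) := by
        rw [shift, neg_add, hyt, ← hd]
        module
      rcases hτ.eq_or_lt with rfl | hτ0
      · have : t = 0 := le_antisymm htτ ht0
        exact ⟨0, h0, by rw [hsh, this]; simp⟩
      · refine ⟨(t / τ) • (-d + y), hS0 _ (by positivity) (by rwa [div_le_one hτ0]), ?_⟩
        rw [hsh, smul_smul, mul_div_cancel₀ _ hτ0.ne']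

variable [MeasurableSpace V] [BorelSpace V]

/-- An unbounded convex set that contains a ball of radius `r` contains, on the way to a far point
`y`, any number of disjoint balls of radius `r / 2`, contrary to finite volume. -/
lemma isBounded_of_convex_of_volume_ne_top {K : Set V} (hK : Convex ℝ K)
    (hi : (interior K).Nonempty) (hf : volume K ≠ ⊤) : Bornology.IsBounded K := by
  obtain ⟨x, hx⟩ := hi
  obtain ⟨r, hr, hball⟩ := Metric.mem_nhds_iff.1 (mem_interior_iff_mem_nhds.1 hx)
  by_contra hunb
  have hpack : ∀ N : ℕ, N * volume (Metric.ball (0 : V) (r / 2)) ≤ volume K := by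
    intro N
    have hfar : ∃ y ∈ K, 2 * N * r < dist y x := by
      by_contra hcon
      push Not at hcon
      exact hunb ((Metric.isBounded_iff_subset_closedBall x).2 ⟨_, hcon⟩)
    obtain ⟨y, hy, hD⟩ := hfar
    set D := dist y x with hDdef
    have hD0 : 0 < D := lt_of_le_of_lt (by positivity) hD
    have hnorm : ‖y - x‖ = D := by rw [hDdef, dist_eq_norm]
    let z : ℕ → V := fun k => x + (k * r / D) • (y - x)
    -- The centres stay in the first half of the segment to `y`, so the homothety of centre `y` and
    -- ratio `1 - θ ≥ 1/2` maps the ball of radius `r` onto one of radius at least `r / 2`.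
    have hsub : ∀ k ∈ Finset.range N, Metric.ball (z k) (r / 2) ⊆ K := by
      intro k hk w hw
      have hkN : (k : ℝ) ≤ N := by exact_mod_cast (Finset.mem_range.1 hk).le
      set θ : ℝ := k * r / D with hθ
      have hθ0 : 0 ≤ θ := by positivity
      have hθ1 : θ ≤ 1 / 2 := by
        rw [hθ, div_le_iff₀ hD0]
        have := mul_le_mul_of_nonneg_right hkN hr.le
        linarith
      have h1θ : 0 < 1 - θ := by linarith
      have hx' : x + (1 - θ)⁻¹ • (w - z k) ∈ K := by
        refine hball ?_
        rw [Metric.mem_ball, dist_eq_norm, add_sub_cancel_left, norm_smul, Real.norm_eq_abs,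
          abs_of_pos (inv_pos.2 h1θ)]
        rw [Metric.mem_ball, dist_eq_norm] at hw
        have h2 : (1 - θ)⁻¹ ≤ 2 := by
          rw [inv_le_comm₀ h1θ two_pos]; linarith
        calc (1 - θ)⁻¹ * ‖w - z k‖ ≤ 2 * ‖w - z k‖ :=
              mul_le_mul_of_nonneg_right h2 (norm_nonneg _)
          _ < r := by linarith
      have hcomb := hK hx' hy h1θ.le hθ0 (by ring)
      convert hcomb using 1
      rw [smul_add, smul_smul, mul_inv_cancel₀ h1θ.ne', one_smul]
      simp only [z, ← hθ]
      module
    have hdisj : Set.PairwiseDisjoint (Finset.range N : Set ℕ)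
        fun k => Metric.ball (z k) (r / 2) := by
      intro j _ k _ hjk
      refine Metric.ball_disjoint_ball ?_
      have h1 : z j - z k = (((j : ℝ) - k) * r / D) • (y - x) := by
        simp only [z]
        rw [sub_mul, sub_div]
        module
      have h2 : (1 : ℝ) ≤ |(j : ℝ) - k| := by
        have : (1 : ℤ) ≤ |(j : ℤ) - k| := Int.one_le_abs (sub_ne_zero.2 (by exact_mod_cast hjk))
        exact_mod_cast this
      rw [add_halves, dist_eq_norm, h1, norm_smul, hnorm, Real.norm_eq_abs, abs_div, abs_mul,
        abs_of_pos hr, abs_of_pos hD0, div_mul_cancel₀ _ hD0.ne']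
      exact le_mul_of_one_le_left hr.le h2
    have hmeas := measure_biUnion_finset (μ := (volume : Measure V)) hdisj
      fun k _ => Metric.isOpen_ball.measurableSet
    calc (N : ENNReal) * volume (Metric.ball (0 : V) (r / 2))
        = ∑ k ∈ Finset.range N, volume (Metric.ball (z k) (r / 2)) := by
          simp [Measure.addHaar_ball_center]
      _ = volume (⋃ k ∈ Finset.range N, Metric.ball (z k) (r / 2)) := hmeas.symm
      _ ≤ volume K := measure_mono (Set.iUnion₂_subset hsub)
  obtain ⟨N, hN⟩ := ENNReal.exists_nat_mul_gt
    (Metric.measure_ball_pos (volume : Measure V) 0 (half_pos hr)).ne' hf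
  exact hN.not_ge (hpack N)

end Pizza

end

noncomputable section

namespace Pizza

variable {V : Type*} [NormedAddCommGroup V] [InnerProductSpace ℝ V] [FiniteDimensional ℝ V]
  [MeasurableSpace V] [BorelSpace V]

/-! ### Slices by lines -/

lemma volOn_line {ℓ : Submodule ℝ V} (hℓ : Module.finrank ℝ ℓ = 1) {u : V} (hu : u ∈ ℓ)
    (hn : ‖u‖ = 1) : volOn ℓ = (volume : Measure ℝ).map (fun t => t • u) := by
  have hspan : Submodule.span ℝ {u} = ℓ := by
    refine Submodule.eq_of_le_of_finrank_eq ?_ ?_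
    · rwa [Submodule.span_singleton_le_iff_mem]
    · rw [hℓ, finrank_span_singleton]
      rintro rfl
      simp at hn
  subst hspan
  rw [volOn, lebesgue,
    ← (LinearIsometryEquiv.toSpanUnitSingleton (𝕜 := ℝ) u hn).measurePreserving.map_eq,
    Measure.map_map measurable_subtype_coe (LinearIsometryEquiv.continuous _).measurable]
  rfl

/-- The only hyperplane of a line is `{0}`, so the sign function is plus or minus the usual sign. -/
lemma exists_sgn_line {E : Finset V} {ℓ : Submodule ℝ V} {B : Set (Submodule ℝ V)}
    (h : IsGen E ℓ B) (hℓ : Module.finrank ℝ ℓ = 1) (hB : B ≠ ∅) {u : V} (hu : u ∈ ℓ)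
    (hn : ‖u‖ = 1) : ∃ κ : ℝ, κ ≠ 0 ∧ ∀ t : ℝ, t ≠ 0 → sgn ℓ B (t • u) = κ * Real.sign t := by
  have hbot : ∀ M ∈ B, M = ⊥ := fun M hM => by
    have := finrank_lt_of_mem h hM
    exact Submodule.finrank_eq_zero.1 (by omega)
  have hcomp : ∀ t : ℝ, t ≠ 0 → t • u ∈ complementIn ℓ B := by
    intro t ht
    refine mem_complementIn.2 ⟨ℓ.smul_mem _ hu, fun M hM hin => ?_⟩
    rw [hbot M hM, Submodule.mem_bot, smul_eq_zero] at hin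
    rcases hin with h0 | rfl
    · exact ht h0
    · simp at hn
  obtain ⟨M, hM⟩ := Set.nonempty_iff_ne_empty.2 hB
  have hBM : h.finite.toFinset = {M} := by
    ext N
    rw [Set.Finite.mem_toFinset, Finset.mem_singleton]
    exact ⟨fun hN => by rw [hbot N hN, hbot M hM], fun hN => hN ▸ hM⟩
  obtain ⟨r, hr⟩ := h.exists_rep
  have hin : ∀ t : ℝ, t ≠ 0 → ⟪r M, t • u⟫ ≠ 0 := fun t ht => by
    refine inner_ne_zero_of_notMem (ℓ.smul_mem _ hu) ?_
    rw [← (hr M hM).2.1]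
    exact (mem_complementIn.1 (hcomp t ht)).2 M hM
  have h1 : ⟪r M, u⟫ ≠ 0 := by simpa using hin 1 one_ne_zero
  have hp : ⟪r M, basePoint ℓ B⟫ ≠ 0 := by
    have hb := mem_complementIn.1 (basePoint_mem h)
    refine inner_ne_zero_of_notMem hb.1 ?_
    rw [← (hr M hM).2.1]
    exact hb.2 M hM
  refine ⟨Real.sign ⟪r M, basePoint ℓ B⟫ * Real.sign ⟪r M, u⟫,
    mul_ne_zero ((Real.sign_eq_zero_iff.not).2 hp) ((Real.sign_eq_zero_iff.not).2 h1), fun t ht => ?_⟩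
  rw [sgn_eq_prod h hr (hcomp t ht), hBM, Finset.prod_singleton, Finset.prod_singleton,
    inner_smul_right, mul_assoc]
  have := sign_affine (α := 0) (t := t) h1
  rw [zero_add, neg_zero, zero_div, sub_zero] at this
  rw [this]

/-- A slice of a bounded convex set by a line is a bounded interval, hence measurable of finite
length. The symmetry condition is thus available for every slice, not just for almost every one. -/
lemma setIntegral_sign_line_eq_zero {E : Finset V} {K : Set V} (hKc : Convex ℝ K)
    (hKb : Bornology.IsBounded K) (hE : ∀ e ∈ E, ‖e‖ = 1) (hK : RelSymm E ⊤ (arr E) K)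
    {s : List V} (hs : IsEvenSeq E ⊤ (arr E) s)
    (hℓ : Module.finrank ℝ (flagSpace ⊤ s) = 1) (hB : flagArr ⊤ (arr E) s ≠ ∅) {u : V}
    (hu : u ∈ flagSpace ⊤ s) (hn : ‖u‖ = 1) {x : V} (hx : x ∈ (flagSpace ⊤ s)ᗮ) :
    Convex ℝ {t : ℝ | x + t • u ∈ K} ∧ volume {t : ℝ | x + t • u ∈ K} ≠ ⊤ ∧
      ∫ t in {t : ℝ | x + t • u ∈ K}, Real.sign t = 0 := by
  have hu0 : u ≠ 0 := by rintro rfl; simp at hn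
  have hemb : MeasurableEmbedding fun t : ℝ => t • u :=
    (isClosedEmbedding_smul_left hu0).measurableEmbedding
  have hvol := volOn_line hℓ hu hn
  set I := {t : ℝ | x + t • u ∈ K} with hI
  have hpre : (fun t : ℝ => t • u) ⁻¹' translateSet K (-x) = I := by
    ext t
    rw [mem_preimage, mem_translateSet, sub_neg_eq_add, add_comm, hI, mem_ofPred_eq]
  have hconv : Convex ℝ I := by
    intro t ht t' ht' a b ha hb hab
    have h1 := hKc ht ht' ha hb hab
    rw [hI, mem_ofPred_eq]
    convert h1 using 1
    have h2 : x = (a + b) • x := by rw [hab, one_smul]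
    conv_lhs => rw [h2]
    simp only [smul_eq_mul]
    module
  have hfin : volume I ≠ ⊤ := by
    obtain ⟨R, hR⟩ := hKb.subset_closedBall 0
    have hsub : I ⊆ Icc (-(R + ‖x‖)) (R + ‖x‖) := fun t ht => by
      have h1 := mem_closedBall_zero_iff.1 (hR ht)
      have h2 : ‖t • u‖ ≤ ‖x + t • u‖ + ‖x‖ := by
        have := norm_sub_le (x + t • u) x
        rwa [add_sub_cancel_left] at this
      rw [norm_smul, hn, mul_one, Real.norm_eq_abs] at h2
      exact abs_le.1 (by linarith)
    exact measure_ne_top_of_subset hsub (by simp)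
  have hIm : MeasurableSet I := hconv.ordConnected.measurableSet
  refine ⟨hconv, hfin, ?_⟩
  have hnull : NullMeasurableSet (translateSet K (-x)) (volOn (flagSpace ⊤ s)) := by
    refine ⟨(fun t : ℝ => t • u) '' I, hemb.measurableSet_image' hIm, ?_⟩
    have hr : ∀ᵐ y ∂volOn (flagSpace ⊤ s), y ∈ Set.range fun t : ℝ => t • u := by
      rw [hvol]
      exact (ae_map_iff hemb.measurable.aemeasurable hemb.measurableSet_range).2
        (Eventually.of_forall fun t => mem_range_self t)
    filter_upwards [hr] with y hy
    obtain ⟨t, rfl⟩ := hy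
    refine propext ?_
    change t • u ∈ translateSet K (-x) ↔ t • u ∈ (fun t : ℝ => t • u) '' I
    rw [← hpre]
    exact ⟨fun h => ⟨t, h, rfl⟩, fun ⟨t', h, h'⟩ => hemb.injective h' ▸ h⟩
  have hfin' : volOn (flagSpace ⊤ s) (translateSet K (-x)) ≠ ⊤ := by
    rw [hvol, hemb.map_apply, hpre]
    exact hfin
  have h0 := hK s hs hB (-x) trivial (Submodule.neg_mem _ hx) hnull hfin'
  obtain ⟨κ, hκ, hsgn⟩ := exists_sgn_line (hs.isGen (isGen_arr hE)) hℓ hB hu hn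
  rw [signedVol, hvol, hemb.setIntegral_map, hpre] at h0
  have hae : ∀ᵐ t : ℝ ∂volume.restrict I,
      sgn (flagSpace ⊤ s) (flagArr ⊤ (arr E) s) (t • u) = κ * Real.sign t := by
    refine ae_restrict_of_ae ?_
    filter_upwards [compl_mem_ae_iff.2 (measure_singleton (0 : ℝ))] with t ht
    exact hsgn t ht
  rw [integral_congr_ae hae, integral_const_mul] at h0
  exact (mul_eq_zero.1 h0).resolve_left hκ

/-- A bounded convex sufficiently symmetric set is symmetric, up to closure, with respect to the
hyperplanes orthogonal to the lines reached by even restriction sequences. -/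
lemma reflect_mem_closure {E : Finset V} {K : Set V} (hKc : Convex ℝ K)
    (hKb : Bornology.IsBounded K) (hi : (interior K).Nonempty) (hE : ∀ e ∈ E, ‖e‖ = 1)
    (hK : RelSymm E ⊤ (arr E) K) {s : List V} (hs : IsEvenSeq E ⊤ (arr E) s)
    (hℓ : Module.finrank ℝ (flagSpace ⊤ s) = 1) (hB : flagArr ⊤ (arr E) s ≠ ∅) {u : V}
    (hu : u ∈ flagSpace ⊤ s) (hn : ‖u‖ = 1) {x : V} (hx : x ∈ closure K) :
    reflect u x ∈ closure K := by
  -- For `x` in the interior, `⟪u, x⟫` is interior to the balanced interval cut out by the line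
  -- through `x`; the opposite parameter is the reflected point.
  have hpos : ∀ u ∈ flagSpace ⊤ s, ‖u‖ = 1 → ∀ x ∈ interior K, 0 < ⟪u, x⟫ →
      reflect u x ∈ closure K := by
    intro u hu hn x hx hc
    have hspan : Submodule.span ℝ {u} = flagSpace ⊤ s := by
      refine Submodule.eq_of_le_of_finrank_eq ?_ ?_
      · rwa [Submodule.span_singleton_le_iff_mem]
      · rw [hℓ, finrank_span_singleton]
        rintro rfl
        simp at hn
    have hx0 : x - ⟪u, x⟫ • u ∈ (flagSpace ⊤ s)ᗮ := by
      rw [← hspan, Submodule.mem_orthogonal_singleton_iff_inner_right, inner_sub_right,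
        inner_smul_right, real_inner_self_eq_norm_sq, hn]
      ring
    obtain ⟨h1, h2, h3⟩ := setIntegral_sign_line_eq_zero hKc hKb hE hK hs hℓ hB hu hn hx0
    have hcont : Continuous fun t : ℝ => x - ⟪u, x⟫ • u + t • u := by fun_prop
    have hnhds : {t : ℝ | x - ⟪u, x⟫ • u + t • u ∈ K} ∈ 𝓝 ⟪u, x⟫ := by
      refine hcont.continuousAt.preimage_mem_nhds ?_
      rw [sub_add_cancel]
      exact mem_interior_iff_mem_nhds.1 hx
    have h4 := neg_mem_closure_of_integral_sign_eq_zero h1 h2 h3 hc hnhds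
    have h5 : x - ⟪u, x⟫ • u + (-⟪u, x⟫) • u ∈ closure K :=
      map_mem_closure (f := fun t : ℝ => x - ⟪u, x⟫ • u + t • u) hcont h4 fun t ht => ht
    have h6 : reflect u x = x - ⟪u, x⟫ • u + (-⟪u, x⟫) • u := by
      unfold reflect
      module
    rwa [h6]
  have hint : ∀ x ∈ interior K, reflect u x ∈ closure K := by
    intro x hx
    rcases lt_trichotomy ⟪u, x⟫ 0 with h | h | h
    · have h1 := hpos (-u) ((flagSpace ⊤ s).neg_mem hu) (by rwa [norm_neg]) x hx
        (by rw [inner_neg_left]; linarith)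
      have h2 : reflect (-u) x = reflect u x := by
        simp only [reflect, inner_neg_left]
        module
      rwa [h2] at h1
    · rw [reflect, h, mul_zero, zero_smul, sub_zero]
      exact subset_closure (interior_subset hx)
    · exact hpos u hu hn x hx h
  rw [← hKc.closure_interior_eq_closure_of_nonempty_interior hi] at hx
  have := map_mem_closure (continuous_reflect u) hx hint
  rwa [closure_closure] at this

/-- An even arrangement and a convex sufficiently symmetric set: the containment condition holds
for the interior points. -/
lemma contains_of_neg_mem_interior {E : Finset V} {K : Set V} (hKc : Convex ℝ K)
    (hKb : Bornology.IsBounded K) (hE : ∀ e ∈ E, ‖e‖ = 1) (hev : IsEvenArr E)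
    (hK : RelSymm E ⊤ (arr E) K) {a : V} (ha : -a ∈ interior K) : Contains E K a := by
  have hi : (interior K).Nonempty := ⟨_, ha⟩
  have hgen := isGen_arr hE
  intro s hs ts _ hp hts
  have hs' : IsEvenSeq E ⊤ (arr E) s := hs.1
  obtain ⟨r, hr, hball⟩ := Metric.isOpen_iff.1 isOpen_interior _ ha
  -- Reflections are known to preserve only the closure of `K`. This closed convex set keeps a
  -- margin `r / 2`: it inherits the invariance, since reflections are isometries, contains `-a`,
  -- and lies in `K` itself.
  set C := {x : V | Metric.closedBall x (r / 2) ⊆ closure K} with hC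
  have hCmem : ∀ x, x ∈ C ↔ ∀ v : V, ‖v‖ ≤ r / 2 → x + v ∈ closure K := by
    intro x
    rw [hC, mem_ofPred_eq]
    refine ⟨fun h v hv => h (by simpa [Metric.mem_closedBall, dist_eq_norm] using hv),
      fun h y hy => ?_⟩
    have := h (y - x) (by rwa [Metric.mem_closedBall, dist_eq_norm] at hy)
    rwa [add_sub_cancel] at this
  have hCclosed : IsClosed C := by
    have : C = ⋂ v ∈ Metric.closedBall (0 : V) (r / 2), (fun x => x + v) ⁻¹' closure K := by
      ext x
      simp [hCmem]
    rw [this]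
    exact isClosed_biInter fun v _ => isClosed_closure.preimage (by fun_prop)
  have hCconv : Convex ℝ C := by
    intro x hx y hy c d hc hd hcd
    rw [hCmem] at hx hy ⊢
    intro v hv
    have h1 := hKc.closure (hx v hv) (hy v hv) hc hd hcd
    convert h1 using 1
    have h2 : v = (c + d) • v := by rw [hcd, one_smul]
    conv_lhs => rw [h2]
    module
  have haC : -a ∈ C := by
    refine (Metric.closedBall_subset_ball (half_lt_self hr)).trans (hball.trans ?_)
    exact interior_subset.trans subset_closure
  have hCK : C ⊆ K := fun x hx => by
    have h1 : x ∈ interior (closure K) :=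
      mem_interior_iff_mem_nhds.2
        (mem_of_superset (Metric.closedBall_mem_nhds x (half_pos hr)) hx)
    rw [hKc.interior_closure_eq_interior_of_nonempty_interior hi] at h1
    exact interior_subset h1
  have hproj : ∀ i, -(proj ⊤ a - proj (flagSpace ⊤ (s.take i)) a) ∈ C := by
    intro i
    have hti : IsEvenSeq E ⊤ (arr E) (s.take i) := by
      have := List.take_append_drop i s ▸ hs'
      exact (isEvenSeq_append.1 this).1
    set W := flagSpace ⊤ (s.take i) with hW
    -- The unit vectors on the lines reached by continuing the truncated sequence; by evenness they
    -- span `W`.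
    set U : Set V := {u | ‖u‖ = 1 ∧ ∃ t, IsEvenSeq E W (flagArr ⊤ (arr E) (s.take i)) t ∧
      Module.finrank ℝ (flagSpace W t) = 1 ∧ u ∈ flagSpace W t} with hU
    have key := sub_proj_mem_of_reflect (W := W) (U := U) hCclosed hCconv ?_ ?_ ?_ haC
    · convert key using 1
      rw [proj_top, proj, proj, map_neg]
      abel
    · rintro u ⟨-, t, -, -, hu⟩
      exact flagSpace_le W t hu
    · intro x hx
      refine inner_eq_zero_of_lines (E := E) _ W (flagArr ⊤ (arr E) (s.take i)) le_rfl
        (hti.isGen hgen) (fun t ht => ?_) x fun t ht h1 u hu => ?_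
      · have := hev _ (show s.take i ++ t ∈ evenSeqs E from isEvenSeq_append.2 ⟨hti, ht⟩)
        rwa [flagSpace_append, flagArr_append] at this
      · by_cases hu0 : u = 0
        · rw [hu0, inner_zero_left]
        have h2 := hx (‖u‖⁻¹ • u) ⟨norm_smul_inv_norm hu0, t, ht, h1, Submodule.smul_mem _ _ hu⟩
        rw [real_inner_smul_left] at h2
        exact (mul_eq_zero.1 h2).resolve_left (inv_ne_zero (norm_ne_zero_iff.2 hu0))
    · rintro u ⟨hn, t, ht, h1, hu⟩ x hx
      have hst : IsEvenSeq E ⊤ (arr E) (s.take i ++ t) := isEvenSeq_append.2 ⟨hti, ht⟩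
      rw [hW, ← flagSpace_append] at h1 hu
      have hne : flagArr ⊤ (arr E) (s.take i ++ t) ≠ ∅ := fun h0 => by
        rw [hev.flagSpace_eq_bot hst h0, finrank_bot] at h1
        exact zero_ne_one h1
      rw [hCmem] at hx ⊢
      intro v hv
      have hv' : ‖reflect u v‖ ≤ r / 2 := by
        have := norm_reflect_sub hn v 0
        have h0 : reflect u (0 : V) = 0 := by simp [reflect]
        rw [h0, sub_zero, sub_zero] at this
        rwa [this]
      have h2 := reflect_mem_closure hKc hKb hi hE hK hst h1 hne hu hn (hx _ hv')
      convert h2 using 1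
      conv_lhs => rw [← reflect_reflect hn v]
      simp only [reflect, inner_add_right, inner_sub_right]
      module
  obtain ⟨y, hy, hyt⟩ := exists_neg_shift_eq_smul a s ⊤ C hCconv hproj 1 ts zero_le_one hp hts
  rw [hyt, one_smul]
  exact hCK hy

/-! ### Continuity of the pizza quantity -/

/-- Dominated convergence: `sgn` is bounded, and locally constant off the hyperplanes, which form a
null set. -/
lemma continuous_setIntegral_sgn {E : Finset V} {A : Set (Submodule ℝ V)} (h : IsGen E ⊤ A)
    {K : Set V} (hK : volOn (⊤ : Submodule ℝ V) K ≠ ⊤) :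
    Continuous fun b : V => ∫ x in K, sgn ⊤ A (x + b) ∂volOn ⊤ := by
  rw [continuous_iff_continuousAt]
  intro a
  have hmp : ∀ b : V, MeasurePreserving (fun x : V => x + b) (volOn ⊤) (volOn ⊤) :=
    fun b => measurePreserving_add_volOn (L := ⊤) trivial
  refine continuousAt_of_dominated (bound := fun _ => 1) (Eventually.of_forall fun b => ?_)
    (Eventually.of_forall fun b => Eventually.of_forall fun x => ?_) (integrableOn_const hK)
    (ae_restrict_of_ae ?_)
  · exact ((aestronglyMeasurable_sgn h).comp_measurePreserving (hmp b)).restrict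
  · rw [Real.norm_eq_abs, abs_sgn]
  · filter_upwards [(hmp a).quasiMeasurePreserving.ae (ae_mem_complementIn h)] with x hx
    obtain ⟨r, hr⟩ := h.exists_rep
    have hev : ∀ᶠ b in 𝓝 a, ∀ M ∈ A, 0 < ⟪r M, x + a⟫ * ⟪r M, x + b⟫ := by
      refine (eventually_all_finite h.finite).2 fun M hM => ?_
      have hc : Continuous fun b => ⟪r M, x + a⟫ * ⟪r M, x + b⟫ := by fun_prop
      refine (hc.tendsto a).eventually (lt_mem_nhds (mul_self_pos.2 ?_))
      refine inner_ne_zero_of_notMem (L := ⊤) trivial ?_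
      rw [← (hr M hM).2.1]
      exact (mem_complementIn.1 hx).2 M hM
    refine (continuousAt_const (y := sgn ⊤ A (x + a))).congr ?_
    filter_upwards [hev] with b hb
    exact relSign_congr_of_mem_cell h hx ((mem_cell_iff hr hx).2 ⟨trivial, hb⟩)
      (mem_complementIn.1 (basePoint_mem h)).1

/-- The identity holds when `-a` is interior to `K`. Both sides are continuous in `a`, and the
interior of a convex set, when nonempty, is dense in its closure. -/
theorem pizza_translateSet_eq_pizzaPoly_of_convex {E : Finset V} (hE : ∀ e ∈ E, ‖e‖ = 1)
    (hev : IsEvenArr E) {p : V} (hp : p ∈ baseChamber E) {K : Set V}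
    (hK : NullMeasurableSet K volume) (hKf : volume K ≠ ⊤) (hs : SuffSymm E K)
    (hKc : Convex ℝ K) (hK0 : volume K ≠ 0) {a : V} (ha : 0 ∈ translateSet K a) :
    pizza ⊤ (arr E) (baseChamber E) (translateSet K a) = pizzaPoly E a := by
  have hi : (interior K).Nonempty := by
    rw [Set.nonempty_iff_ne_empty]
    intro h
    -- With empty interior, `K` would lie in its frontier, which is null for a convex set.
    refine hK0 (measure_mono_null ?_ (hKc.addHaar_frontier volume))
    rw [frontier, h, sdiff_empty]
    exact subset_closure
  have hKb := isBounded_of_convex_of_volume_ne_top hKc hi hKf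
  have hgen := isGen_arr hE
  have hKf' : volOn (⊤ : Submodule ℝ V) K ≠ ⊤ := by rwa [volOn_top]
  have hpizza : ∀ b, pizza ⊤ (arr E) (baseChamber E) (translateSet K b) =
      sgn ⊤ (arr E) p * ∫ x in K, sgn ⊤ (arr E) (x + b) ∂volOn ⊤ := fun b => by
    have hb : volOn (⊤ : Submodule ℝ V) (translateSet K b) ≠ ⊤ := by
      rwa [volOn_translateSet (by rwa [volOn_top]) Submodule.mem_top]
    rw [baseChamber_eq_cell hp, pizza_eq_signedVol hgen hb (mem_complementIn_arr hp),
      signedVol_translateSet Submodule.mem_top]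
  have hclosed : IsClosed {z : V | pizza ⊤ (arr E) (baseChamber E) (translateSet K (-z)) =
      pizzaPoly E (-z)} := by
    simp only [hpizza]
    exact isClosed_eq (((continuous_const.mul (continuous_setIntegral_sgn hgen hKf'))).comp
      continuous_neg) ((continuous_pizzaPoly hE hev hp).comp continuous_neg)
  have hsub : interior K ⊆ {z : V | pizza ⊤ (arr E) (baseChamber E) (translateSet K (-z)) =
      pizzaPoly E (-z)} := fun z hz =>
    pizza_translateSet_eq_pizzaPoly hE hev hp hK hKf hs
      (contains_of_neg_mem_interior hKc hKb hE hev (hs.relSymm hE) (by rwa [neg_neg]))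
  have hmem : -a ∈ closure (interior K) := by
    rw [hKc.closure_interior_eq_closure_of_nonempty_interior hi]
    rw [mem_translateSet, zero_sub] at ha
    exact subset_closure ha
  have h1 := closure_minimal hsub hclosed hmem
  rwa [mem_ofPred_eq, neg_neg] at h1

end Pizza

end

/-! ### The three assertions assembled -/

open Pizza
theorem corollary5p3 {V : Type*} [NormedAddCommGroup V] [InnerProductSpace ℝ V]
    [FiniteDimensional ℝ V] [MeasurableSpace V] [BorelSpace V]
    (E : Finset V) (hunit : ∀ e ∈ E, ‖e‖ = 1) (hbase : (baseChamber E).Nonempty) :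
    -- the signed products do not depend on the representative of a class
    (∀ s ∈ maxEvenSeqs E, ∀ s' ∈ maxEvenSeqs E, (flagSetoid V).r s s' → ∀ a : V,
      seqSign E s * normalProd a ⊤ s = seqSign E s' * normalProd a ⊤ s') ∧
    -- the formula for a sufficiently symmetric set
    (∀ K : Set V, NullMeasurableSet K volume → volume K ≠ ⊤ → SuffSymm E K → ∀ a : V,
      pizza ⊤ (arr E) (baseChamber E) (translateSet K a) =
        sumMod (maxEvenSeqs E) (summand E K a)) ∧
    -- the case of an even arrangement
    (IsEvenArr E →
      (∀ b : Module.Basis (Fin (Module.finrank ℝ V)) ℝ V,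
        ∃ p : MvPolynomial (Fin (Module.finrank ℝ V)) ℝ,
          p.IsHomogeneous (Module.finrank ℝ V) ∧
          ∀ a : V, pizzaPoly E a = MvPolynomial.eval (fun i => b.repr a i) p) ∧
      (∀ K : Set V, NullMeasurableSet K volume → volume K ≠ ⊤ → SuffSymm E K → ∀ a : V,
        Contains E K a ∨ (Convex ℝ K ∧ volume K ≠ 0 ∧ 0 ∈ translateSet K a) →
        pizza ⊤ (arr E) (baseChamber E) (translateSet K a) = pizzaPoly E a)) := by
  obtain ⟨p, hp⟩ := hbase
  refine ⟨fun s hs s' hs' hr a => ?_,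
    fun K hK hKf hsymm a => pizza_translateSet_eq_sumMod hunit hp hK hKf hsymm a,
    fun hev => ⟨fun b => isHomogPoly_pizzaPoly hunit hev hp b,
      fun K hK hKf hsymm a hc => ?_⟩⟩
  · rw [seqSign_mul_normalProd hunit hp hs, seqSign_mul_normalProd hunit hp hs',
      flagSetoid_iff.1 hr]
  · rcases hc with hc | ⟨hconv, h0, ha⟩
    · exact pizza_translateSet_eq_pizzaPoly hunit hev hp hK hKf hsymm hc
    · exact pizza_translateSet_eq_pizzaPoly_of_convex hunit hev hp hK hKf hsymm hconv h0 ha
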